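/- Let $f_\varepsilon$, $\varepsilon$ in a neighbourhood of $0\in\mathbb R^2$, be a family of symplectic (area- and orientation-preserving) diffeomorphisms of the plane, jointly $C^r$ in the point and the parameter, $5\le r\le\infty$. Assume that $f_0$ has a saddle fixed point $O$ with eigenvalues $\lambda,\lambda^{-1}$, $0<|\lambda|<1$; that $W^u(O)$ and $W^s(O)$ have a cubic tangency at the points of a homoclinic orbit $\Gamma_0$; and that the family unfolds this tangency generally, i.e. is transverse at $\varepsilon=0$ to the codimension-two surface of maps having a cubic homoclinic tangency near $\Gamma_0$: if $s(\varepsilon,t)$ measures the splitting of $W^u(O_\varepsilon)$ and $W^s(O_\varepsilon)$ along a regular parametrization $t$ of $W^u(O_\varepsilon)$ near the tangency point ($t=0$ at $\varepsilon=0$), then $\varepsilon\mapsto(s,\partial_t s)(\varepsilon,0)$ has nonzero Jacobian at $\varepsilon=0$. Then there is a jointly $C^r$ family of canonical coordinates $(x,y)$ near $O$, depending on $\varepsilon$, with the fixed point $O_\varepsilon$ at the origin and with $W^s_{loc}(O_\varepsilon)=\{y=0\}$, $W^u_{loc}(O_\varepsilon)=\{x=0\}$, and there are points $M^-=(0,y^-_0)$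 and $M^+=(x^+,0)=f_0^q(M^-)$, $q\ge 0$, of $\Gamma_0$ in the domain of these coordinates. Moreover, for every such choice of $M^\pm$ and of such coordinates, jointly of class $C^k$ with $4\le k\le r$, the following holds. Let $G(x,y,\varepsilon)$ be the $y$-coordinate of $T_1(x,y)$, where $T_1=f_\varepsilon^q$ is the global map from a neighbourhood of $M^-$ to a neighbourhood of $M^+$, and let $6d=\partial_y^3G(0,y^-_0,0)$. Then $d\ne0$, and there are a $C^{k-2}$ function $y^-(\varepsilon)$ with $y^-(0)=y_0^-$, $\partial_y^2G(0,y^-(\varepsilon),\varepsilon)=0$, and new parameters $$\mu_1=G(0,y^-(\varepsilon),\varepsilon),\qquad \mu_2=\partial_yG(0,y^-(\varepsilon),\varepsilon)$$ such that $\varepsilon\mapsto\mu=(\mu_1,\mu_2)$ is a $C^{k-2}$ diffeomorphism between neighbourhoods of $0$ sending $0$ to $0$. Write $f_\mu$, $O_\mu$ for the map and its saddle in the new parameters. In a neighbourhood of $0$ in the $(\mu_1,\mu_2)$-plane there is a bifurcation curve $$H_0:\quad \mu_1=\pm2d\left[-\frac{\mu_2}{3d}\bigl(1+\rho_\pm(\mu_2)\bigr)\right]^{3/2},\qquad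 -\frac{\mu_2}{3d}\ge0,$$ where $\rho_\pm$ are continuous and $\rho_\pm(\mu_2)=O(\sqrt{|\mu_2|})$, such that $\mu\in H_0$ if and only if the curve $T_1(W^u_{loc}(O_\mu))$ is tangent to $W^s_{loc}(O_\mu)$ near $M^+$. For $\mu\in H_0$ the map $f_\mu$ has a homoclinic orbit to $O_\mu$, tending to $\Gamma_0$ (uniformly along the orbit) as $\mu\to0$, at the points of which $W^u(O_\mu)$ and $W^s(O_\mu)$ are tangent; the tangency is quadratic for $\mu\ne0$ and cubic for $\mu=0$. -/

import Mathlib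

open Set Filter Topology

/-- The phase plane. -/
abbrev Plane : Type := ℝ × ℝ

/-- The plane of the two parameters. -/
abbrev Params : Type := ℝ × ℝ

/-- `f` is a family of symplectic (area and orientation preserving) diffeomorphisms of the plane,
jointly of class `C^r` in the phase point and in the parameter `ε ∈ V`. The inverse maps are of
class `C^r` as well, because the Jacobian determinant is `1`. -/
structure IsSymplecticFamily (r : ℕ∞) (V : Set Params) (f : Params → Equiv.Perm Plane) :
    Prop where
  isOpen : IsOpen V
  zero_mem : (0 : Params) ∈ V
  contDiffOn : ContDiffOn ℝ r (fun x : Params × Plane => f x.1 x.2) (V ×ˢ univ)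
  det_eq_one : ∀ ε ∈ V, ∀ z : Plane, (fderiv ℝ (f ε) z).det = 1

/-- `p` is a saddle fixed point of `g` with eigenvalues `lam`, `lam⁻¹`, where `0 < |lam| < 1`. -/
structure IsSaddle (g : Equiv.Perm Plane) (p : Plane) (lam : ℝ) : Prop where
  fixed : g p = p
  pos : 0 < |lam|
  lt_one : |lam| < 1
  eigen_stable :
    Module.End.HasEigenvalue ((fderiv ℝ g p : Plane →L[ℝ] Plane) : Plane →ₗ[ℝ] Plane) lam
  eigen_unstable :
    Module.End.HasEigenvalue ((fderiv ℝ g p : Plane →L[ℝ] Plane) : Plane →ₗ[ℝ] Plane) lam⁻¹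

/-- The stable set `W^s(p)`. -/
def stableSet (g : Equiv.Perm Plane) (p : Plane) : Set Plane :=
  {z | Tendsto (fun n : ℕ => (g ^ n) z) atTop (𝓝 p)}

/-- The unstable set `W^u(p)`. -/
def unstableSet (g : Equiv.Perm Plane) (p : Plane) : Set Plane :=
  {z | Tendsto (fun n : ℕ => (g ^ n).symm z) atTop (𝓝 p)}

/-- `z` is a homoclinic point of `g` to `p`. -/
def IsHomoclinic (g : Equiv.Perm Plane) (p z : Plane) : Prop :=
  z ≠ p ∧ z ∈ unstableSet g p ∧ z ∈ stableSet g p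

/-- `W^u(p)` and `W^s(p)` have a contact of order exactly `m` at `z`: there are a regular curve `γ`
parametrizing a piece of `W^u(p)` through `z`, and a function `h` with nonzero differential
at `z` whose zero set near `z` is a piece of `W^s(p)`, such that `h ∘ γ` has a zero of
multiplicity exactly `m + 1` at `0`. (A piece of an invariant manifold is a piece on which the
iterates converge to `p` uniformly.) Thus `m = 0` is a transverse intersection, `m = 1` a quadratic
tangency, and `m = 2` a cubic tangency. -/
def HasContact (g : Equiv.Perm Plane) (p z : Plane) (m : ℕ) : Prop :=
  ∃ (γ : ℝ → Plane) (h : Plane → ℝ),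
    ContDiffAt ℝ ((m + 1 : ℕ) : WithTop ℕ∞) γ 0 ∧ γ 0 = z ∧ deriv γ 0 ≠ 0 ∧
    (∃ I ∈ 𝓝 (0 : ℝ),
      TendstoUniformlyOn (fun (n : ℕ) t => (g ^ n).symm (γ t)) (fun _ => p) atTop I) ∧
    ContDiffAt ℝ ((m + 1 : ℕ) : WithTop ℕ∞) h z ∧ fderiv ℝ h z ≠ 0 ∧
    (∃ N ∈ 𝓝 z,
      TendstoUniformlyOn (fun (n : ℕ) w => (g ^ n) w) (fun _ => p) atTop {w ∈ N | h w = 0}) ∧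
    (∀ j ≤ m, iteratedDeriv j (h ∘ γ) 0 = 0) ∧ iteratedDeriv (m + 1) (h ∘ γ) 0 ≠ 0

/-- Quadratic tangency of `W^u(p)` and `W^s(p)` at `z`. -/
def QuadraticTangency (g : Equiv.Perm Plane) (p z : Plane) : Prop := HasContact g p z 1

/-- Cubic tangency of `W^u(p)` and `W^s(p)` at `z`. -/
def CubicTangency (g : Equiv.Perm Plane) (p z : Plane) : Prop := HasContact g p z 2

/-- `p ε` is the continuation of the fixed point `O` of `f 0`, and, for all `ε` near `0`, the curve
`t ↦ γ (ε, t)` near `t = 0` parametrizes a piece of `W^u(p ε)` and the equation `h (ε, z) = 0` near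
`z = M` describes a piece of `W^s(p ε)`; for `ε = 0` both pieces pass through `M`. -/
structure DescribesManifolds (f : Params → Equiv.Perm Plane) (O M : Plane) (p : Params → Plane)
    (h : Params × Plane → ℝ) (γ : Params × ℝ → Plane) : Prop where
  p_zero : p 0 = O
  p_cont : ContinuousAt p 0
  p_fixed : ∀ᶠ ε in 𝓝 (0 : Params), f ε (p ε) = p ε
  γ_smooth : ContDiffAt ℝ 2 γ (0, 0)
  γ_zero : γ (0, 0) = M
  γ_regular : deriv (fun t => γ (0, t)) 0 ≠ 0
  γ_unstable : ∃ I ∈ 𝓝 ((0, 0) : Params × ℝ),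
    TendstoUniformlyOn (fun (n : ℕ) x => (f x.1 ^ n).symm (γ x)) (fun x => p x.1) atTop I
  h_smooth : ContDiffAt ℝ 2 h (0, M)
  h_zero : h (0, M) = 0
  h_regular : fderiv ℝ (fun z => h (0, z)) M ≠ 0
  h_stable : ∃ N ∈ 𝓝 ((0, M) : Params × Plane),
    TendstoUniformlyOn (fun (n : ℕ) x => (f x.1 ^ n) x.2) (fun x => p x.1) atTop
      {x ∈ N | h x = 0}

/-- The family is transverse at `ε = 0` to the surface of maps having a cubic tangency near `M`.
If `s (ε, t) = h (ε, γ (ε, t))` measures the splitting of the two manifolds, that surface is given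
near `f 0` by two equations in the coefficients of `s` (the value of `s` and of its
`t`-derivative at the zero of the second `t`-derivative), and transversality says that these two
coefficients have nonzero Jacobian in `ε` at `0`. As `s`, `∂s/∂t`, `∂²s/∂t²` all vanish at the
tangency, this Jacobian may be computed at `t = 0`, and its non-vanishing does not depend on the
choice of `γ` and `h`. -/
def UnfoldsGenerally (f : Params → Equiv.Perm Plane) (O M : Plane) : Prop :=
  ∀ (p : Params → Plane) (h : Params × Plane → ℝ) (γ : Params × ℝ → Plane),
    DescribesManifolds f O M p h γ →
    (fderiv ℝ (fun ε : Params =>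
      ((h (ε, γ (ε, 0)), deriv (fun t => h (ε, γ (ε, t))) 0) : Params)) 0).det ≠ 0

/-- A family of local coordinates, `Θ (ε, z) = (ε, (x, y))`. `atPoint Θ ε w` is the point of the
plane that has the coordinates `w = (x, y)` for the parameter `ε`. -/
def atPoint (Θ : OpenPartialHomeomorph (Params × Plane) (Params × Plane)) (ε : Params)
    (w : ℝ × ℝ) : Plane := (Θ.symm (ε, w)).2

/-- `Θ` is a `C^k` family of canonical coordinates `(x, y)` on a neighbourhood `U₀` of `O` (the
box `|x|, |y| < R`, for `‖ε‖ < δ`), with the fixed point `O_ε` at the origin, in which the local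
stable manifold is the `x`-axis and the local unstable manifold is the `y`-axis: the axes are
invariant for the map and for its inverse, respectively, and are contracted to the origin. -/
structure IsAdaptedChart (k : ℕ∞) (V : Set Params) (f : Params → Equiv.Perm Plane) (O : Plane)
    (Θ : OpenPartialHomeomorph (Params × Plane) (Params × Plane)) (δ R : ℝ) : Prop where
  δ_pos : 0 < δ
  R_pos : 0 < R
  ball_subset : Metric.ball (0 : Params) δ ⊆ V
  target_eq : Θ.target = Metric.ball (0 : Params) δ ×ˢ Metric.ball (0 : ℝ × ℝ) R
  fst_eq : ∀ x ∈ Θ.source, (Θ x).1 = x.1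
  origin : atPoint Θ 0 0 = O
  contDiffOn : ContDiffOn ℝ k Θ Θ.source
  contDiffOn_symm : ContDiffOn ℝ k Θ.symm Θ.target
  canonical : ∀ x ∈ Θ.source, (fderiv ℝ (fun z : Plane => (Θ (x.1, z)).2) x.2).det = 1
  axes : ∃ κ : ℝ, κ < 1 ∧ ∀ ε ∈ Metric.ball (0 : Params) δ, ∀ u : ℝ, |u| < R →
    (∃ u' : ℝ, |u'| ≤ κ * |u| ∧ f ε (atPoint Θ ε (u, 0)) = atPoint Θ ε (u', 0)) ∧
    (∃ u' : ℝ, |u'| ≤ κ * |u| ∧ (f ε).symm (atPoint Θ ε (0, u)) = atPoint Θ ε (0, u'))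

/-- The points `M⁻ = (f 0)^j M = (0, ym)` and `M⁺ = (f 0)^q M⁻ = (xp, 0)` of the orbit of `M` lie
in the domain of the adapted coordinates. -/
def IsGlobalMapData (f : Params → Equiv.Perm Plane) (M : Plane)
    (Θ : OpenPartialHomeomorph (Params × Plane) (Params × Plane)) (R : ℝ)
    (j : ℤ) (q : ℕ) (ym xp : ℝ) : Prop :=
  |ym| < R ∧ |xp| < R ∧ atPoint Θ 0 (0, ym) = (f 0 ^ j) M ∧
    atPoint Θ 0 (xp, 0) = (f 0 ^ (j + q)) M

/-- The function `G(0, y, ε)`: the `y`-coordinate of the image of the point `(0, y)` of the local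
unstable manifold under the global map `T₁ = f_ε^q`. The image of the local unstable manifold
is tangent to the local stable manifold where this function has a multiple zero. -/
def splitting (f : Params → Equiv.Perm Plane)
    (Θ : OpenPartialHomeomorph (Params × Plane) (Params × Plane)) (q : ℕ)
    (ε : Params) (y : ℝ) : ℝ :=
  (Θ (ε, (f ε ^ q) (atPoint Θ ε (0, y)))).2.2

/-- `ε ↦ μ = par ε` is the change to the splitting parameters. With `y⁻(ε) = yM ε` such that the
second `y`-derivative of `G(0, y, ε)` vanishes at `y⁻(ε)`, they are the coefficients in
`G(0, y, ε) = μ₁ + μ₂ (y - y⁻) + d (y - y⁻)³ + O((y - y⁻)⁴)`. -/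
structure IsSplittingParameter (k : ℕ∞) (f : Params → Equiv.Perm Plane)
    (Θ : OpenPartialHomeomorph (Params × Plane) (Params × Plane)) (δ : ℝ) (q : ℕ) (ym : ℝ)
    (par : OpenPartialHomeomorph Params Params) (yM : Params → ℝ) : Prop where
  zero_mem : (0 : Params) ∈ par.source
  map_zero : par 0 = 0
  source_subset : par.source ⊆ Metric.ball (0 : Params) δ
  contDiffOn : ContDiffOn ℝ (k - 2 : ℕ∞) par par.source
  contDiffOn_symm : ContDiffOn ℝ (k - 2 : ℕ∞) par.symm par.target
  yM_zero : yM 0 = ym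
  yM_smooth : ContDiffOn ℝ (k - 2 : ℕ∞) yM par.source
  fst_eq : ∀ ε ∈ par.source, (par ε).1 = splitting f Θ q ε (yM ε)
  snd_eq : ∀ ε ∈ par.source, (par ε).2 = deriv (splitting f Θ q ε) (yM ε)
  second_eq : ∀ ε ∈ par.source, iteratedDeriv 2 (splitting f Θ q ε) (yM ε) = 0

/-- The curve `μ₁ = ± 2d [-(μ₂ / (3d)) (1 + ρ±(μ₂))]^{3/2}`, on the side of `μ₂ = 0` where
`-μ₂ / (3d) ≥ 0`. -/
def curveH0 (d : ℝ) (ρp ρm : ℝ → ℝ) : Set Params :=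
  {μ | 0 ≤ -μ.2 / (3 * d) ∧
    (μ.1 = 2 * d * (-μ.2 / (3 * d) * (1 + ρp μ.2)) ^ (3 / 2 : ℝ) ∨
     μ.1 = -(2 * d * (-μ.2 / (3 * d) * (1 + ρm μ.2)) ^ (3 / 2 : ℝ)))}

/-- `ρ` is continuous and `ρ(m) = O(√|m|)` for `-m / (3d) ≥ 0`, `|m| < δ`, and `1 + ρ > 0`. -/
def IsCorrection (d δ : ℝ) (ρ : ℝ → ℝ) : Prop :=
  ContinuousOn ρ {m | |m| < δ ∧ 0 ≤ -m / (3 * d)} ∧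
  ∃ C : ℝ, ∀ m : ℝ, |m| < δ → 0 ≤ -m / (3 * d) → |ρ m| ≤ C * √|m| ∧ 0 < 1 + ρ m

/-! The problem reduces to one real function, the splitting function `G(ε, y)`. It is the height
above the stable axis of the image under `f_ε^q` of the point `(0, y)` of the unstable axis. A zero
of `G` of multiplicity `m + 1` in `y` is a contact of order `m` of the two manifolds, and this order
is the same at every point of the homoclinic orbit.

Coordinates. Small convergent orbits with prescribed initial `x`-coordinate are the zeros of a
smooth map on the Banach space of convergent sequences. At the saddle, its derivative in the
sequence variable is diagonal with entries `1 - lam * (right shift)` and `1 - lam * (left shift)`.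
Both are invertible because the shifts have norm at most `1` and `|lam| < 1`. The implicit function
theorem gives the stable manifold as a graph, jointly as smooth as the family
(`exists_orbit_solution`, `exists_stable_graph`). The unstable one comes from the inverse family,
and two shears, which preserve area, straighten both graphs (`exists_straightening`). An orbit that
stays near the saddle must lie on an axis, by expansion in the transverse direction. This puts the
two ends of the homoclinic orbit on the axes.

Hypotheses in terms of `G`. The tangency is assumed for some curve and some defining function. A
function with nonzero differential whose zero set lies in the `x`-axis is comparable with `y`, and a
regular curve in the `y`-axis has a parameter comparable with the coordinate. Hence `h ∘ γ` and `G`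
vanish to the same order, and `G(0, ·)` has an exact triple zero at the base point
(`splitting_of_cubicTangency`). The transversality hypothesis, applied to the axes themselves, says
that `ε ↦ (G, ∂G/∂y)` has nonzero Jacobian (`splitting_jacobian_ne_zero`).

Unfolding. As `∂³G/∂y³ = 6d ≠ 0`, the zero `y⁻(ε)` of the second derivative continues. Moving the
base point to `y⁻(ε)` does not change the Jacobian, because the first two `y`-derivatives vanish at
the tangency; so `μ` is a local coordinate. The equations for a double zero at `y⁻(ε) + t` are
solved for `ε = e(t)`, not for `t`. Integrating the third derivative gives `μ₂ = -3dt² + O(t³)`, `μ₁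
= 2dt³ + O(t⁴)`, while the second derivative at the zero is `6dt + O(t²)`. Eliminating `t` on `t ≥
0` and on `t ≤ 0` yields the two branches with their corrections (`exists_branch`,
`exists_curveH0`). The contact is quadratic for `t ≠ 0` and cubic for `t = 0`.

Closeness of orbits. Both ends are attracted by the saddle uniformly in the parameter, only finitely
many points remain between them, and `t = O(√|μ₂|)` tends to `0`. -/

/-! ### Inverse and implicit functions on open sets. -/

section InverseFunction

variable {E F G : Type*} [NormedAddCommGroup E] [NormedSpace ℝ E] [NormedAddCommGroup F]
  [NormedSpace ℝ F] [NormedAddCommGroup G] [NormedSpace ℝ G]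

/-- Inverse function theorem on an open set: the local inverse has the regularity of `f` on its
whole domain, which does not depend on the order of differentiability. -/
theorem exists_smooth_localInverse [CompleteSpace E] {f : E → F} {U : Set E} (hU : IsOpen U)
    {n : WithTop ℕ∞} (hn : n ≠ 0) (hf : ContDiffOn ℝ n f U) {a : E} (ha : a ∈ U) (f' : E ≃L[ℝ] F)
    (hf' : HasFDerivAt f (f' : E →L[ℝ] F) a) :
    ∃ e : OpenPartialHomeomorph E F, a ∈ e.source ∧ e.source ⊆ U ∧ (∀ x, e x = f x) ∧
      ContDiffOn ℝ n e.symm e.target := by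
  have hfa : ContDiffAt ℝ n f a := hf.contDiffAt (hU.mem_nhds ha)
  have hc : ContinuousOn (fderiv ℝ f) U :=
    hf.continuousOn_fderiv_of_isOpen hU (ENat.one_le_iff_ne_zero_withTop.2 hn)
  -- The domain is cut down to the open set where the derivative is invertible. There the inverse
  -- has the regularity of `f` at every point of the target, so no shrinking that depends on the
  -- order is needed when `n = ∞`.
  set S : Set E := U ∩ fderiv ℝ f ⁻¹' (range ((↑) : (E ≃L[ℝ] F) → E →L[ℝ] F)) with hS
  have hSo : IsOpen S := hc.isOpen_inter_preimage hU ContinuousLinearEquiv.isOpen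
  have haS : a ∈ S := ⟨ha, f', hf'.fderiv.symm⟩
  set e0 := hfa.toOpenPartialHomeomorph f hf' hn with he0
  have hcoe : ∀ x, e0 x = f x := fun x => by
    rw [he0, ContDiffAt.toOpenPartialHomeomorph_coe]
  refine ⟨e0.restrOpen S hSo, ?_, ?_, ?_, ?_⟩
  · exact ⟨hfa.mem_toOpenPartialHomeomorph_source hf' hn, haS⟩
  · intro x hx
    exact hx.2.1
  · intro x
    exact hcoe x
  · intro y hy
    have hx := (e0.restrOpen S hSo).map_target hy
    obtain ⟨hxU, e', he'⟩ := hx.2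
    have hd : HasFDerivAt (e0.restrOpen S hSo) (e' : E →L[ℝ] F) ((e0.restrOpen S hSo).symm y) := by
      have h1 : (⇑(e0.restrOpen S hSo)) = f := funext hcoe
      rw [h1, he']
      exact (((hf.contDiffAt (hU.mem_nhds hxU)).differentiableAt hn)).hasFDerivAt
    refine (OpenPartialHomeomorph.contDiffAt_symm _ hy hd ?_).contDiffWithinAt
    have h1 : (⇑(e0.restrOpen S hSo)) = f := funext hcoe
    rw [h1]
    exact hf.contDiffAt (hU.mem_nhds hxU)

/-- Implicit function theorem on an open set. -/
theorem exists_smooth_implicit [CompleteSpace E] [CompleteSpace F] {f : E × F → G}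
    {U : Set (E × F)} (hU : IsOpen U) {n : WithTop ℕ∞} (hn : n ≠ 0) (hf : ContDiffOn ℝ n f U)
    {a : E} {b : F} (ha : (a, b) ∈ U) (f' : E × F →L[ℝ] G) (hf' : HasFDerivAt f f' (a, b))
    (e : F ≃L[ℝ] G) (he : ∀ v, f' (0, v) = e v) :
    ∃ (A : Set E) (φ : E → F), IsOpen A ∧ a ∈ A ∧ ContDiffOn ℝ n φ A ∧ φ a = b ∧
      (∀ x ∈ A, (x, φ x) ∈ U ∧ f (x, φ x) = f (a, b)) ∧
      ∀ᶠ p in 𝓝 (a, b), f p = f (a, b) → p.1 ∈ A ∧ p.2 = φ p.1 := by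
  have hsplit : ∀ p : E × F, f' p = f' (p.1, 0) + e p.2 := fun p => by
    rw [← he, ← map_add]; simp
  -- The derivative of `(x, y) ↦ (x, f (x, y))` is block triangular with diagonal blocks `1` and
  -- `e`; the inverse is written by back substitution.
  let L : (E × F) ≃L[ℝ] (E × G) := ContinuousLinearEquiv.equivOfInverse
    ((ContinuousLinearMap.fst ℝ E F).prod f')
    ((ContinuousLinearMap.fst ℝ E G).prod ((e.symm : G →L[ℝ] F).comp
      (ContinuousLinearMap.snd ℝ E G - f'.comp
        ((ContinuousLinearMap.inl ℝ E F).comp (ContinuousLinearMap.fst ℝ E G)))))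
    (fun p => by
      ext
      · simp
      · simp [hsplit p])
    (fun p => by
      ext
      · simp
      · change f' (p.1, e.symm (p.2 - f' (p.1, 0))) = p.2
        rw [hsplit]
        simp)
  have hΦ : HasFDerivAt (fun p : E × F => (p.1, f p)) (L : (E × F) →L[ℝ] (E × G)) (a, b) :=
    (hasFDerivAt_fst).prodMk hf'
  obtain ⟨h, hah, hhU, hhf, hhs⟩ := exists_smooth_localInverse hU hn
    (contDiff_fst.contDiffOn.prodMk hf) ha L hΦ
  have hmem : (a, f (a, b)) ∈ h.target := by
    have := h.map_source hah
    rwa [hhf] at this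
  have hsym : h.symm (a, f (a, b)) = (a, b) := by
    have := h.left_inv hah
    rwa [hhf] at this
  have key : ∀ x, (x, f (a, b)) ∈ h.target → h.symm (x, f (a, b)) =
      (x, (h.symm (x, f (a, b))).2) ∧ f (h.symm (x, f (a, b))) = f (a, b) := by
    intro x hx
    have := h.right_inv hx
    rw [hhf, Prod.mk.injEq] at this
    exact ⟨Prod.ext this.1 rfl, this.2⟩
  have hcont : Continuous fun x : E => (x, f (a, b)) := by fun_prop
  refine ⟨(fun x : E => (x, f (a, b))) ⁻¹' h.target, fun x => (h.symm (x, f (a, b))).2,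
    h.open_target.preimage hcont, hmem, ?_, by simp [hsym], ?_, ?_⟩
  · exact (hhs.comp (contDiff_id.prodMk contDiff_const).contDiffOn (fun x hx => hx)).snd
  · intro x hx
    obtain ⟨h1, h2⟩ := key x hx
    rw [← h1]
    exact ⟨hhU (h.map_target hx), h2⟩
  · filter_upwards [h.open_source.mem_nhds hah] with p hp hfp
    have h1 := h.map_source hp
    have h2 := h.left_inv hp
    rw [hhf, hfp] at h1 h2
    exact ⟨h1, by rw [h2]⟩

end InverseFunction

/-! ### Superposition operators on spaces of continuous functions. -/

section Nemytskii

variable {K : Type*} [TopologicalSpace K] [CompactSpace K]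
variable {E : Type} {F : Type} [NormedAddCommGroup E] [NormedSpace ℝ E] [NormedAddCommGroup F]
  [NormedSpace ℝ F]

/-- Pointwise application of a continuous family of linear maps. -/
noncomputable def pointwiseApply (K E F : Type*) [TopologicalSpace K] [CompactSpace K]
    [NormedAddCommGroup E] [NormedSpace ℝ E] [NormedAddCommGroup F] [NormedSpace ℝ F] :
    C(K, E →L[ℝ] F) →L[ℝ] C(K, E) →L[ℝ] C(K, F) :=
  LinearMap.mkContinuous₂
    (LinearMap.mk₂ ℝ (fun (T : C(K, E →L[ℝ] F)) (h : C(K, E)) =>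
      (⟨fun k => T k (h k), by fun_prop⟩ : C(K, F)))
      (fun _ _ _ => by ext; simp) (fun _ _ _ => by ext; simp)
      (fun _ _ _ => by ext; simp) (fun _ _ _ => by ext; simp)) 1
    (fun T h => by
      rw [one_mul, ContinuousMap.norm_le _ (by positivity)]
      intro k
      exact (ContinuousLinearMap.le_opNorm _ _).trans
        (mul_le_mul (T.norm_coe_le_norm k) (h.norm_coe_le_norm k) (norm_nonneg _)
          ((norm_nonneg (T k)).trans (T.norm_coe_le_norm k))))

@[simp]
theorem pointwiseApply_apply (K E F : Type*) [TopologicalSpace K] [CompactSpace K]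
    [NormedAddCommGroup E] [NormedSpace ℝ E] [NormedAddCommGroup F] [NormedSpace ℝ F]
    (T : C(K, E →L[ℝ] F)) (h : C(K, E)) (k : K) : pointwiseApply K E F T h k = T k (h k) := rfl

/-- The range of `u` is compact, so `g'` varies by at most `c` within a fixed distance `δ` of each
of its points. The mean value inequality on these balls bounds the remainder by `c * ‖h‖`, uniformly
in the point of `K`. -/
theorem hasFDerivAt_postcomp (g : C(E, F)) (g' : C(E, E →L[ℝ] F))
    (hg : ∀ x, HasFDerivAt g (g' x) x) (u : C(K, E)) :
    HasFDerivAt (fun v : C(K, E) => g.comp v) (pointwiseApply K E F (g'.comp u)) u := by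
  rw [hasFDerivAt_iff_isLittleO_nhds_zero, Asymptotics.isLittleO_iff]
  intro c hc
  have hK : IsCompact (range u) := isCompact_range u.continuous
  have huc := hK.uniformContinuousAt_of_continuousAt (f := g')
    (fun a _ => g'.continuous.continuousAt) (Metric.dist_mem_uniformity hc)
  obtain ⟨δ, hδ, hδ'⟩ := Metric.mem_uniformity_dist.1 huc
  filter_upwards [Metric.ball_mem_nhds (0 : C(K, E)) hδ] with h hh
  rw [mem_ball_zero_iff] at hh
  rw [ContinuousMap.norm_le _ (by positivity)]
  intro k
  have hball : ∀ x ∈ Metric.ball (u k) δ, ‖g' x - g' (u k)‖ ≤ c := by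
    intro x hx
    have := @hδ' (u k) x (by rw [dist_comm]; exact hx) (mem_range_self k)
    rw [← dist_eq_norm, dist_comm]
    exact this.le
  have hk : ‖h k‖ < δ := (h.norm_coe_le_norm k).trans_lt hh
  have := (convex_ball (u k) δ).norm_image_sub_le_of_norm_hasFDerivWithin_le'
    (f := g) (f' := g') (φ := g' (u k)) (fun x _ => (hg x).hasFDerivWithinAt) hball
    (Metric.mem_ball_self hδ) (y := u k + h k) (by simpa [mem_ball_iff_norm] using hk)
  simp only [ContinuousMap.sub_apply, ContinuousMap.comp_apply, ContinuousMap.add_apply,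
    pointwiseApply_apply]
  calc _ ≤ c * ‖u k + h k - u k‖ := by simpa using this
    _ ≤ c * ‖h‖ := by
      gcongr
      simpa using h.norm_coe_le_norm k

/-- The derivative of the superposition operator of `g` is the superposition operator of `fderiv ℝ
g`, followed by a bounded bilinear map. The induction thus passes from `F` to `E →L[ℝ] F`, which is
why `F` is quantified inside and why all spaces live in one universe. -/
theorem contDiff_postcomp_nat (n : ℕ) : ∀ (F : Type) [NormedAddCommGroup F] [NormedSpace ℝ F]
    (g : C(E, F)), ContDiff ℝ n g → ContDiff ℝ n (fun v : C(K, E) => g.comp v) := by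
  induction n with
  | zero =>
    intro F _ _ g _
    rw [Nat.cast_zero, contDiff_zero]
    exact ContinuousMap.continuous_postcomp g
  | succ n ih =>
    intro F _ _ g hg
    rw [Nat.cast_add, Nat.cast_one] at hg ⊢
    have h1 := contDiff_succ_iff_fderiv.1 hg
    let g' : C(E, E →L[ℝ] F) := ⟨fderiv ℝ g, h1.2.2.continuous⟩
    rw [contDiff_succ_iff_hasFDerivAt]
    refine ⟨fun u => pointwiseApply K E F (g'.comp u), ?_, ?_⟩
    · exact (pointwiseApply K E F).contDiff.comp (ih _ g' h1.2.2)
    · exact hasFDerivAt_postcomp g g' (fun x => (h1.1 x).hasFDerivAt)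

/-- The superposition operator of a `C^n` map is of class `C^n`. -/
theorem contDiff_postcomp {n : ℕ∞} (g : C(E, F)) (hg : ContDiff ℝ n g) :
    ContDiff ℝ n (fun v : C(K, E) => g.comp v) := by
  rw [contDiff_iff_forall_nat_le]
  intro m hm
  exact contDiff_postcomp_nat m F g (hg.of_le (by exact_mod_cast hm))

end Nemytskii

/-- A smooth map with values in a prescribed neighbourhood of `0`, equal to the identity near `0`. -/
theorem exists_smooth_truncation {E : Type*} [NormedAddCommGroup E] [NormedSpace ℝ E]
    [FiniteDimensional ℝ E] {s : Set E} (hs : s ∈ 𝓝 (0 : E)) :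
    ∃ χ : E → E, (∀ n : ℕ∞, ContDiff ℝ n χ) ∧ (∀ x, χ x ∈ s) ∧ (∀ᶠ x in 𝓝 0, χ x = x) ∧
      χ 0 = 0 := by
  obtain ⟨ρ, hρ, hρs⟩ := Metric.mem_nhds_iff.1 hs
  let b : ContDiffBump (0 : E) := ⟨ρ / 2, ρ, by positivity, by linarith⟩
  refine ⟨fun x => b x • x, fun n => b.contDiff.smul contDiff_id, fun x => ?_, ?_, by simp⟩
  · by_cases hx : x ∈ Metric.ball (0 : E) ρ
    · apply hρs
      rw [mem_ball_zero_iff] at hx ⊢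
      rw [norm_smul, Real.norm_of_nonneg b.nonneg]
      exact (mul_le_of_le_one_left (norm_nonneg _) b.le_one).trans_lt hx
    · have : b x = 0 := b.zero_of_le_dist (by simpa [not_lt] using hx)
      simp only [this, zero_smul]
      exact mem_of_mem_nhds hs
  · filter_upwards [b.eventuallyEq_one] with x hx
    simp [hx]

/-! ### The Banach space of convergent sequences and its shifts. -/

/-- Convergent real sequences, with the supremum norm. -/
abbrev ConvSeq : Type := C(OnePoint ℕ, ℝ)

open OnePoint in
theorem ConvSeq.tendsto (u : ConvSeq) : Tendsto (fun n : ℕ => u (n : OnePoint ℕ)) atTop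
    (𝓝 (u ∞)) :=
  (continuous_iff_from_nat _).1 u.continuous

open OnePoint in
/-- The sequence preceded by `a`. -/
def ConvSeq.cons (a : ℝ) (u : ConvSeq) : ConvSeq :=
  continuousMapMkNat (fun n => Nat.casesOn n a (fun m => u (m : OnePoint ℕ))) (u ∞) (by
    rw [← tendsto_add_atTop_iff_nat 1]
    exact u.tendsto)

open OnePoint in
/-- The sequence without its first term. -/
def ConvSeq.tail (u : ConvSeq) : ConvSeq :=
  continuousMapMkNat (fun n => u ((n + 1 : ℕ) : OnePoint ℕ)) (u ∞) (by
    have := (tendsto_add_atTop_iff_nat 1).2 u.tendsto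
    exact this)

namespace ConvSeq

open OnePoint

@[simp] theorem cons_zero (a : ℝ) (u : ConvSeq) : cons a u ((0 : ℕ) : OnePoint ℕ) = a := rfl
@[simp] theorem cons_succ (a : ℝ) (u : ConvSeq) (n : ℕ) :
    cons a u ((n + 1 : ℕ) : OnePoint ℕ) = u (n : OnePoint ℕ) := rfl
@[simp] theorem cons_infty (a : ℝ) (u : ConvSeq) : cons a u ∞ = u ∞ := rfl
@[simp] theorem tail_coe (u : ConvSeq) (n : ℕ) :
    tail u (n : OnePoint ℕ) = u ((n + 1 : ℕ) : OnePoint ℕ) := rfl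
@[simp] theorem tail_infty (u : ConvSeq) : tail u ∞ = u ∞ := rfl

theorem ext_nat {u v : ConvSeq} (h : ∀ n : ℕ, u (n : OnePoint ℕ) = v (n : OnePoint ℕ)) :
    u = v := by
  ext k
  induction k with
  | coe n => exact h n
  | infty =>
    refine tendsto_nhds_unique u.tendsto ?_
    simp only [h]
    exact v.tendsto

/-- Right shift, as a continuous linear map. -/
noncomputable def consL : ConvSeq →L[ℝ] ConvSeq :=
  LinearMap.mkContinuous
    { toFun := cons 0
      map_add' := fun u v => ext_nat fun n => by cases n <;> simp
      map_smul' := fun c u => ext_nat fun n => by cases n <;> simp } 1 (fun u => by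
    rw [one_mul, ContinuousMap.norm_le _ (norm_nonneg _)]
    intro k
    induction k with
    | coe n =>
      cases n with
      | zero => exact (norm_zero (E := ℝ)).le.trans (norm_nonneg u)
      | succ n => exact u.norm_coe_le_norm n
    | infty => exact u.norm_coe_le_norm _)

/-- Left shift, as a continuous linear map. -/
noncomputable def tailL : ConvSeq →L[ℝ] ConvSeq :=
  LinearMap.mkContinuous
    { toFun := tail
      map_add' := fun u v => ext_nat fun n => by simp
      map_smul' := fun c u => ext_nat fun n => by simp } 1 (fun u => by
    rw [one_mul, ContinuousMap.norm_le _ (norm_nonneg _)]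
    intro k
    induction k with
    | coe n => exact u.norm_coe_le_norm _
    | infty => exact u.norm_coe_le_norm _)

theorem consL_apply (u : ConvSeq) : consL u = cons 0 u := rfl
theorem tailL_apply (u : ConvSeq) : tailL u = tail u := rfl

theorem norm_consL_le : ‖consL‖ ≤ 1 := LinearMap.mkContinuous_norm_le _ zero_le_one _
theorem norm_tailL_le : ‖tailL‖ ≤ 1 := LinearMap.mkContinuous_norm_le _ zero_le_one _

/-- Sequences of points of the plane, together with a constant parameter. -/
noncomputable def withParam :
    ((Params × ℝ) × (ConvSeq × ConvSeq)) →L[ℝ] C(OnePoint ℕ, Params × Plane) :=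
  LinearMap.mkContinuous
    { toFun := fun p => ⟨fun k => (p.1.1, (p.2.1 k, p.2.2 k)), by fun_prop⟩
      map_add' := fun u v => by ext <;> simp
      map_smul' := fun c u => by ext <;> simp } 1 (fun p => by
    rw [one_mul, ContinuousMap.norm_le _ (norm_nonneg _)]
    intro k
    refine max_le ?_ (max_le ?_ ?_)
    · exact (norm_fst_le p.1).trans (norm_fst_le p)
    · exact (p.2.1.norm_coe_le_norm k).trans ((norm_fst_le p.2).trans (norm_snd_le p))
    · exact (p.2.2.norm_coe_le_norm k).trans ((norm_snd_le p.2).trans (norm_snd_le p)))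

theorem withParam_apply (p : (Params × ℝ) × (ConvSeq × ConvSeq)) (k : OnePoint ℕ) :
    withParam p k = (p.1.1, (p.2.1 k, p.2.2 k)) := rfl

end ConvSeq

/-! ### The local stable manifold as the set of convergent orbits. -/

/-- `1 - T` as an equivalence, for `‖T‖ < 1`. -/
theorem exists_oneSub_equiv {E : Type*} [NormedAddCommGroup E] [NormedSpace ℝ E] [CompleteSpace E]
    (T : E →L[ℝ] E) (hT : ‖T‖ < 1) : ∃ e : E ≃L[ℝ] E, ∀ x, e x = x - T x :=
  ⟨ContinuousLinearEquiv.unitsEquiv ℝ E (Units.oneSub T hT), fun x => by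
    simp⟩

open OnePoint ConvSeq in
/-- The equation satisfied by the convergent orbits of `g (ε, ·)` whose first coordinate is
initially `a`. -/
noncomputable def orbitEquation (g₁ g₂ : C(Params × Plane, ℝ)) (lam : ℝ)
    (p : (Params × ℝ) × (ConvSeq × ConvSeq)) : ConvSeq × ConvSeq :=
  (p.2.1 - (p.1.2 • cons 1 0 + consL (g₁.comp (withParam p))),
    -- The factor `lam` turns the linear part `lam⁻¹ • η - tail η` into `η - lam • tail η`, a
    -- perturbation of the identity of norm less than one.
    lam • (g₂.comp (withParam p) - tailL p.2.2))

-- Nothing has to be required at `∞`: two convergent sequences that agree on `ℕ` have the same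
-- limit.
open OnePoint ConvSeq in
theorem orbitEquation_eq_zero_iff (g₁ g₂ : C(Params × Plane, ℝ)) {lam : ℝ} (hlam : lam ≠ 0)
    (p : (Params × ℝ) × (ConvSeq × ConvSeq)) :
    orbitEquation g₁ g₂ lam p = 0 ↔ p.2.1 ((0 : ℕ) : OnePoint ℕ) = p.1.2 ∧
      ∀ n : ℕ, p.2.1 ((n + 1 : ℕ) : OnePoint ℕ) = g₁ (p.1.1, (p.2.1 n, p.2.2 n)) ∧
        p.2.2 ((n + 1 : ℕ) : OnePoint ℕ) = g₂ (p.1.1, (p.2.1 n, p.2.2 n)) := by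
  rw [orbitEquation, Prod.mk_eq_zero, smul_eq_zero_iff_right hlam, sub_eq_zero, sub_eq_zero]
  constructor
  · rintro ⟨h1, h2⟩
    refine ⟨?_, fun n => ⟨?_, ?_⟩⟩
    · rw [h1]; simp [consL_apply]
    · conv_lhs => rw [h1]
      simp [consL_apply, withParam_apply]
    · have := DFunLike.congr_fun h2 (n : OnePoint ℕ)
      simpa [tailL_apply, withParam_apply] using this.symm
  · rintro ⟨h1, h2⟩
    constructor
    · refine ext_nat fun n => ?_
      cases n with
      | zero => simpa [consL_apply] using h1
      | succ n => simpa [consL_apply, withParam_apply] using (h2 n).1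
    · refine ext_nat fun n => ?_
      simpa [tailL_apply, withParam_apply] using (h2 n).2.symm

open ConvSeq in
theorem contDiff_orbitEquation {r : ℕ∞} {g₁ g₂ : C(Params × Plane, ℝ)} (h₁ : ContDiff ℝ r g₁)
    (h₂ : ContDiff ℝ r g₂) (lam : ℝ) : ContDiff ℝ r (orbitEquation g₁ g₂ lam) := by
  have k₁ := (contDiff_postcomp (K := OnePoint ℕ) g₁ h₁).comp withParam.contDiff
  have k₂ := (contDiff_postcomp (K := OnePoint ℕ) g₂ h₂).comp withParam.contDiff
  refine ContDiff.prodMk ?_ ?_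
  · exact contDiff_snd.fst.sub (((contDiff_fst (E := Params × ℝ) (F := ConvSeq × ConvSeq)).snd.smul
      (contDiff_const (c := cons 1 0))).add
      (consL.contDiff.comp k₁))
  · exact (k₂.sub (tailL.contDiff.comp contDiff_snd.snd)).const_smul lam

open ConvSeq in
theorem hasFDerivAt_superposition {g : C(Params × Plane, ℝ)} (h : ContDiff ℝ 1 g) :
    ∃ T : ((Params × ℝ) × (ConvSeq × ConvSeq)) →L[ℝ] ConvSeq,
      HasFDerivAt (fun p => g.comp (withParam p)) T 0 ∧
      ∀ p k, T p k = fderiv ℝ g 0 (p.1.1, (p.2.1 k, p.2.2 k)) := by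
  let g' : C(Params × Plane, Params × Plane →L[ℝ] ℝ) :=
    ⟨fderiv ℝ g, h.continuous_fderiv (by simp)⟩
  have h1 := hasFDerivAt_postcomp (K := OnePoint ℕ) g g'
    (fun x => (h.differentiable (by simp) x).hasFDerivAt) (withParam 0)
  refine ⟨_, h1.comp 0 withParam.hasFDerivAt, fun p k => ?_⟩
  simp only [ContinuousLinearMap.coe_comp, Function.comp_apply, pointwiseApply_apply,
    ContinuousMap.comp_apply, withParam_apply]
  rfl

-- In the sequence directions the linearization decouples into `1 - lam • consL` and `1 - lam •
-- tailL`. Both are invertible by the Neumann series, since the shifts have norm at most `1`. The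
-- implicit function theorem then parametrizes the small convergent orbits by the parameter and the
-- initial first coordinate, with uniqueness among all small convergent sequences.
open OnePoint ConvSeq in
theorem exists_orbit_solution {r : ℕ∞} (hr : 1 ≤ r) {g : Params × Plane → Plane}
    (hg : ContDiff ℝ r g) (h0 : ∀ ε, g (ε, 0) = 0) {lam : ℝ} (hl0 : 0 < |lam|) (hl1 : |lam| < 1)
    (hD : ∀ z : Plane, fderiv ℝ g 0 (0, z) = (lam * z.1, lam⁻¹ * z.2)) :
    ∃ (A : Set (Params × ℝ)) (φ : Params × ℝ → ConvSeq × ConvSeq), IsOpen A ∧ (0, 0) ∈ A ∧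
      ContDiffOn ℝ r φ A ∧ φ (0, 0) = 0 ∧
      (∀ x ∈ A, (φ x).1 ((0 : ℕ) : OnePoint ℕ) = x.2 ∧ ∀ n : ℕ,
        ((φ x).1 ((n + 1 : ℕ) : OnePoint ℕ), (φ x).2 ((n + 1 : ℕ) : OnePoint ℕ)) =
          g (x.1, ((φ x).1 n, (φ x).2 n))) ∧
      ∀ᶠ p in 𝓝 (((0, 0), 0) : (Params × ℝ) × (ConvSeq × ConvSeq)),
        p.2.1 ((0 : ℕ) : OnePoint ℕ) = p.1.2 → (∀ n : ℕ,
        (p.2.1 ((n + 1 : ℕ) : OnePoint ℕ), p.2.2 ((n + 1 : ℕ) : OnePoint ℕ)) =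
          g (p.1.1, (p.2.1 n, p.2.2 n))) → p.1 ∈ A ∧ p.2 = φ p.1 := by
  have hlne : lam ≠ 0 := abs_pos.1 hl0
  let g₁ : C(Params × Plane, ℝ) := ⟨fun p => (g p).1, (continuous_fst.comp hg.continuous)⟩
  let g₂ : C(Params × Plane, ℝ) := ⟨fun p => (g p).2, (continuous_snd.comp hg.continuous)⟩
  have hg₁ : ContDiff ℝ r g₁ := contDiff_fst.comp hg
  have hg₂ : ContDiff ℝ r g₂ := contDiff_snd.comp hg
  have hr' : (1 : WithTop ℕ∞) ≤ r := by exact_mod_cast hr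
  have hr0 : (r : WithTop ℕ∞) ≠ 0 := (zero_lt_one.trans_le hr').ne'
  have hgd := (hg.differentiable hr0 0).hasFDerivAt
  have hd₁ : ∀ v : Params × Plane, fderiv ℝ g₁ 0 v = (fderiv ℝ g 0 v).1 := fun v => by
    have h : HasFDerivAt g₁ _ 0 := hgd.fst
    rw [h.fderiv]; rfl
  have hd₂ : ∀ v : Params × Plane, fderiv ℝ g₂ 0 v = (fderiv ℝ g 0 v).2 := fun v => by
    have h : HasFDerivAt g₂ _ 0 := hgd.snd
    rw [h.fderiv]; rfl
  obtain ⟨T₁, hT₁, hT₁'⟩ := hasFDerivAt_superposition (hg₁.of_le hr')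
  obtain ⟨T₂, hT₂, hT₂'⟩ := hasFDerivAt_superposition (hg₂.of_le hr')
  have hnorm : ∀ S : ConvSeq →L[ℝ] ConvSeq, ‖S‖ ≤ 1 → ‖lam • S‖ < 1 := fun S hS => by
    refine (ContinuousLinearMap.opNorm_smul_le lam S).trans_lt ?_
    exact (mul_le_of_le_one_right (abs_nonneg _) hS).trans_lt hl1
  obtain ⟨e₁, he₁⟩ := exists_oneSub_equiv (lam • consL) (hnorm _ norm_consL_le)
  obtain ⟨e₂, he₂⟩ := exists_oneSub_equiv (lam • tailL) (hnorm _ norm_tailL_le)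
  have hzero : orbitEquation g₁ g₂ lam ((0, 0), 0) = 0 := by
    rw [orbitEquation_eq_zero_iff _ _ hlne]
    refine ⟨rfl, fun n => ⟨?_, ?_⟩⟩
    · exact (congrArg Prod.fst (h0 0)).symm
    · exact (congrArg Prod.snd (h0 0)).symm
  have hder : HasFDerivAt (orbitEquation g₁ g₂ lam) _ (((0, 0), 0) :
      (Params × ℝ) × (ConvSeq × ConvSeq)) :=
    ((hasFDerivAt_snd.fst).sub (((hasFDerivAt_fst.snd).smul_const (cons 1 0)).add
      (consL.hasFDerivAt.comp _ hT₁))).prodMk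
      ((hT₂.sub (tailL.hasFDerivAt.comp _ (hasFDerivAt_snd.snd))).const_smul lam)
  obtain ⟨A, φ, hA, hA0, hφ, hφ0, hφA, huniq⟩ := exists_smooth_implicit isOpen_univ hr0
    (contDiff_orbitEquation hg₁ hg₂ lam).contDiffOn (a := ((0, 0) : Params × ℝ))
    (b := (0 : ConvSeq × ConvSeq)) (mem_univ _) _ hder (e₁.prodCongr e₂) (by
      rintro ⟨ξ, η⟩
      refine Prod.ext (ext_nat fun n => ?_) (ext_nat fun n => ?_)
      · cases n with
        | zero => simp [he₁, consL_apply]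
        | succ n => simp [he₁, consL_apply, hT₁', hd₁, hD]
      · simp [he₂, tailL_apply, hT₂', hd₂, hD, mul_sub, hlne])
  rw [hzero] at hφA huniq
  refine ⟨A, φ, hA, hA0, hφ, hφ0, fun x hx => ?_, ?_⟩
  · obtain ⟨h1, h2⟩ := (orbitEquation_eq_zero_iff _ _ hlne _).1 (hφA x hx).2
    exact ⟨h1, fun n => Prod.ext (h2 n).1 (h2 n).2⟩
  · filter_upwards [huniq] with p hp h1 h2
    refine hp ((orbitEquation_eq_zero_iff _ _ hlne _).2 ⟨h1, fun n => ?_⟩)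
    exact ⟨congrArg Prod.fst (h2 n), congrArg Prod.snd (h2 n)⟩

open OnePoint ConvSeq in
/-- Local stable manifold theorem with parameters, near a fixed point at the origin with
derivative `diag(lam, lam⁻¹)`: the invariant graph is as smooth as the family. -/
theorem exists_stable_graph {r : ℕ∞} (hr : 1 ≤ r) {g : Params × Plane → Plane}
    (hg : ContDiff ℝ r g) (h0 : ∀ ε, g (ε, 0) = 0) {lam : ℝ} (hl0 : 0 < |lam|) (hl1 : |lam| < 1)
    (hD : ∀ z : Plane, fderiv ℝ g 0 (0, z) = (lam * z.1, lam⁻¹ * z.2)) :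
    ∃ φ : Params × ℝ → ℝ, ContDiff ℝ r φ ∧ (∀ ε, φ (ε, 0) = 0) ∧
      HasDerivAt (fun a => φ (0, a)) 0 0 ∧
      ∃ κ < 1, ∃ ρ > 0, ∀ ε : Params, ‖ε‖ < ρ → ∀ a : ℝ, |a| < ρ →
        ∃ a', |a'| ≤ κ * |a| ∧ g (ε, (a, φ (ε, a))) = (a', φ (ε, a')) := by
  obtain ⟨A, Φ, hA, hA0, hΦ, hΦ0, hΦA, huniq⟩ := exists_orbit_solution hr hg h0 hl0 hl1 hD
  have hlne : lam ≠ 0 := abs_pos.1 hl0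
  have hr' : (1 : WithTop ℕ∞) ≤ r := by exact_mod_cast hr
  have hr0 : (r : WithTop ℕ∞) ≠ 0 := (zero_lt_one.trans_le hr').ne'
  have hev : ∀ k : OnePoint ℕ, ContDiff ℝ r (fun u : ConvSeq => u k) :=
    fun k => (ContinuousMap.evalCLM ℝ k : C(OnePoint ℕ, ℝ) →L[ℝ] ℝ).contDiff
  -- The graph `ψ` is the second coordinate at time `0`, and `α` is the first coordinate at time
  -- `1`, that is, the map induced on the graph.
  set ψ : Params × ℝ → ℝ := fun x => (Φ x).2 ((0 : ℕ) : OnePoint ℕ) with hψdef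
  set α : Params × ℝ → ℝ := fun x => (Φ x).1 ((1 : ℕ) : OnePoint ℕ) with hαdef
  have hψ : ContDiffOn ℝ r ψ A := (hev _).comp_contDiffOn hΦ.snd
  have hα : ContDiffOn ℝ r α A := (hev _).comp_contDiffOn hΦ.fst
  have hAn : A ∈ 𝓝 ((0, 0) : Params × ℝ) := hA.mem_nhds hA0
  have hψat : ContDiffAt ℝ r ψ (0, 0) := hψ.contDiffAt hAn
  have hαat : ContDiffAt ℝ r α (0, 0) := hα.contDiffAt hAn
  have hΦc : ContinuousAt Φ (0, 0) := (hΦ.contDiffAt hAn).continuousAt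
  have hψ0 : ψ (0, 0) = 0 := by simp [ψ, hΦ0]
  have hα0 : α (0, 0) = 0 := by simp [α, hΦ0]
  have hz : ∀ᶠ ε : Params in 𝓝 0, Φ (ε, 0) = 0 := by
    have hc : Tendsto (fun ε : Params => (((ε, 0), 0) : (Params × ℝ) × (ConvSeq × ConvSeq)))
        (𝓝 0) (𝓝 ((0, 0), 0)) := by
      have : Continuous (fun ε : Params =>
        (((ε, 0), 0) : (Params × ℝ) × (ConvSeq × ConvSeq))) := by fun_prop
      exact this.tendsto' _ _ rfl
    filter_upwards [hc.eventually huniq] with ε hε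
    exact (hε rfl (fun n => (h0 ε).symm)).2.symm
  have hfirst : ∀ x ∈ A, g (x.1, (x.2, ψ x)) = (α x, (Φ x).2 ((1 : ℕ) : OnePoint ℕ)) := by
    intro x hx
    have h1 := (hΦA x hx).2 0
    rw [(hΦA x hx).1] at h1
    exact h1.symm
  -- The tail of a convergent orbit is a convergent orbit with initial coordinate `α x`. By
  -- uniqueness it is the solution over `(x.1, α x)`, which is the invariance of the graph.
  have hinv : ∀ᶠ x in 𝓝 ((0, 0) : Params × ℝ), (x.1, α x) ∈ A ∧
      g (x.1, (x.2, ψ x)) = (α x, ψ (x.1, α x)) := by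
    have hc : Tendsto (fun x : Params × ℝ => (((x.1, α x), (tailL (Φ x).1, tailL (Φ x).2)) :
        (Params × ℝ) × (ConvSeq × ConvSeq))) (𝓝 (0, 0)) (𝓝 ((0, 0), 0)) := by
      have : ContinuousAt (fun x : Params × ℝ => (((x.1, α x), (tailL (Φ x).1, tailL (Φ x).2)) :
        (Params × ℝ) × (ConvSeq × ConvSeq))) (0, 0) := by
        refine (continuousAt_fst.prodMk hαat.continuousAt).prodMk (ContinuousAt.prodMk ?_ ?_)
        · exact tailL.continuous.continuousAt.comp hΦc.fst
        · exact tailL.continuous.continuousAt.comp hΦc.snd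
      have h2 := this.tendsto
      simp only [hα0, hΦ0, Prod.fst_zero, Prod.snd_zero, map_zero] at h2
      exact h2
    filter_upwards [hc.eventually huniq, hAn] with x hx hxA
    obtain ⟨h1, h2⟩ := hx rfl (fun n => (hΦA x hxA).2 (n + 1))
    refine ⟨h1, ?_⟩
    rw [hfirst x hxA]
    have : (Φ (x.1, α x)).2 = tailL (Φ x).2 := (congrArg Prod.snd h2).symm
    simp only [hψdef, this, tailL_apply, tail_coe]
  -- derivatives along the stable direction
  have hline : HasDerivAt (fun a : ℝ => ((0, a) : Params × ℝ)) (0, 1) 0 :=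
    (hasDerivAt_const _ _).prodMk (hasDerivAt_id _)
  have hψ' := (hψat.differentiableAt hr0).hasFDerivAt
  have hα' := (hαat.differentiableAt hr0).hasFDerivAt
  set c := fderiv ℝ ψ (0, 0) (0, 1) with hc
  set b := fderiv ℝ α (0, 0) (0, 1) with hb
  have hψl : HasDerivAt (fun a => ψ (0, a)) c 0 := hψ'.comp_hasDerivAt_of_eq 0 hline rfl
  have hαl : HasDerivAt (fun a => α (0, a)) b 0 := hα'.comp_hasDerivAt_of_eq 0 hline rfl
  have hgl : HasDerivAt (fun a => g (0, (a, ψ (0, a)))) (lam, lam⁻¹ * c) 0 := by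
    have h1 : HasDerivAt (fun a : ℝ => ((0, (a, ψ (0, a))) : Params × Plane)) (0, (1, c)) 0 :=
      (hasDerivAt_const _ _).prodMk ((hasDerivAt_id _).prodMk hψl)
    have h2 := (hg.differentiable hr0 0).hasFDerivAt.comp_hasDerivAt_of_eq 0 h1 (by
      simp only [hψ0]; rfl)
    rw [hD] at h2
    exact h2.congr_deriv (by simp)
  have hlinet : Tendsto (fun a : ℝ => ((0, a) : Params × ℝ)) (𝓝 0) (𝓝 (0, 0)) :=
    hline.continuousAt
  have hinvl := hlinet.eventually hinv
  have hb' : b = lam := by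
    refine hαl.unique (HasDerivAt.congr_of_eventuallyEq hgl.fst ?_)
    filter_upwards [hinvl] with a ha
    rw [ha.2]
  -- Invariance at first order reads `c * lam = lam⁻¹ * c`. As `lam ^ 2 ≠ 1`, the slope `c`
  -- vanishes.
  have hc0 : c = 0 := by
    have h1 : HasDerivAt (fun a => ψ (0, α (0, a))) (c * b) 0 := by
      have h3 : HasDerivAt (fun a => ψ (0, a)) c (α (0, 0)) := by rw [hα0]; exact hψl
      exact HasDerivAt.comp (h₂ := fun a => ψ (0, a)) 0 h3 hαl
    have h2 : c * b = lam⁻¹ * c := by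
      refine h1.unique (HasDerivAt.congr_of_eventuallyEq hgl.snd ?_)
      filter_upwards [hinvl] with a ha
      rw [ha.2]
    rw [hb'] at h2
    by_contra hcn
    have h3 : lam = lam⁻¹ := mul_left_cancel₀ hcn (by rw [h2, mul_comm])
    have h4 : lam * lam = 1 := by
      nth_rewrite 2 [h3]
      exact mul_inv_cancel₀ hlne
    have h5 : |lam| * |lam| = 1 := by rw [← abs_mul, h4, abs_one]
    nlinarith
  -- contraction
  obtain ⟨κ, hκl, hκ1⟩ := exists_between hl1
  -- Strict differentiability compares `x` with `(x.1, 0)`, where `α` vanishes. This gives a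
  -- contraction rate that is uniform in the parameter.
  have hcontr : ∀ᶠ x in 𝓝 ((0, 0) : Params × ℝ), |α x| ≤ κ * |x.2| := by
    have hs := hαat.hasStrictFDerivAt hr0
    have h1 := hs.isLittleO.def (sub_pos.2 hκl)
    have ht : Tendsto (fun x : Params × ℝ => (x, ((x.1, 0) : Params × ℝ))) (𝓝 (0, 0))
        (𝓝 (((0, 0) : Params × ℝ), ((0, 0) : Params × ℝ))) := by
      have : Continuous (fun x : Params × ℝ => (x, ((x.1, 0) : Params × ℝ))) := by fun_prop
      exact this.tendsto' _ _ rfl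
    have hz' := (continuous_fst.tendsto ((0, 0) : Params × ℝ)).eventually hz
    filter_upwards [ht.eventually h1, hz'] with x hx hzx
    have h2 : α (x.1, 0) = 0 := by simp [α, hzx]
    have h3 : x - (x.1, 0) = x.2 • ((0, 1) : Params × ℝ) := by ext <;> simp
    rw [h2, h3, _root_.map_smul, ← hb, hb', norm_smul] at hx
    simp only [sub_zero, smul_eq_mul, Prod.norm_mk, norm_zero, norm_one, Real.norm_eq_abs] at hx
    have h4 := abs_sub_abs_le_abs_sub (α x) (x.2 * lam)
    rw [abs_mul] at h4
    have h5 : max (0 : ℝ) 1 = 1 := by norm_num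
    rw [h5] at hx
    nlinarith [abs_nonneg x.2]
  have hz' := (continuous_fst.tendsto ((0, 0) : Params × ℝ)).eventually hz
  obtain ⟨ρ₀, hρ₀, hball⟩ := Metric.eventually_nhds_iff_ball.1
    ((hA.eventually_mem hA0).and (hinv.and (hcontr.and hz')))
  have hmem : ∀ (ε : Params) (a : ℝ), ‖ε‖ < ρ₀ → |a| < ρ₀ →
      (ε, a) ∈ Metric.ball ((0, 0) : Params × ℝ) ρ₀ := fun ε a h1 h2 => by
    rw [mem_ball_iff_norm]
    simpa [Prod.norm_def] using ⟨by simpa [Prod.norm_def] using h1, h2⟩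
  -- The graph is only local; composing with truncations makes it globally smooth without changing
  -- it near the origin.
  obtain ⟨χ₁, hχ₁, hχ₁m, hχ₁e, -⟩ := exists_smooth_truncation
    (Metric.ball_mem_nhds (0 : Params) hρ₀)
  obtain ⟨χ₂, hχ₂, hχ₂m, hχ₂e, hχ₂z⟩ := exists_smooth_truncation
    (Metric.ball_mem_nhds (0 : ℝ) hρ₀)
  have hm : ∀ x : Params × ℝ, (χ₁ x.1, χ₂ x.2) ∈ Metric.ball ((0, 0) : Params × ℝ) ρ₀ :=
    fun x => hmem _ _ (by simpa using hχ₁m x.1) (by simpa using hχ₂m x.2)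
  have hχ₁0 : χ₁ 0 = 0 := hχ₁e.self_of_nhds
  refine ⟨fun x => ψ (χ₁ x.1, χ₂ x.2), ?_, ?_, ?_, κ, hκ1, ?_⟩
  · exact hψ.comp_contDiff (((hχ₁ r).comp contDiff_fst).prodMk ((hχ₂ r).comp contDiff_snd))
      (fun x => (hball _ (hm x)).1)
  · intro ε
    have h1 := (hball _ (hmem (χ₁ ε) 0 (by simpa using hχ₁m ε) (by simpa using hρ₀))).2.2.2
    simp only at h1
    simp [ψ, hχ₂z, h1]
  · rw [hc0] at hψl
    refine hψl.congr_of_eventuallyEq ?_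
    filter_upwards [hχ₂e] with a ha
    simp only [hχ₁0, ha]
  · obtain ⟨ρ₁, hρ₁, h1⟩ := Metric.eventually_nhds_iff_ball.1 hχ₁e
    obtain ⟨ρ₂, hρ₂, h2⟩ := Metric.eventually_nhds_iff_ball.1 hχ₂e
    refine ⟨min ρ₀ (min ρ₁ ρ₂), by positivity, fun ε hε a ha => ?_⟩
    rw [lt_min_iff, lt_min_iff] at hε ha
    have hx := hball _ (hmem ε a hε.1 ha.1)
    have e1 : χ₁ ε = ε := h1 _ (by simpa using hε.2.1)
    have e2 : χ₂ a = a := h2 _ (by simpa using ha.2.2)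
    have hle : |α (ε, a)| ≤ |a| := hx.2.2.1.trans (mul_le_of_le_one_left (abs_nonneg _) hκ1.le)
    have e3 : χ₂ (α (ε, a)) = α (ε, a) := h2 _ (by simpa using hle.trans_lt ha.2.2)
    refine ⟨α (ε, a), hx.2.2.1, ?_⟩
    simp only [e1, e2, e3]
    exact hx.2.1.2

/-! ### Area preserving families of plane diffeomorphisms. -/

theorem exists_equiv_of_injective {E : Type*} [NormedAddCommGroup E] [NormedSpace ℝ E]
    [FiniteDimensional ℝ E] (T : E →L[ℝ] E) (hT : Function.Injective T) :
    ∃ e : E ≃L[ℝ] E, (e : E →L[ℝ] E) = T :=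
  ⟨(LinearEquiv.ofInjectiveEndo (T : E →ₗ[ℝ] E) hT).toContinuousLinearEquiv, by ext; simp⟩

theorem injective_of_det_ne_zero {T : Plane →L[ℝ] Plane} (hT : T.det ≠ 0) :
    Function.Injective T :=
  (T.toContinuousLinearEquivOfDetNeZero hT).injective

theorem det_plane (T : Plane →L[ℝ] Plane) :
    T.det = (T (1, 0)).1 * (T (0, 1)).2 - (T (0, 1)).1 * (T (1, 0)).2 := by
  rw [ContinuousLinearMap.det, ← LinearMap.det_toMatrix (Module.Basis.finTwoProd ℝ),
    Matrix.det_fin_two]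
  simp [LinearMap.toMatrix_apply]

theorem fderiv_fiber {E F G : Type*} [NormedAddCommGroup E] [NormedSpace ℝ E]
    [NormedAddCommGroup F] [NormedSpace ℝ F] [NormedAddCommGroup G] [NormedSpace ℝ G]
    {g : E × F → G} {x : E × F} (hg : DifferentiableAt ℝ g x) (v : F) :
    fderiv ℝ (fun z => g (x.1, z)) x.2 v = fderiv ℝ g x (0, v) := by
  have h1 : HasFDerivAt (fun z : F => (x.1, z)) (ContinuousLinearMap.inr ℝ E F) x.2 :=
    hasFDerivAt_prodMk_right _ _
  have h2 : HasFDerivAt (fun z => g (x.1, z)) _ x.2 :=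
    HasFDerivAt.comp (g := g) (f := fun z : F => (x.1, z)) x.2 hg.hasFDerivAt h1
  rw [h2.fderiv]
  simp

/-- The inverse function theorem is applied to `(ε, z) ↦ (ε, f ε z)`, whose derivative is injective
because the fibre derivative has determinant `1`. -/
theorem IsSymplecticFamily.contDiffOn_symm {r : ℕ∞} (hr : 1 ≤ r) {V : Set Params}
    {f : Params → Equiv.Perm Plane} (hf : IsSymplecticFamily r V f) :
    ContDiffOn ℝ r (fun x : Params × Plane => (f x.1).symm x.2) (V ×ˢ univ) := by
  have hr' : (1 : WithTop ℕ∞) ≤ r := by exact_mod_cast hr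
  have hr0 : (r : WithTop ℕ∞) ≠ 0 := (zero_lt_one.trans_le hr').ne'
  have hU : IsOpen (V ×ˢ (univ : Set Plane)) := hf.isOpen.prod isOpen_univ
  rintro ⟨ε, w⟩ hx
  set z := (f ε).symm w with hz
  have hxz : (ε, z) ∈ V ×ˢ (univ : Set Plane) := ⟨hx.1, mem_univ _⟩
  have hd := (hf.contDiffOn.contDiffAt (hU.mem_nhds hxz)).differentiableAt hr0
  have hinj : Function.Injective ((ContinuousLinearMap.fst ℝ Params Plane).prod
      (fderiv ℝ (fun x : Params × Plane => f x.1 x.2) (ε, z))) := by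
    rw [injective_iff_map_eq_zero]
    rintro ⟨v, u⟩ h
    simp only [ContinuousLinearMap.prod_apply, ContinuousLinearMap.coe_fst', Prod.mk_eq_zero] at h
    obtain ⟨rfl, h2⟩ := h
    rw [← fderiv_fiber hd] at h2
    have := (injective_iff_map_eq_zero _).1 (injective_of_det_ne_zero
      (by rw [hf.det_eq_one ε hx.1 z]; exact one_ne_zero)) u h2
    rw [this]; rfl
  obtain ⟨L, hL⟩ := exists_equiv_of_injective _ hinj
  have hΦ : HasFDerivAt (fun x : Params × Plane => (x.1, f x.1 x.2)) _ (ε, z) :=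
    hasFDerivAt_fst.prodMk hd.hasFDerivAt
  obtain ⟨e, hem, -, hef, hes⟩ := exists_smooth_localInverse hU hr0
    (contDiff_fst.contDiffOn.prodMk hf.contDiffOn) hxz L (by rw [hL]; exact hΦ)
  have hmem : (ε, w) ∈ e.target := by
    have := e.map_source hem
    rw [hef] at this
    simpa [hz] using this
  refine ContDiffAt.contDiffWithinAt ?_
  refine (hes.contDiffAt (e.open_target.mem_nhds hmem)).snd.congr_of_eventuallyEq ?_
  filter_upwards [e.open_target.mem_nhds hmem] with y hy
  have h1 := e.right_inv hy
  rw [hef] at h1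
  have h2 := congrArg Prod.fst h1
  have h3 := congrArg Prod.snd h1
  simp only at h2 h3
  rw [Equiv.symm_apply_eq, ← h3, h2]

/-- A globally defined smooth family of area preserving diffeomorphisms of the plane. -/
structure GlobalSymplecticFamily (r : ℕ∞) (F : Params → Equiv.Perm Plane) : Prop where
  contDiff : ContDiff ℝ r (fun x : Params × Plane => F x.1 x.2)
  contDiff_symm : ContDiff ℝ r (fun x : Params × Plane => (F x.1).symm x.2)
  det_eq_one : ∀ (ε : Params) (z : Plane), (fderiv ℝ (F ε) z).det = 1

namespace GlobalSymplecticFamily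

variable {r : ℕ∞} {F G : Params → Equiv.Perm Plane}

theorem contDiff_fiber (hF : GlobalSymplecticFamily r F) (ε : Params) : ContDiff ℝ r (F ε) :=
  hF.contDiff.comp (contDiff_const.prodMk contDiff_id)

theorem contDiff_symm_fiber (hF : GlobalSymplecticFamily r F) (ε : Params) :
    ContDiff ℝ r (F ε).symm :=
  hF.contDiff_symm.comp (contDiff_const.prodMk contDiff_id)

theorem mul (hr : r ≠ 0) (hF : GlobalSymplecticFamily r F) (hG : GlobalSymplecticFamily r G) :
    GlobalSymplecticFamily r (fun ε => F ε * G ε) where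
  contDiff := hF.contDiff.comp (contDiff_fst.prodMk hG.contDiff)
  contDiff_symm := hG.contDiff_symm.comp (contDiff_fst.prodMk hF.contDiff_symm)
  det_eq_one ε z := by
    have hr' : (r : WithTop ℕ∞) ≠ 0 := by exact_mod_cast hr
    have h : fderiv ℝ (F ε * G ε) z = (fderiv ℝ (F ε) (G ε z)).comp (fderiv ℝ (G ε) z) :=
      fderiv_comp z ((hF.contDiff_fiber ε).differentiable hr' _)
        ((hG.contDiff_fiber ε).differentiable hr' _)
    have h2 := LinearMap.det_comp (fderiv ℝ (F ε) (G ε z) : Plane →ₗ[ℝ] Plane)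
      (fderiv ℝ (G ε) z : Plane →ₗ[ℝ] Plane)
    have h3 := hF.det_eq_one ε (G ε z)
    have h4 := hG.det_eq_one ε z
    rw [ContinuousLinearMap.det] at h3 h4
    rw [h3, h4, one_mul] at h2
    rw [h]
    exact h2

theorem inv (hr : r ≠ 0) (hF : GlobalSymplecticFamily r F) :
    GlobalSymplecticFamily r (fun ε => (F ε)⁻¹) where
  contDiff := hF.contDiff_symm
  contDiff_symm := hF.contDiff
  det_eq_one ε z := by
    have hr' : (r : WithTop ℕ∞) ≠ 0 := by exact_mod_cast hr
    have h : fderiv ℝ (F ε ∘ (F ε).symm) z =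
        (fderiv ℝ (F ε) ((F ε).symm z)).comp (fderiv ℝ (F ε).symm z) :=
      fderiv_comp z ((hF.contDiff_fiber ε).differentiable hr' _)
        ((hF.contDiff_symm_fiber ε).differentiable hr' _)
    rw [Equiv.self_comp_symm, fderiv_id] at h
    have h2 := LinearMap.det_comp (fderiv ℝ (F ε) ((F ε).symm z) : Plane →ₗ[ℝ] Plane)
      (fderiv ℝ (F ε).symm z : Plane →ₗ[ℝ] Plane)
    have h3 := hF.det_eq_one ε ((F ε).symm z)
    rw [ContinuousLinearMap.det] at h3
    rw [h3, one_mul, ← ContinuousLinearMap.toLinearMap_comp, ← h] at h2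
    have h5 : LinearMap.det ((ContinuousLinearMap.id ℝ Plane : Plane →L[ℝ] Plane) :
      Plane →ₗ[ℝ] Plane) = 1 := LinearMap.det_id
    rw [h5] at h2
    exact h2.symm

end GlobalSymplecticFamily

/-- Only the parameter is truncated: a cut-off in the phase variable would destroy area
preservation. -/
theorem IsSymplecticFamily.comp_truncation {r : ℕ∞} (hr : 1 ≤ r) {V : Set Params}
    {f : Params → Equiv.Perm Plane} (hf : IsSymplecticFamily r V f) {χ : Params → Params}
    (hχ : ContDiff ℝ r χ) (hχV : ∀ ε, χ ε ∈ V) :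
    GlobalSymplecticFamily r (fun ε => f (χ ε)) where
  contDiff := hf.contDiffOn.comp_contDiff ((hχ.comp contDiff_fst).prodMk contDiff_snd)
    (fun _ => ⟨hχV _, mem_univ _⟩)
  contDiff_symm := (hf.contDiffOn_symm hr).comp_contDiff
    ((hχ.comp contDiff_fst).prodMk contDiff_snd) (fun _ => ⟨hχV _, mem_univ _⟩)
  det_eq_one ε z := hf.det_eq_one _ (hχV ε) z

/-- The shear `(x, y) ↦ (x, y - φ x)`. -/
def shearY (φ : ℝ → ℝ) : Equiv.Perm Plane where
  toFun z := (z.1, z.2 - φ z.1)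
  invFun z := (z.1, z.2 + φ z.1)
  left_inv z := by simp
  right_inv z := by simp

/-- The shear `(x, y) ↦ (x - ψ y, y)`. -/
def shearX (ψ : ℝ → ℝ) : Equiv.Perm Plane where
  toFun z := (z.1 - ψ z.2, z.2)
  invFun z := (z.1 + ψ z.2, z.2)
  left_inv z := by simp
  right_inv z := by simp

theorem shearY_apply (φ : ℝ → ℝ) (z : Plane) : shearY φ z = (z.1, z.2 - φ z.1) := rfl
theorem shearY_symm_apply (φ : ℝ → ℝ) (z : Plane) : (shearY φ).symm z = (z.1, z.2 + φ z.1) := rfl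
theorem shearX_apply (φ : ℝ → ℝ) (z : Plane) : shearX φ z = (z.1 - φ z.2, z.2) := rfl
theorem shearX_symm_apply (φ : ℝ → ℝ) (z : Plane) : (shearX φ).symm z = (z.1 + φ z.2, z.2) := rfl

theorem hasFDerivAt_shearY {φ : ℝ → ℝ} {c : ℝ} {z : Plane} (h : HasDerivAt φ c z.1) :
    HasFDerivAt (shearY φ) ((ContinuousLinearMap.fst ℝ ℝ ℝ).prod
      (ContinuousLinearMap.snd ℝ ℝ ℝ - c • ContinuousLinearMap.fst ℝ ℝ ℝ)) z :=
  hasFDerivAt_fst.prodMk (hasFDerivAt_snd.sub (h.comp_hasFDerivAt z hasFDerivAt_fst))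

theorem hasFDerivAt_shearX {φ : ℝ → ℝ} {c : ℝ} {z : Plane} (h : HasDerivAt φ c z.2) :
    HasFDerivAt (shearX φ) ((ContinuousLinearMap.fst ℝ ℝ ℝ - c • ContinuousLinearMap.snd ℝ ℝ ℝ).prod
      (ContinuousLinearMap.snd ℝ ℝ ℝ)) z :=
  (hasFDerivAt_fst.sub (h.comp_hasFDerivAt z hasFDerivAt_snd)).prodMk hasFDerivAt_snd

theorem globalSymplecticFamily_shearY {r : ℕ∞} (hr : r ≠ 0) {φ : Params × ℝ → ℝ}
    (hφ : ContDiff ℝ r φ) : GlobalSymplecticFamily r (fun ε => shearY fun a => φ (ε, a)) where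
  contDiff := contDiff_snd.fst.prodMk
    (contDiff_snd.snd.sub (hφ.comp (contDiff_fst.prodMk contDiff_snd.fst)))
  contDiff_symm := contDiff_snd.fst.prodMk
    (contDiff_snd.snd.add (hφ.comp (contDiff_fst.prodMk contDiff_snd.fst)))
  det_eq_one ε z := by
    have hr' : (r : WithTop ℕ∞) ≠ 0 := by exact_mod_cast hr
    have h1 : ContDiff ℝ r (fun a => φ (ε, a)) := hφ.comp (contDiff_const.prodMk contDiff_id)
    rw [(hasFDerivAt_shearY ((h1.differentiable hr' z.1).hasDerivAt)).fderiv, det_plane]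
    simp

theorem globalSymplecticFamily_shearX {r : ℕ∞} (hr : r ≠ 0) {φ : Params × ℝ → ℝ}
    (hφ : ContDiff ℝ r φ) : GlobalSymplecticFamily r (fun ε => shearX fun a => φ (ε, a)) where
  contDiff := (contDiff_snd.fst.sub (hφ.comp (contDiff_fst.prodMk contDiff_snd.snd))).prodMk
    contDiff_snd.snd
  contDiff_symm := (contDiff_snd.fst.add (hφ.comp (contDiff_fst.prodMk contDiff_snd.snd))).prodMk
    contDiff_snd.snd
  det_eq_one ε z := by
    have hr' : (r : WithTop ℕ∞) ≠ 0 := by exact_mod_cast hr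
    have h1 : ContDiff ℝ r (fun a => φ (ε, a)) := hφ.comp (contDiff_const.prodMk contDiff_id)
    rw [(hasFDerivAt_shearX ((h1.differentiable hr' z.2).hasDerivAt)).fderiv, det_plane]
    simp

/-- A symplectic eigenbasis of the derivative at a saddle. -/
theorem IsSaddle.exists_eigenbasis {g : Equiv.Perm Plane} {p : Plane} {lam : ℝ}
    (h : IsSaddle g p lam) : ∃ L : Plane ≃L[ℝ] Plane, (L : Plane →L[ℝ] Plane).det = 1 ∧
      ∀ z : Plane, fderiv ℝ g p (L z) = L (lam * z.1, lam⁻¹ * z.2) := by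
  obtain ⟨v, hv⟩ := h.eigen_stable.exists_hasEigenvector
  obtain ⟨w, hw⟩ := h.eigen_unstable.exists_hasEigenvector
  have hlne : lam ≠ 0 := abs_pos.1 h.pos
  have hne : lam ≠ lam⁻¹ := fun h3 => by
    have h4 : lam * lam = 1 := by
      nth_rewrite 2 [h3]
      exact mul_inv_cancel₀ hlne
    have h5 : |lam| * |lam| = 1 := by rw [← abs_mul, h4, abs_one]
    nlinarith [h.lt_one, h.pos]
  have hvD : fderiv ℝ g p v = lam • v := hv.apply_eq_smul
  have hwD : fderiv ℝ g p w = lam⁻¹ • w := hw.apply_eq_smul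
  set D := v.1 * w.2 - w.1 * v.2 with hD
  have hD0 : D ≠ 0 := by
    intro hD0
    -- if the determinant vanishes the eigenvectors are proportional
    have key : ∃ a b : ℝ, (a ≠ 0 ∨ b ≠ 0) ∧ a • v + b • w = 0 := by
      by_cases hv1 : w.1 = 0 ∧ v.1 = 0
      · refine ⟨w.2, -v.2, Or.inl fun h0 => hw.2 (Prod.ext hv1.1 h0), ?_⟩
        ext
        · simp [hv1.1, hv1.2]
        · simp; ring
      · refine ⟨w.1, -v.1, ?_, ?_⟩
        · rw [not_and_or] at hv1
          simpa using hv1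
        · ext
          · simp; ring
          · simp; rw [hD] at hD0; linarith
    obtain ⟨a, b, hab, h0⟩ := key
    have h1 := congrArg (fderiv ℝ g p) h0
    rw [map_add, map_smul, map_smul, hvD, hwD, map_zero] at h1
    have h2 : (a * (lam - lam⁻¹)) • v = 0 := by
      have : (a * (lam - lam⁻¹)) • v = (a • lam • v + b • lam⁻¹ • w) - lam⁻¹ • (a • v + b • w) := by
        module
      rw [this, h1, h0]; simp
    have h3 : (b * (lam⁻¹ - lam)) • w = 0 := by
      have : (b * (lam⁻¹ - lam)) • w = (a • lam • v + b • lam⁻¹ • w) - lam • (a • v + b • w) := by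
        module
      rw [this, h1, h0]; simp
    rcases hab with ha | hb
    · exact (smul_ne_zero (mul_ne_zero ha (sub_ne_zero.2 hne)) hv.2) h2
    · exact (smul_ne_zero (mul_ne_zero hb (sub_ne_zero.2 hne.symm)) hw.2) h3
  -- Dividing one eigenvector by `D` normalizes the determinant of the eigenbasis to `1`.
  let T : Plane →L[ℝ] Plane := (ContinuousLinearMap.fst ℝ ℝ ℝ).smulRight (D⁻¹ • v) +
    (ContinuousLinearMap.snd ℝ ℝ ℝ).smulRight w
  have hT : ∀ z : Plane, T z = z.1 • D⁻¹ • v + z.2 • w := fun z => rfl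
  have hdet : T.det = 1 := by
    rw [det_plane]
    simp only [hT]
    have : D⁻¹ * D = 1 := inv_mul_cancel₀ hD0
    rw [hD] at this
    simp only [Prod.fst_add, Prod.snd_add, Prod.smul_fst, Prod.smul_snd, smul_eq_mul]
    rw [hD]
    linear_combination this
  obtain ⟨L, hL⟩ := exists_equiv_of_injective T
    (injective_of_det_ne_zero (by rw [hdet]; exact one_ne_zero))
  refine ⟨L, by rw [hL, hdet], fun z => ?_⟩
  have hLT : ∀ z, L z = T z := fun z => by rw [← hL]; rfl
  rw [hLT, hLT, hT, hT, map_add, map_smul, map_smul, map_smul, hvD, hwD]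
  module

/-- Continuation of the saddle fixed point. -/
theorem exists_fixed_point {r : ℕ∞} (hr : 1 ≤ r) {V : Set Params} {f : Params → Equiv.Perm Plane}
    (hf : IsSymplecticFamily r V f) {O : Plane} {lam : ℝ} (hO : IsSaddle (f 0) O lam) :
    ∃ (A : Set Params) (p : Params → Plane), IsOpen A ∧ 0 ∈ A ∧ A ⊆ V ∧ ContDiffOn ℝ r p A ∧
      p 0 = O ∧ ∀ ε ∈ A, f ε (p ε) = p ε := by
  have hr' : (1 : WithTop ℕ∞) ≤ r := by exact_mod_cast hr
  have hr0 : (r : WithTop ℕ∞) ≠ 0 := (zero_lt_one.trans_le hr').ne'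
  have hU : IsOpen (V ×ˢ (univ : Set Plane)) := hf.isOpen.prod isOpen_univ
  have hmem : ((0, O) : Params × Plane) ∈ V ×ˢ (univ : Set Plane) := ⟨hf.zero_mem, mem_univ _⟩
  have hd := (hf.contDiffOn.contDiffAt (hU.mem_nhds hmem)).differentiableAt hr0
  obtain ⟨L, -, hL⟩ := hO.exists_eigenbasis
  have hlne : lam ≠ 0 := abs_pos.1 hO.pos
  have hl1 : lam ≠ 1 := fun h => by
    have := hO.lt_one
    rw [h, abs_one] at this
    exact lt_irrefl _ this
  have hl1' : lam⁻¹ ≠ 1 := fun h => hl1 (inv_eq_one.1 h)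
  -- Neither eigenvalue is `1`, so the equation for the fixed point is nondegenerate in the phase
  -- variable.
  have hinj : Function.Injective (fderiv ℝ (f 0) O - ContinuousLinearMap.id ℝ Plane) := by
    rw [injective_iff_map_eq_zero]
    intro v hv
    obtain ⟨z, rfl⟩ := L.surjective v
    simp only [sub_apply, hL, ContinuousLinearMap.id_apply, sub_eq_zero] at hv
    have h1 := L.injective hv
    have h2 : lam * z.1 = z.1 := congrArg Prod.fst h1
    have h3 : lam⁻¹ * z.2 = z.2 := congrArg Prod.snd h1
    have h4 : z.1 = 0 := by
      by_contra h
      exact hl1 (mul_right_cancel₀ h (by rw [h2, one_mul]))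
    have h5 : z.2 = 0 := by
      by_contra h
      exact hl1' (mul_right_cancel₀ h (by rw [h3, one_mul]))
    rw [show z = 0 from Prod.ext h4 h5, map_zero]
  obtain ⟨e, he⟩ := exists_equiv_of_injective _ hinj
  obtain ⟨A, p, hA, hA0, hp, hp0, hpA, -⟩ := exists_smooth_implicit hU hr0
    (hf.contDiffOn.sub contDiff_snd.contDiffOn) hmem _ (hd.hasFDerivAt.sub hasFDerivAt_snd) e
    (fun v => by
      have h1 : e v = (e : Plane →L[ℝ] Plane) v := rfl
      rw [h1, he]
      simp only [sub_apply, ← fderiv_fiber hd]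
      rfl)
  refine ⟨A, p, hA, hA0, fun ε hε => (hpA ε hε).1.1, hp, hp0, fun ε hε => ?_⟩
  have h1 := (hpA ε hε).2
  simp only [hO.fixed, sub_self] at h1
  exact sub_eq_zero.1 h1

/-- The affine change of coordinates `w ↦ p + L w`. -/
def affinePerm (L : Plane ≃L[ℝ] Plane) (p : Plane) : Equiv.Perm Plane :=
  L.toEquiv.trans (Equiv.addLeft p)

theorem affinePerm_apply (L : Plane ≃L[ℝ] Plane) (p w : Plane) : affinePerm L p w = p + L w := rfl

theorem affinePerm_symm_apply (L : Plane ≃L[ℝ] Plane) (p w : Plane) :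
    (affinePerm L p).symm w = L.symm (w - p) := by
  rw [Equiv.symm_apply_eq, affinePerm_apply]
  simp

theorem globalSymplecticFamily_affinePerm {r : ℕ∞} {L : Plane ≃L[ℝ] Plane}
    (hL : (L : Plane →L[ℝ] Plane).det = 1) {p : Params → Plane} (hp : ContDiff ℝ r p) :
    GlobalSymplecticFamily r (fun ε => affinePerm L (p ε)) where
  contDiff := (hp.comp contDiff_fst).add (L.contDiff.comp contDiff_snd)
  contDiff_symm := by
    simp only [affinePerm_symm_apply]
    exact L.symm.contDiff.comp (contDiff_snd.sub (hp.comp contDiff_fst))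
  det_eq_one ε z := by
    have h : HasFDerivAt (affinePerm L (p ε)) (L : Plane →L[ℝ] Plane) z :=
      L.hasFDerivAt.const_add (p ε)
    rw [h.fderiv, hL]

/-! ### Straightening the invariant manifolds; adapted canonical coordinates. -/

/-- The diagonal linear map. -/
def diagMap (a b : ℝ) : Plane →L[ℝ] Plane :=
  (a • ContinuousLinearMap.fst ℝ ℝ ℝ).prod (b • ContinuousLinearMap.snd ℝ ℝ ℝ)

theorem diagMap_apply (a b : ℝ) (z : Plane) : diagMap a b z = (a * z.1, b * z.2) := rfl

/-- Straightening of both local invariant manifolds of a family with a fixed point at the origin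
by area preserving shears. -/
theorem exists_straightening {r : ℕ∞} (hr : 1 ≤ r) {g : Params → Equiv.Perm Plane}
    (hg : GlobalSymplecticFamily r g) (h0 : ∀ ε, g ε 0 = 0) {lam : ℝ} (hl0 : 0 < |lam|)
    (hl1 : |lam| < 1) (hD : HasFDerivAt (g 0) (diagMap lam lam⁻¹) 0) :
    ∃ S : Params → Equiv.Perm Plane, GlobalSymplecticFamily r S ∧ (∀ ε, S ε 0 = 0) ∧
      ∃ κ < 1, ∃ ρ > 0, ∀ ε : Params, ‖ε‖ < ρ → ∀ u : ℝ, |u| < ρ →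
        (∃ u' : ℝ, |u'| ≤ κ * |u| ∧ g ε ((S ε).symm (u, 0)) = (S ε).symm (u', 0)) ∧
        (∃ u' : ℝ, |u'| ≤ κ * |u| ∧ (g ε).symm ((S ε).symm (0, u)) = (S ε).symm (0, u')) := by
  have hrne : r ≠ 0 := (zero_lt_one.trans_le hr).ne'
  have hr' : (1 : WithTop ℕ∞) ≤ r := by exact_mod_cast hr
  have hr0 : (r : WithTop ℕ∞) ≠ 0 := (zero_lt_one.trans_le hr').ne'
  have hlne : lam ≠ 0 := abs_pos.1 hl0
  obtain ⟨φ, hφ, hφ0, hφ', κ₁, hκ₁, ρ₁, hρ₁, hinv₁⟩ := exists_stable_graph hr hg.contDiff h0 hl0 hl1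
    (fun z => by
      rw [← fderiv_fiber (g := fun x : Params × Plane => g x.1 x.2) (x := 0)
        (hg.contDiff.differentiable hr0 _)]
      exact congrArg (fun T : Plane →L[ℝ] Plane => T z) hD.fderiv)
  set σ : Params → Equiv.Perm Plane := fun ε => shearY fun a => φ (ε, a) with hσdef
  have hσ : GlobalSymplecticFamily r σ := globalSymplecticFamily_shearY hrne hφ
  set g₁ : Params → Equiv.Perm Plane := fun ε => σ ε * g ε * (σ ε)⁻¹ with hg₁def
  have hg₁ : GlobalSymplecticFamily r g₁ := (hσ.mul hrne hg).mul hrne (hσ.inv hrne)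
  have hσ0 : ∀ ε, σ ε 0 = 0 := fun ε => by
    simp [hσdef, shearY_apply, hφ0]
  have hσs0 : ∀ ε, (σ ε).symm 0 = 0 := fun ε => by rw [Equiv.symm_apply_eq, hσ0]
  have hg₁0 : ∀ ε, g₁ ε 0 = 0 := fun ε => by
    change σ ε (g ε ((σ ε).symm 0)) = 0
    rw [hσs0, h0, hσ0]
  have hσd : HasFDerivAt (σ 0) (ContinuousLinearMap.id ℝ Plane) 0 := by
    have := hasFDerivAt_shearY (φ := fun a => φ (0, a)) (z := 0) hφ'
    simpa using this
  have hσsd : HasFDerivAt (σ 0).symm (ContinuousLinearMap.id ℝ Plane) 0 := by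
    have := hasFDerivAt_shearY (φ := fun a => - φ (0, a)) (z := 0) hφ'.neg
    have h2 : (σ 0).symm = shearY (fun a => - φ (0, a)) := by
      ext z <;> simp [hσdef, shearY_apply, shearY_symm_apply]
    rw [h2]
    simpa using this
  -- The stable graph is tangent to the `x`-axis, so the first shear has identity derivative at the
  -- origin. The conjugated family therefore keeps the diagonal derivative, and the graph theorem
  -- can be used a second time.
  have hg₁d : HasFDerivAt (g₁ 0) (diagMap lam lam⁻¹) 0 := by
    have h1 : HasFDerivAt (g 0) (diagMap lam lam⁻¹) ((σ 0).symm 0) := by rw [hσs0]; exact hD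
    have h2 := h1.comp 0 hσsd
    have h3 : HasFDerivAt (σ 0) (ContinuousLinearMap.id ℝ Plane) ((g 0 ∘ (σ 0).symm) 0) := by
      rw [Function.comp_apply, hσs0, h0]; exact hσd
    exact h3.comp 0 h2
  -- the inverse family, with the coordinates exchanged
  have hg₂c : ContDiff ℝ r (fun x : Params × Plane => ((g₁ x.1).symm x.2.swap).swap) := by
    have h1 := hg₁.contDiff_symm.comp (contDiff_fst.prodMk
      ((contDiff_snd.comp contDiff_snd).prodMk (contDiff_fst.comp contDiff_snd)) :
      ContDiff ℝ r (fun x : Params × Plane => (x.1, ((x.2.2, x.2.1) : Plane))))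
    exact h1.snd.prodMk h1.fst
  have hg₁s : ∀ ε, (g₁ ε).symm 0 = 0 := fun ε => by rw [Equiv.symm_apply_eq, hg₁0]
  have hsd : ∀ z : Plane, fderiv ℝ (g₁ 0).symm 0 z = (lam⁻¹ * z.1, lam * z.2) := by
    intro z
    have h1 : HasFDerivAt (g₁ 0).symm (fderiv ℝ (g₁ 0).symm 0) (g₁ 0 0) := by
      rw [hg₁0]
      exact ((hg₁.contDiff_symm_fiber 0).differentiable hr0 0).hasFDerivAt
    have h2 := h1.comp 0 hg₁d
    rw [Equiv.symm_comp_self] at h2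
    have h3 := congrArg (fun T : Plane →L[ℝ] Plane => T (lam⁻¹ * z.1, lam * z.2))
      (h2.unique (hasFDerivAt_id _))
    simp only [ContinuousLinearMap.comp_apply, diagMap_apply, ContinuousLinearMap.id_apply] at h3
    rw [← h3]
    congr 1
    ext <;> field_simp
  obtain ⟨ψ, hψ, hψ0, -, κ₂, hκ₂, ρ₂, hρ₂, hinv₂⟩ := exists_stable_graph hr hg₂c
    (fun ε => by simp only [Prod.swap_zero, hg₁s]) hl0 hl1 (fun z => by
      rw [← fderiv_fiber (x := (0 : Params × Plane)) (hg₂c.differentiable hr0 _)]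
      have h1 := ((hg₁.contDiff_symm_fiber 0).differentiable hr0 0).hasFDerivAt
      let sw : Plane →L[ℝ] Plane :=
        (ContinuousLinearMap.snd ℝ ℝ ℝ).prod (ContinuousLinearMap.fst ℝ ℝ ℝ)
      have h2 : HasFDerivAt (fun z : Plane => ((g₁ 0).symm z.swap).swap)
          (sw.comp ((fderiv ℝ (g₁ 0).symm 0).comp sw)) 0 := by
        have h3 : HasFDerivAt (g₁ 0).symm (fderiv ℝ (g₁ 0).symm 0) (sw 0) := by simpa using h1
        exact sw.hasFDerivAt.comp 0 (h3.comp 0 sw.hasFDerivAt)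
      have h4 := congrArg (fun T : Plane →L[ℝ] Plane => T z) h2.fderiv
      refine h4.trans ?_
      simp only [ContinuousLinearMap.comp_apply, hsd]
      rfl)
  set τ : Params → Equiv.Perm Plane := fun ε => shearX fun a => ψ (ε, a) with hτdef
  have hτ : GlobalSymplecticFamily r τ := globalSymplecticFamily_shearX hrne hψ
  have hSs : ∀ ε (w : Plane), (τ ε * σ ε).symm w = (σ ε).symm ((τ ε).symm w) := fun ε w => rfl
  refine ⟨fun ε => τ ε * σ ε, hτ.mul hrne hσ, fun ε => ?_, max κ₁ κ₂, max_lt hκ₁ hκ₂,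
    min ρ₁ ρ₂, lt_min hρ₁ hρ₂, fun ε hε u hu => ⟨?_, ?_⟩⟩
  · change τ ε (σ ε 0) = 0
    rw [hσ0]
    simp [hτdef, shearX_apply, hψ0]
  · obtain ⟨u', hu', h⟩ := hinv₁ ε (hε.trans_le (min_le_left _ _)) u (hu.trans_le (min_le_left _ _))
    refine ⟨u', hu'.trans (mul_le_mul_of_nonneg_right (le_max_left _ _) (abs_nonneg _)), ?_⟩
    rw [hSs, hSs]
    -- The second shear fixes the `x`-axis pointwise because `ψ (ε, 0) = 0`; the axis straightened
    -- first stays straight.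
    simp only [hτdef, hσdef, shearX_symm_apply, shearY_symm_apply, hψ0, add_zero, zero_add]
    exact h
  · obtain ⟨u', hu', h⟩ := hinv₂ ε (hε.trans_le (min_le_right _ _)) u
      (hu.trans_le (min_le_right _ _))
    refine ⟨u', hu'.trans (mul_le_mul_of_nonneg_right (le_max_right _ _) (abs_nonneg _)), ?_⟩
    have h1 : (g₁ ε).symm (ψ (ε, u), u) = (ψ (ε, u'), u') := by
      have := congrArg Prod.swap h
      simpa using this
    have h2 : (g₁ ε).symm (ψ (ε, u), u) = σ ε ((g ε).symm ((σ ε).symm (ψ (ε, u), u))) := rfl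
    rw [h2, ← Equiv.eq_symm_apply] at h1
    rw [hSs, hSs]
    have h3 : ∀ v : ℝ, (τ ε).symm (0, v) = (ψ (ε, v), v) := fun v => by
      simp [hτdef, shearX_symm_apply]
    rw [h3, h3]
    exact h1

namespace GlobalSymplecticFamily

variable {r : ℕ∞} {F : Params → Equiv.Perm Plane}

/-- The homeomorphism of the total space given by a family of diffeomorphisms. -/
def toHomeomorph (hF : GlobalSymplecticFamily r F) : Params × Plane ≃ₜ Params × Plane where
  toFun x := (x.1, F x.1 x.2)
  invFun x := (x.1, (F x.1).symm x.2)
  left_inv x := by simp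
  right_inv x := by simp
  continuous_toFun := continuous_fst.prodMk hF.contDiff.continuous
  continuous_invFun := continuous_fst.prodMk hF.contDiff_symm.continuous

/-- The family of coordinates given by a family of diffeomorphisms, over a box. -/
noncomputable def toChart (hF : GlobalSymplecticFamily r F) (δ R : ℝ) :
    OpenPartialHomeomorph (Params × Plane) (Params × Plane) :=
  -- Restricting the inverse and then inverting makes the target, not the source, equal to the box.
  (hF.toHomeomorph.symm.toOpenPartialHomeomorph.restrOpen
    (Metric.ball (0 : Params) δ ×ˢ Metric.ball (0 : ℝ × ℝ) R)
    (Metric.isOpen_ball.prod Metric.isOpen_ball)).symm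

theorem toChart_apply (hF : GlobalSymplecticFamily r F) (δ R : ℝ) (x : Params × Plane) :
    hF.toChart δ R x = (x.1, F x.1 x.2) := rfl

theorem toChart_symm_apply (hF : GlobalSymplecticFamily r F) (δ R : ℝ) (x : Params × Plane) :
    (hF.toChart δ R).symm x = (x.1, (F x.1).symm x.2) := rfl

theorem toChart_target (hF : GlobalSymplecticFamily r F) (δ R : ℝ) :
    (hF.toChart δ R).target = Metric.ball (0 : Params) δ ×ˢ Metric.ball (0 : ℝ × ℝ) R := by
  simp [toChart]

end GlobalSymplecticFamily

/-- Existence of adapted canonical coordinates near a saddle. -/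
theorem exists_isAdaptedChart {r : ℕ∞} (hr : 1 ≤ r) {V : Set Params}
    {f : Params → Equiv.Perm Plane} (hf : IsSymplecticFamily r V f) {O : Plane} {lam : ℝ}
    (hO : IsSaddle (f 0) O lam) :
    ∃ (Θ : OpenPartialHomeomorph (Params × Plane) (Params × Plane)) (δ R : ℝ),
      IsAdaptedChart r V f O Θ δ R := by
  have hrne : r ≠ 0 := (zero_lt_one.trans_le hr).ne'
  have hr' : (1 : WithTop ℕ∞) ≤ r := by exact_mod_cast hr
  have hr0 : (r : WithTop ℕ∞) ≠ 0 := (zero_lt_one.trans_le hr').ne'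
  obtain ⟨A, p, hA, hA0, hAV, hp, hp0, hpA⟩ := exists_fixed_point hr hf hO
  obtain ⟨χ, hχ, hχA, hχe, hχ0⟩ := exists_smooth_truncation (hA.mem_nhds hA0)
  obtain ⟨L, hLdet, hL⟩ := hO.exists_eigenbasis
  have hF : GlobalSymplecticFamily r (fun ε => f (χ ε)) :=
    hf.comp_truncation hr (hχ r) (fun ε => hAV (hχA ε))
  set T : Params → Equiv.Perm Plane := fun ε => affinePerm L (p (χ ε)) with hTdef
  have hT : GlobalSymplecticFamily r T :=
    globalSymplecticFamily_affinePerm hLdet (hp.comp_contDiff (hχ r) hχA)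
  set g : Params → Equiv.Perm Plane := fun ε => (T ε)⁻¹ * f (χ ε) * T ε with hgdef
  have hg : GlobalSymplecticFamily r g := ((hT.inv hrne).mul hrne hF).mul hrne hT
  have hT0 : ∀ ε, T ε 0 = p (χ ε) := fun ε => by simp [hTdef, affinePerm_apply]
  have hg0 : ∀ ε, g ε 0 = 0 := fun ε => by
    change (T ε).symm (f (χ ε) (T ε 0)) = 0
    rw [Equiv.symm_apply_eq, hT0, hpA _ (hχA ε)]
  have hgd : HasFDerivAt (g 0) (diagMap lam lam⁻¹) 0 := by
    have h1 : HasFDerivAt (T 0) (L : Plane →L[ℝ] Plane) 0 := L.hasFDerivAt.const_add _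
    have hT00 : T 0 0 = O := by rw [hT0, hχ0, hp0]
    have h2 : HasFDerivAt (f (χ 0)) (fderiv ℝ (f 0) O) (T 0 0) := by
      rw [hT00, hχ0]
      have := ((hF.contDiff_fiber 0).differentiable hr0 O).hasFDerivAt
      rwa [hχ0] at this
    have h3 : HasFDerivAt (T 0).symm (L.symm : Plane →L[ℝ] Plane) ((f (χ 0) ∘ T 0) 0) := by
      have h4 : ⇑(T 0).symm = fun w => L.symm (w - p (χ 0)) :=
        funext fun w => affinePerm_symm_apply _ _ _
      rw [h4]
      exact L.symm.hasFDerivAt.comp _ ((hasFDerivAt_id _).sub_const _)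
    refine (h3.comp 0 (h2.comp 0 h1)).congr_fderiv ?_
    refine ContinuousLinearMap.ext fun z => ?_
    simp only [ContinuousLinearMap.comp_apply, diagMap_apply]
    change L.symm (fderiv ℝ (f 0) O (L z)) = _
    rw [hL, L.symm_apply_apply]
  obtain ⟨S, hS, hS0, κ, hκ, ρ, hρ, haxes⟩ := exists_straightening hr hg hg0 hO.pos hO.lt_one hgd
  have hΨ : GlobalSymplecticFamily r (fun ε => S ε * (T ε)⁻¹) := hS.mul hrne (hT.inv hrne)
  obtain ⟨δ₁, hδ₁, hδ₁e⟩ := Metric.eventually_nhds_iff_ball.1 hχe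
  have hsym : ∀ ε w, (S ε * (T ε)⁻¹).symm w = T ε ((S ε).symm w) := fun ε w => rfl
  have hat : ∀ δ R ε w, atPoint (hΨ.toChart δ R) ε w = T ε ((S ε).symm w) := fun δ R ε w => rfl
  have hconj : ∀ ε z, f (χ ε) (T ε z) = T ε (g ε z) := fun ε z => by simp [hgdef]
  have hconjs : ∀ ε z, (f (χ ε)).symm (T ε z) = T ε ((g ε).symm z) := fun ε z => by
    rw [Equiv.symm_apply_eq, hconj, Equiv.apply_symm_apply]
  -- For `‖ε‖ < δ₁` the truncation is the identity, so that the truncated family is the given one;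
  -- `ρ` is the size on which the axes are invariant.
  refine ⟨hΨ.toChart (min δ₁ ρ) ρ, min δ₁ ρ, ρ, ⟨by positivity, hρ, ?_, hΨ.toChart_target _ _,
    fun x _ => rfl, ?_, ?_, ?_, ?_, κ, hκ, ?_⟩⟩
  · intro ε hε
    rw [← hδ₁e ε (Metric.ball_subset_ball (min_le_left _ _) hε)]
    exact hAV (hχA ε)
  · rw [hat, show (S 0).symm 0 = 0 by rw [Equiv.symm_apply_eq, hS0], hT0, hχ0, hp0]
  · exact (contDiff_fst.prodMk hΨ.contDiff).contDiffOn
  · exact (contDiff_fst.prodMk hΨ.contDiff_symm).contDiffOn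
  · intro x _
    exact hΨ.det_eq_one x.1 x.2
  · intro ε hε u hu
    have hεe := hδ₁e ε (Metric.ball_subset_ball (min_le_left _ _) hε)
    have hερ : ‖ε‖ < ρ := by
      simpa using Metric.ball_subset_ball (min_le_right δ₁ ρ) hε
    obtain ⟨⟨u', hu', h1⟩, ⟨v', hv', h2⟩⟩ := haxes ε hερ u hu
    simp only [hat]
    refine ⟨⟨u', hu', ?_⟩, ⟨v', hv', ?_⟩⟩
    · have := hconj ε ((S ε).symm (u, 0))
      rw [hεe, h1] at this
      exact this
    · have := hconjs ε ((S ε).symm (0, u))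
      rw [hεe, h2] at this
      exact this

/-! ### Local dynamics in adapted coordinates. -/

/-- A family of local coordinates in which the axes are invariant and contracted, without the
area preservation; this notion is symmetric under time reversal. -/
structure AxisChart (k : ℕ∞) (f : Params → Equiv.Perm Plane)
    (Θ : OpenPartialHomeomorph (Params × Plane) (Params × Plane)) (δ R κ : ℝ) : Prop where
  δ_pos : 0 < δ
  R_pos : 0 < R
  κ_lt_one : κ < 1
  target_eq : Θ.target = Metric.ball (0 : Params) δ ×ˢ Metric.ball (0 : ℝ × ℝ) R
  fst_eq : ∀ x ∈ Θ.source, (Θ x).1 = x.1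
  contDiffOn : ContDiffOn ℝ k Θ Θ.source
  contDiffOn_symm : ContDiffOn ℝ k Θ.symm Θ.target
  axis_stable : ∀ ε ∈ Metric.ball (0 : Params) δ, ∀ u : ℝ, |u| < R →
    ∃ u' : ℝ, |u'| ≤ κ * |u| ∧ f ε (atPoint Θ ε (u, 0)) = atPoint Θ ε (u', 0)
  axis_unstable : ∀ ε ∈ Metric.ball (0 : Params) δ, ∀ u : ℝ, |u| < R →
    ∃ u' : ℝ, |u'| ≤ κ * |u| ∧ (f ε).symm (atPoint Θ ε (0, u)) = atPoint Θ ε (0, u')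
  smooth : ContDiffOn ℝ k (fun x : Params × Plane => f x.1 x.2)
    (Metric.ball (0 : Params) δ ×ˢ univ)
  smooth_symm : ContDiffOn ℝ k (fun x : Params × Plane => (f x.1).symm x.2)
    (Metric.ball (0 : Params) δ ×ˢ univ)

theorem IsAdaptedChart.exists_axisChart {r k : ℕ∞} (hk : k ≤ r) (hr : 1 ≤ r) {V : Set Params}
    {f : Params → Equiv.Perm Plane} (hf : IsSymplecticFamily r V f) {O : Plane}
    {Θ : OpenPartialHomeomorph (Params × Plane) (Params × Plane)} {δ R : ℝ}
    (h : IsAdaptedChart k V f O Θ δ R) : ∃ κ, AxisChart k f Θ δ R κ := by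
  obtain ⟨κ, hκ, hax⟩ := h.axes
  have hk' : (k : WithTop ℕ∞) ≤ r := by exact_mod_cast hk
  have hsub : Metric.ball (0 : Params) δ ×ˢ (univ : Set Plane) ⊆ V ×ˢ univ :=
    prod_mono h.ball_subset subset_rfl
  exact ⟨κ, h.δ_pos, h.R_pos, hκ, h.target_eq, h.fst_eq, h.contDiffOn, h.contDiffOn_symm,
    fun ε hε u hu => (hax ε hε u hu).1, fun ε hε u hu => (hax ε hε u hu).2,
    (hf.contDiffOn.mono hsub).of_le hk', ((hf.contDiffOn_symm hr).mono hsub).of_le hk'⟩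

/-- The coordinates with the two axes exchanged. -/
def swapChart (Θ : OpenPartialHomeomorph (Params × Plane) (Params × Plane)) :
    OpenPartialHomeomorph (Params × Plane) (Params × Plane) :=
  Θ.transHomeomorph ((Homeomorph.refl Params).prodCongr (Homeomorph.prodComm ℝ ℝ))

theorem swapChart_apply (Θ : OpenPartialHomeomorph (Params × Plane) (Params × Plane))
    (x : Params × Plane) : swapChart Θ x = ((Θ x).1, (Θ x).2.swap) := rfl

theorem atPoint_swapChart (Θ : OpenPartialHomeomorph (Params × Plane) (Params × Plane))
    (ε : Params) (w : Plane) : atPoint (swapChart Θ) ε w = atPoint Θ ε w.swap := rfl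

theorem swapChart_source (Θ : OpenPartialHomeomorph (Params × Plane) (Params × Plane)) :
    (swapChart Θ).source = Θ.source := rfl

namespace AxisChart

variable {k : ℕ∞} {f : Params → Equiv.Perm Plane}
  {Θ : OpenPartialHomeomorph (Params × Plane) (Params × Plane)} {δ R κ : ℝ}

/-- Time reversal exchanges the roles of the axes. Every statement about the stable axis thereby
yields one about the unstable axis. -/
theorem swap (h : AxisChart k f Θ δ R κ) :
    AxisChart k (fun ε => (f ε)⁻¹) (swapChart Θ) δ R κ := by
  have hsw : ContDiff ℝ k (fun x : Params × Plane => (x.1, ((x.2.2, x.2.1) : Plane))) := by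
    fun_prop
  have htgt : ∀ x : Params × Plane, x ∈ (swapChart Θ).target ↔ (x.1, x.2.swap) ∈ Θ.target :=
    fun x => Iff.rfl
  refine ⟨h.δ_pos, h.R_pos, h.κ_lt_one, ?_, h.fst_eq, hsw.comp_contDiffOn h.contDiffOn, ?_,
    fun ε hε u hu => h.axis_unstable ε hε u hu, fun ε hε u hu => h.axis_stable ε hε u hu,
    h.smooth_symm, h.smooth⟩
  · ext x
    rw [htgt, h.target_eq]
    simp only [mem_prod, mem_ball_zero_iff, Prod.norm_def, Prod.fst_swap, Prod.snd_swap]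
    rw [max_comm ‖x.2.2‖]
  · exact h.contDiffOn_symm.comp hsw.contDiffOn (fun x hx => (htgt x).1 hx)

theorem mem_target (h : AxisChart k f Θ δ R κ) {ε : Params} {w : Plane} (hε : ‖ε‖ < δ)
    (hw : ‖w‖ < R) : (ε, w) ∈ Θ.target := by
  rw [h.target_eq]
  simp only [mem_prod, mem_ball_zero_iff]
  exact ⟨hε, hw⟩

theorem symm_apply (h : AxisChart k f Θ δ R κ) {x : Params × Plane} (hx : x ∈ Θ.target) :
    Θ.symm x = (x.1, atPoint Θ x.1 x.2) := by
  have h1 := h.fst_eq _ (Θ.map_target hx)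
  rw [Θ.right_inv hx] at h1
  exact Prod.ext h1.symm rfl

theorem mem_source (h : AxisChart k f Θ δ R κ) {ε : Params} {w : Plane} (hε : ‖ε‖ < δ)
    (hw : ‖w‖ < R) : (ε, atPoint Θ ε w) ∈ Θ.source := by
  have h1 := Θ.map_target (h.mem_target hε hw)
  rwa [h.symm_apply (h.mem_target hε hw)] at h1

theorem apply_atPoint (h : AxisChart k f Θ δ R κ) {ε : Params} {w : Plane} (hε : ‖ε‖ < δ)
    (hw : ‖w‖ < R) : Θ (ε, atPoint Θ ε w) = (ε, w) := by
  have h1 := Θ.right_inv (h.mem_target hε hw)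
  rwa [h.symm_apply (h.mem_target hε hw)] at h1

theorem apply_mem (h : AxisChart k f Θ δ R κ) {ε : Params} {z : Plane} (hz : (ε, z) ∈ Θ.source) :
    ‖ε‖ < δ ∧ ‖(Θ (ε, z)).2‖ < R ∧ atPoint Θ ε (Θ (ε, z)).2 = z := by
  have h1 := Θ.map_source hz
  have h2 := h.fst_eq _ hz
  have h3 := Θ.left_inv hz
  rw [h.symm_apply h1, h2] at h3
  rw [h.target_eq] at h1
  simp only [mem_prod, mem_ball_zero_iff, h2] at h1
  exact ⟨h1.1, h1.2, congrArg Prod.snd h3⟩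

theorem norm_axis_lt {R u : ℝ} (hu : |u| < R) : ‖((u, 0) : Plane)‖ < R := by
  simpa [Prod.norm_def] using hu

theorem norm_axis_lt' {R u : ℝ} (hu : |u| < R) : ‖((0, u) : Plane)‖ < R := by
  simpa [Prod.norm_def] using hu

theorem κ_nonneg (h : AxisChart k f Θ δ R κ) : 0 ≤ κ := by
  have hR := h.R_pos
  have h2 : |R / 2| = R / 2 := abs_of_pos (by positivity)
  obtain ⟨u', hu', -⟩ := h.axis_stable 0 (by simpa using h.δ_pos) (R / 2) (by rw [h2]; linarith)
  have h1 := (abs_nonneg _).trans hu'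
  rw [h2] at h1
  by_contra hκ
  nlinarith

theorem fixed (h : AxisChart k f Θ δ R κ) {ε : Params} (hε : ‖ε‖ < δ) :
    f ε (atPoint Θ ε 0) = atPoint Θ ε 0 := by
  obtain ⟨u', hu', h1⟩ := h.axis_stable ε (by simpa using hε) 0 (by simpa using h.R_pos)
  rw [abs_zero, mul_zero, abs_nonpos_iff] at hu'
  rw [hu'] at h1
  exact h1

theorem orbit (h : AxisChart k f Θ δ R κ) {ε : Params} (hε : ‖ε‖ < δ) {u : ℝ} (hu : |u| < R)
    (n : ℕ) : ∃ u' : ℝ, |u'| ≤ κ ^ n * |u| ∧ |u'| < R ∧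
      (f ε ^ n) (atPoint Θ ε (u, 0)) = atPoint Θ ε (u', 0) := by
  induction n with
  | zero => exact ⟨u, by simp, hu, rfl⟩
  | succ n ih =>
    obtain ⟨v, hv, hvR, hv'⟩ := ih
    obtain ⟨v', h1, h2⟩ := h.axis_stable ε (by simpa using hε) v hvR
    refine ⟨v', ?_, ?_, ?_⟩
    · rw [pow_succ']
      calc _ ≤ κ * |v| := h1
        _ ≤ κ * (κ ^ n * |u|) := mul_le_mul_of_nonneg_left hv h.κ_nonneg
        _ = _ := by ring
    · exact (h1.trans (mul_le_of_le_one_left (abs_nonneg _) h.κ_lt_one.le)).trans_lt hvR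
    · rw [pow_succ', Equiv.Perm.mul_apply, hv', h2]

theorem contDiffOn_atPoint (h : AxisChart k f Θ δ R κ) :
    ContDiffOn ℝ k (fun x : Params × Plane => atPoint Θ x.1 x.2) Θ.target :=
  h.contDiffOn_symm.snd

theorem contDiffAt_atPoint (h : AxisChart k f Θ δ R κ) {ε : Params} {w : Plane} (hε : ‖ε‖ < δ)
    (hw : ‖w‖ < R) : ContDiffAt ℝ k (fun x : Params × Plane => atPoint Θ x.1 x.2) (ε, w) :=
  h.contDiffOn_atPoint.contDiffAt (Θ.open_target.mem_nhds (h.mem_target hε hw))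

theorem contDiffOn_zpow (h : AxisChart k f Θ δ R κ) (m : ℤ) :
    ContDiffOn ℝ k (fun x : Params × Plane => (f x.1 ^ m) x.2)
      (Metric.ball (0 : Params) δ ×ˢ univ) := by
  induction m using Int.induction_on with
  | zero => exact contDiff_snd.contDiffOn
  | succ n ih =>
    simp only [zpow_add_one, Equiv.Perm.mul_apply]
    exact ih.comp (contDiff_fst.contDiffOn.prodMk h.smooth) (fun x hx => ⟨hx.1, mem_univ _⟩)
  | pred n ih =>
    simp only [zpow_sub_one, Equiv.Perm.mul_apply]
    exact ih.comp (contDiff_fst.contDiffOn.prodMk h.smooth_symm) (fun x hx => ⟨hx.1, mem_univ _⟩)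

theorem contDiffAt_zpow (h : AxisChart k f Θ δ R κ) (m : ℤ) {ε : Params} (hε : ‖ε‖ < δ)
    (z : Plane) : ContDiffAt ℝ k (fun x : Params × Plane => (f x.1 ^ m) x.2) (ε, z) :=
  (h.contDiffOn_zpow m).contDiffAt ((Metric.isOpen_ball.prod isOpen_univ).mem_nhds
    ⟨by simpa using hε, mem_univ _⟩)

theorem contDiffAt_zpow_atPoint (h : AxisChart k f Θ δ R κ) (m : ℤ) {ε : Params} {w : Plane}
    (hε : ‖ε‖ < δ) (hw : ‖w‖ < R) :
    ContDiffAt ℝ k (fun x : Params × Plane => (f x.1 ^ m) (atPoint Θ x.1 x.2)) (ε, w) :=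
  ContDiffAt.comp (ε, w) (g := fun x : Params × Plane => (f x.1 ^ m) x.2)
    (f := fun x => (x.1, atPoint Θ x.1 x.2)) (h.contDiffAt_zpow m hε _)
    (contDiffAt_fst.prodMk (h.contDiffAt_atPoint hε hw))

theorem contDiffAt_chart_zpow (h : AxisChart k f Θ δ R κ) (m : ℤ) {ε : Params} {z : Plane}
    (hε : ‖ε‖ < δ) (hz : (ε, (f ε ^ m) z) ∈ Θ.source) :
    ContDiffAt ℝ k (fun x : Params × Plane => (Θ (x.1, (f x.1 ^ m) x.2)).2) (ε, z) :=
  (ContDiffAt.comp (ε, z) (g := Θ) (f := fun x : Params × Plane => (x.1, (f x.1 ^ m) x.2))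
    (h.contDiffOn.contDiffAt (Θ.open_source.mem_nhds hz))
    (contDiffAt_fst.prodMk (h.contDiffAt_zpow m hε _))).snd

theorem contDiffAt_transition (h : AxisChart k f Θ δ R κ) (m : ℤ) {ε : Params} {w : Plane}
    (hε : ‖ε‖ < δ) (hw : ‖w‖ < R) (hm : (ε, (f ε ^ m) (atPoint Θ ε w)) ∈ Θ.source) :
    ContDiffAt ℝ k (fun x : Params × Plane => (Θ (x.1, (f x.1 ^ m) (atPoint Θ x.1 x.2))).2)
      (ε, w) :=
  ContDiffAt.comp (ε, w) (g := fun x : Params × Plane => (Θ (x.1, (f x.1 ^ m) x.2)).2)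
    (f := fun x : Params × Plane => (x.1, atPoint Θ x.1 x.2)) (h.contDiffAt_chart_zpow m hε hm)
    (contDiffAt_fst.prodMk (h.contDiffAt_atPoint hε hw))

/-- Uniform contraction along the stable axis, for all parameters near `0`. -/
theorem exists_uniform_contraction (h : AxisChart k f Θ δ R κ) (hk : 1 ≤ k) :
    ∃ δ' > 0, δ' ≤ δ ∧ ∀ m : ℤ, ∀ η > 0, ∃ N : ℕ, ∀ n ≥ N, ∀ ε : Params, ‖ε‖ < δ' →
      ∀ u : ℝ, |u| < R →
        dist ((f ε ^ n) ((f ε ^ m) (atPoint Θ ε (u, 0)))) (atPoint Θ ε 0) < η := by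
  have hδ := h.δ_pos
  have hR := h.R_pos
  have hk' : (1 : WithTop ℕ∞) ≤ k := by exact_mod_cast hk
  -- The contraction is known in the coordinates; a Lipschitz bound for the chart, valid for all
  -- parameters near `0`, transfers it to distances in the plane.
  obtain ⟨K, t, ht, hK⟩ := ((h.contDiffAt_atPoint (ε := 0) (w := 0) (by simpa using hδ)
    (by simpa using hR)).of_le hk').exists_lipschitzOnWith
  obtain ⟨ρ, hρ, hball⟩ := Metric.mem_nhds_iff.1 ht
  refine ⟨min δ ρ, by positivity, min_le_left _ _, fun m η hη => ?_⟩
  have hlim : Tendsto (fun n : ℕ => κ ^ n * R) atTop (𝓝 0) := by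
    simpa using (tendsto_pow_atTop_nhds_zero_of_lt_one h.κ_nonneg h.κ_lt_one).mul_const R
  have hη' : 0 < min ρ (η / (K + 1)) := lt_min hρ (by positivity)
  obtain ⟨N, hN⟩ := eventually_atTop.1 (hlim.eventually (gt_mem_nhds hη'))
  -- The shift by `m.natAbs` ensures that `n + m` is nonnegative and at least `N`, also for negative
  -- `m`.
  refine ⟨N + m.natAbs, fun n hn ε hε u hu => ?_⟩
  rw [lt_min_iff] at hε
  obtain ⟨l, hl⟩ : ∃ l : ℕ, (l : ℤ) = n + m := ⟨(n + m).toNat, by omega⟩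
  have hlN : N ≤ l := by omega
  have h1 : (f ε ^ n) ((f ε ^ m) (atPoint Θ ε (u, 0))) = (f ε ^ l) (atPoint Θ ε (u, 0)) := by
    rw [← zpow_natCast, ← Equiv.Perm.mul_apply, ← zpow_add, ← hl, zpow_natCast]
  obtain ⟨u', hu', hu'R, h2⟩ := h.orbit hε.1 hu l
  rw [h1, h2]
  have h3 : |u'| < min ρ (η / (K + 1)) := by
    refine (hu'.trans ?_).trans_lt (hN l hlN)
    exact mul_le_mul_of_nonneg_left hu.le (pow_nonneg h.κ_nonneg _)
  rw [lt_min_iff] at h3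
  have hm : ∀ v : ℝ, |v| < ρ → (ε, ((v, 0) : Plane)) ∈ t := fun v hv => hball (by
    rw [mem_ball_iff_norm]
    refine max_lt ?_ (max_lt ?_ ?_)
    · simpa using hε.2
    · simpa using hv
    · simpa using hρ)
  have h4 := hK.dist_le_mul _ (hm u' h3.1) _ (hm 0 (by simpa using hρ))
  have h5 : dist (ε, ((u', 0) : Plane)) (ε, ((0, 0) : Plane)) = |u'| := by
    simp [Prod.dist_eq]
  rw [h5] at h4
  calc _ ≤ K * |u'| := h4
    _ ≤ (K + 1) * |u'| := by nlinarith [abs_nonneg u']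
    _ < (K + 1) * (η / (K + 1)) := by
      apply mul_lt_mul_of_pos_left h3.2
      positivity
    _ = η := by field_simp

/-- The forward orbits of points of the stable axis depend continuously on the point and on the
parameter, uniformly along the orbit. -/
theorem eventually_dist_orbit_lt (h : AxisChart k f Θ δ R κ) (hk : 1 ≤ k) {a : ℝ} (ha : |a| < R)
    {η : ℝ} (hη : 0 < η) : ∀ᶠ x : Params × ℝ in 𝓝 (0, a), ∀ n : ℕ,
      dist ((f x.1 ^ n) (atPoint Θ x.1 (x.2, 0))) ((f 0 ^ n) (atPoint Θ 0 (a, 0))) < η := by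
  have hδ := h.δ_pos
  have hR := h.R_pos
  obtain ⟨δ', hδ', hδδ', hcon⟩ := h.exists_uniform_contraction hk
  -- From time `N` on, both orbits are within `η / 3` of their saddles, and the saddles are within
  -- `η / 3` of each other. The finitely many earlier times are handled by continuity.
  obtain ⟨N, hN⟩ := hcon 0 (η / 3) (by positivity)
  have h0 : ‖(0 : Params)‖ < δ := by simpa using hδ
  have hline : ContinuousAt (fun x : Params × ℝ => (x.1, ((x.2, 0) : Plane))) (0, a) := by
    fun_prop
  have hfin : ∀ n < N, ∀ᶠ x : Params × ℝ in 𝓝 (0, a),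
      dist ((f x.1 ^ n) (atPoint Θ x.1 (x.2, 0))) ((f 0 ^ n) (atPoint Θ 0 (a, 0))) < η := by
    intro n _
    have h1 : ContinuousAt (fun x : Params × ℝ => (f x.1 ^ n) (atPoint Θ x.1 (x.2, 0)))
        (0, a) := by
      have h2 := (h.contDiffAt_zpow_atPoint n h0 (norm_axis_lt ha)).continuousAt
      simp only [zpow_natCast] at h2
      exact ContinuousAt.comp (f := fun x : Params × ℝ => (x.1, ((x.2, 0) : Plane))) h2 hline
    exact Metric.tendsto_nhds.1 h1.tendsto η hη
  have hcenter : ∀ᶠ x : Params × ℝ in 𝓝 (0, a),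
      dist (atPoint Θ x.1 0) (atPoint Θ 0 0) < η / 3 := by
    have h2 := (h.contDiffAt_atPoint (w := 0) h0 (by simpa using hR)).continuousAt
    have h3 : ContinuousAt (fun x : Params × ℝ => atPoint Θ x.1 0) (0, a) :=
      ContinuousAt.comp (x := ((0, a) : Params × ℝ))
        (g := fun x : Params × Plane => atPoint Θ x.1 x.2)
        (f := fun x : Params × ℝ => (x.1, (0 : Plane))) h2 (by fun_prop)
    exact Metric.tendsto_nhds.1 h3.tendsto _ (by positivity)
  have hε : ∀ᶠ x : Params × ℝ in 𝓝 (0, a), ‖x.1‖ < δ' := by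
    have : ContinuousAt (fun x : Params × ℝ => ‖x.1‖) (0, a) := by fun_prop
    exact this.tendsto.eventually (gt_mem_nhds (by simpa using hδ'))
  have hu : ∀ᶠ x : Params × ℝ in 𝓝 (0, a), |x.2| < R := by
    have : ContinuousAt (fun x : Params × ℝ => |x.2|) (0, a) := by fun_prop
    exact this.tendsto.eventually (gt_mem_nhds ha)
  filter_upwards [(Filter.eventually_all_finite (finite_lt_nat N)).2 hfin, hcenter, hε, hu]
    with x h1 h2 h3 h4 n
  rcases lt_or_ge n N with hn | hn
  · exact h1 n hn
  · have e1 := hN n hn x.1 h3 x.2 h4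
    have e2 := hN n hn 0 (by simpa using hδ') a ha
    simp only [zpow_zero, Equiv.Perm.one_apply] at e1 e2
    rw [dist_comm] at e2
    calc _ ≤ _ := dist_triangle4 _ (atPoint Θ x.1 0) (atPoint Θ 0 0) _
      _ < η := by linarith

end AxisChart

/-- A strictly differentiable map that sends the first axis into itself acts on the second
coordinate, up to a small relative error, as the corresponding entry of the derivative. -/
theorem eventually_abs_snd_sub_le {F : Plane → Plane} {D : Plane →L[ℝ] Plane} {a : ℝ}
    (hF : HasStrictFDerivAt F D (a, 0)) (hax : ∀ᶠ x in 𝓝 a, (F (x, 0)).2 = 0) {η : ℝ}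
    (hη : 0 < η) : ∀ᶠ w : Plane in 𝓝 (a, 0), |(F w).2 - (D (0, 1)).2 * w.2| ≤ η * |w.2| := by
  -- Each `w` is compared with its projection to the axis, where the second coordinate of `F`
  -- vanishes; this makes the error proportional to `|w.2|`.
  have ht : Tendsto (fun w : Plane => (w, ((w.1, 0) : Plane))) (𝓝 (a, 0))
      (𝓝 (((a, 0) : Plane), ((a, 0) : Plane))) := by
    have : Continuous (fun w : Plane => (w, ((w.1, 0) : Plane))) := by fun_prop
    exact this.tendsto' _ _ rfl
  have h1 := (continuous_fst.tendsto ((a, 0) : Plane)).eventually hax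
  filter_upwards [ht.eventually (hF.isLittleO.def hη), h1] with w hw hw1
  have h3 : w - (w.1, 0) = w.2 • ((0, 1) : Plane) := by ext <;> simp
  simp only [h3, map_smul] at hw
  have h4 := (norm_snd_le _).trans hw
  rw [norm_smul] at h4
  simp only [Prod.snd_sub, Prod.smul_snd, hw1, sub_zero, smul_eq_mul, Real.norm_eq_abs] at h4
  have h5 : ‖((0, 1) : Plane)‖ = 1 := by simp [Prod.norm_def]
  rw [h5, mul_one, mul_comm w.2] at h4
  exact h4

namespace AxisChart

variable {k : ℕ∞} {f : Params → Equiv.Perm Plane}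
  {Θ : OpenPartialHomeomorph (Params × Plane) (Params × Plane)} {δ R κ : ℝ}

theorem hasStrictFDerivAt_transition (h : AxisChart k f Θ δ R κ) (hk : 1 ≤ k) (m : ℤ)
    {ε : Params} {w : Plane} (hε : ‖ε‖ < δ) (hw : ‖w‖ < R)
    (hm : (ε, (f ε ^ m) (atPoint Θ ε w)) ∈ Θ.source) :
    ∃ D : Plane →L[ℝ] Plane,
      HasStrictFDerivAt (fun v : Plane => (Θ (ε, (f ε ^ m) (atPoint Θ ε v))).2) D w := by
  have hk0 : (k : WithTop ℕ∞) ≠ 0 := by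
    have : (1 : WithTop ℕ∞) ≤ k := by exact_mod_cast hk
    exact (zero_lt_one.trans_le this).ne'
  have h1 : ContDiffAt ℝ k (fun v : Plane => (Θ (ε, (f ε ^ m) (atPoint Θ ε v))).2) w :=
    ContDiffAt.comp w
      (g := fun x : Params × Plane => (Θ (x.1, (f x.1 ^ m) (atPoint Θ x.1 x.2))).2)
      (f := fun v : Plane => (ε, v)) (h.contDiffAt_transition m hε hw hm)
      (contDiffAt_const.prodMk contDiffAt_id)
  exact ⟨_, h1.hasStrictFDerivAt hk0⟩

/-- Expansion transversally to the stable axis. -/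
theorem exists_expansion (h : AxisChart k f Θ δ R κ) (hk : 1 ≤ k) :
    ∃ c > 1, ∃ ρ > 0, ρ ≤ R ∧ ∀ w : Plane, ‖w‖ < ρ →
      c * |w.2| ≤ |(Θ (0, f 0 (atPoint Θ 0 w))).2.2| := by
  have hδ := h.δ_pos
  have hR := h.R_pos
  have hκ := h.κ_nonneg
  have hκ1 := h.κ_lt_one
  have h0 : ‖(0 : Params)‖ < δ := by simpa using hδ
  have h0' : ‖(0 : Plane)‖ < R := by simpa using hR
  obtain ⟨D, hD⟩ := h.hasStrictFDerivAt_transition hk 1 h0 h0' (by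
    rw [zpow_one, h.fixed h0]; exact h.mem_source h0 h0')
  simp only [zpow_one] at hD
  have hlt : ∀ {v u : ℝ}, |v| ≤ κ * |u| → |u| < R → |v| < R := fun hv hu =>
    (hv.trans (mul_le_of_le_one_left (abs_nonneg _) hκ1.le)).trans_lt hu
  have hax : ∀ᶠ x : ℝ in 𝓝 0, (Θ (0, f 0 (atPoint Θ 0 (x, 0)))).2.2 = 0 := by
    have : ∀ᶠ x : ℝ in 𝓝 0, |x| < R := by
      filter_upwards [Metric.ball_mem_nhds (0 : ℝ) hR] with x hx
      simpa using hx
    filter_upwards [this] with x hx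
    obtain ⟨x', hx', h1⟩ := h.axis_stable 0 (by simpa using hδ) x hx
    rw [h1, h.apply_atPoint h0 (norm_axis_lt (hlt hx' hx))]
  -- This choice gives `(1 + 2 * η) * κ < 1`, so that `1 ≤ (|b| + η) * κ` forces `|b| - η > 1`.
  set η : ℝ := (1 - κ) / 4 with hη
  have hηpos : 0 < η := by rw [hη]; linarith
  have hev := eventually_abs_snd_sub_le (a := 0) hD hax hηpos
  set b := (D (0, 1)).2 with hb
  obtain ⟨ρ, hρ, hball⟩ := Metric.eventually_nhds_iff_ball.1 hev
  have hball' : ∀ w : Plane, ‖w‖ < ρ →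
      |(Θ (0, f 0 (atPoint Θ 0 w))).2.2 - b * w.2| ≤ η * |w.2| := fun w hw =>
    hball w (by
      rw [mem_ball_iff_norm, show ((0, 0) : Plane) = 0 from rfl, sub_zero]; exact hw)
  -- The inverse map contracts the unstable axis by `κ`. Reading this as a statement about the image
  -- of `(0, u')` bounds the transverse multiplier `b` from below.
  have hbig : 1 ≤ (|b| + η) * κ := by
    set u : ℝ := min R ρ / 2 with hu
    have hmin : 0 < min R ρ := lt_min hR hρ
    have hupos : 0 < u := by positivity
    have hua : |u| = u := abs_of_pos hupos
    have huR : |u| < R := by rw [hua]; linarith [min_le_left R ρ]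
    obtain ⟨u', hu', h1⟩ := h.axis_unstable 0 (by simpa using hδ) u huR
    have huρ : |u'| < ρ := by
      refine (hu'.trans (mul_le_of_le_one_left (abs_nonneg _) hκ1.le)).trans_lt ?_
      rw [hua]; linarith [min_le_right R ρ]
    rw [Equiv.symm_apply_eq] at h1
    have h2 := hball' (0, u') (norm_axis_lt' huρ)
    rw [← h1, h.apply_atPoint h0 (norm_axis_lt' huR)] at h2
    simp only at h2
    have h3 : |u| ≤ (|b| + η) * |u'| := by
      have h4 := abs_sub_abs_le_abs_sub u (b * u')
      rw [abs_mul] at h4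
      linarith
    rw [hua] at h3 hu'
    have h5 : (|b| + η) * |u'| ≤ (|b| + η) * (κ * u) :=
      mul_le_mul_of_nonneg_left hu' (by positivity)
    by_contra hcon
    push Not at hcon
    nlinarith
  refine ⟨|b| - η, ?_, min R ρ, lt_min hR hρ, min_le_left _ _, fun w hw => ?_⟩
  · by_contra hcon
    push Not at hcon
    have h6 : (|b| + η) * κ ≤ (1 + 2 * η) * κ :=
      mul_le_mul_of_nonneg_right (by linarith) hκ
    rw [hη] at h6
    nlinarith
  · have h2 := hball' w (hw.trans_le (min_le_right _ _))
    have h4 := abs_sub_abs_le_abs_sub (b * w.2) (Θ (0, f 0 (atPoint Θ 0 w))).2.2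
    rw [abs_sub_comm, abs_mul] at h4
    linarith

/-- A point whose forward orbit stays near the saddle lies on the stable axis. -/
theorem exists_nhds_stable (h : AxisChart k f Θ δ R κ) (hk : 1 ≤ k) :
    ∃ W ∈ 𝓝 (atPoint Θ 0 0), ∀ z : Plane, (∀ n : ℕ, (f 0 ^ n) z ∈ W) →
      ((0, z) : Params × Plane) ∈ Θ.source ∧ (Θ (0, z)).2.2 = 0 := by
  have hδ := h.δ_pos
  have hR := h.R_pos
  have h0 : ‖(0 : Params)‖ < δ := by simpa using hδ
  have h0' : ‖(0 : Plane)‖ < R := by simpa using hR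
  obtain ⟨c, hc, ρ, hρ, hρR, hexp⟩ := h.exists_expansion hk
  refine ⟨{z | (0, z) ∈ Θ.source ∧ ‖(Θ (0, z)).2‖ < ρ}, ?_, fun z hz => ⟨(hz 0).1, ?_⟩⟩
  · have hs := h.mem_source h0 h0'
    have hcont : ContinuousAt (fun z : Plane => ((0, z) : Params × Plane)) (atPoint Θ 0 0) := by
      fun_prop
    have h1 : ∀ᶠ x in 𝓝 ((0, atPoint Θ 0 0) : Params × Plane), x ∈ Θ.source ∧ ‖(Θ x).2‖ < ρ := by
      refine (Θ.open_source.eventually_mem hs).and ?_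
      have h2 : ContinuousAt (fun x => ‖(Θ x).2‖) ((0, atPoint Θ 0 0) : Params × Plane) :=
        (Θ.continuousAt hs).snd.norm
      refine h2.tendsto.eventually (gt_mem_nhds ?_)
      rw [h.apply_atPoint h0 h0']
      simpa using hρ
    exact hcont.tendsto.eventually h1
  -- As long as the orbit stays in the neighbourhood its height above the axis grows at least like
  -- `c ^ n`, so it can remain bounded only if it is zero.
  · have hind : ∀ n : ℕ, c ^ n * |(Θ (0, z)).2.2| ≤ |(Θ (0, (f 0 ^ n) z)).2.2| := by
      intro n
      induction n with
      | zero => simp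
      | succ n ih =>
        have h1 := hexp (Θ (0, (f 0 ^ n) z)).2 (hz n).2
        rw [(h.apply_mem (hz n).1).2.2, ← Equiv.Perm.mul_apply, ← pow_succ'] at h1
        calc _ = c * (c ^ n * |(Θ (0, z)).2.2|) := by ring
          _ ≤ _ := mul_le_mul_of_nonneg_left ih (by linarith)
          _ ≤ _ := h1
    by_contra hne
    have hpos : 0 < |(Θ (0, z)).2.2| := abs_pos.2 hne
    obtain ⟨n, hn⟩ := pow_unbounded_of_one_lt (ρ / |(Θ (0, z)).2.2|) hc
    rw [div_lt_iff₀ hpos] at hn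
    have h3 : |(Θ (0, (f 0 ^ n) z)).2.2| < ρ := (norm_snd_le _).trans_lt (hz n).2
    linarith [hind n]

/-- Points near a point of the stable axis which are uniformly attracted by the saddle lie on the
stable axis. -/
theorem eventually_mem_stable (h : AxisChart k f Θ δ R κ) (hk : 1 ≤ k) {a : ℝ} (ha : |a| < R)
    {E : Set Plane} (hE : TendstoUniformlyOn (fun (n : ℕ) z => (f 0 ^ n) z)
      (fun _ => atPoint Θ 0 0) atTop E) :
    ∀ᶠ z in 𝓝 (atPoint Θ 0 (a, 0)), z ∈ E → (Θ (0, z)).2.2 = 0 := by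
  have hδ := h.δ_pos
  have hR := h.R_pos
  have h0 : ‖(0 : Params)‖ < δ := by simpa using hδ
  have ha' : ‖((a, 0) : Plane)‖ < R := norm_axis_lt ha
  obtain ⟨W, hW, hWs⟩ := h.exists_nhds_stable hk
  obtain ⟨s, hs, hsW⟩ := Metric.mem_nhds_iff.1 hW
  obtain ⟨N, hN⟩ := eventually_atTop.1 (Metric.tendstoUniformlyOn_iff.1 hE s hs)
  -- Uniform attraction brings the whole set into the trapping neighbourhood after one common time
  -- `N`, so its image under `f^N` lies on the axis. The rest of the proof pulls this back to time
  -- `0`.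
  have hEN : ∀ z ∈ E, (Θ (0, (f 0 ^ N) z)).2.2 = 0 := fun z hz => (hWs _ (fun n => by
    rw [← Equiv.Perm.mul_apply, ← pow_add]
    refine hsW ?_
    rw [Metric.mem_ball, dist_comm]
    exact hN (n + N) (by omega) z hz)).2
  obtain ⟨a', -, ha'R, haN⟩ := h.orbit h0 ha N
  have hsrc : ((0, (f 0 ^ (N : ℤ)) (atPoint Θ 0 (a, 0))) : Params × Plane) ∈ Θ.source := by
    rw [zpow_natCast, haN]; exact h.mem_source h0 (norm_axis_lt ha'R)
  obtain ⟨D, hD⟩ := h.hasStrictFDerivAt_transition hk N h0 ha' hsrc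
  obtain ⟨D', hD'⟩ := h.hasStrictFDerivAt_transition hk (-N) h0 (norm_axis_lt ha'R) (by
    rw [← haN, ← zpow_natCast, ← Equiv.Perm.mul_apply, ← zpow_add]
    simpa using h.mem_source h0 ha')
  have hax : ∀ᶠ x : ℝ in 𝓝 a, (Θ (0, (f 0 ^ (N : ℤ)) (atPoint Θ 0 (x, 0)))).2.2 = 0 := by
    have : ∀ᶠ x : ℝ in 𝓝 a, |x| < R :=
      (continuous_abs.tendsto a).eventually (gt_mem_nhds ha)
    filter_upwards [this] with x hx
    obtain ⟨x', -, hx'R, hx'⟩ := h.orbit h0 hx N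
    rw [zpow_natCast, hx', h.apply_atPoint h0 (norm_axis_lt hx'R)]
  -- the derivative is injective and preserves the first axis
  have hFa : (Θ (0, (f 0 ^ (N : ℤ)) (atPoint Θ 0 (a, 0)))).2 = (a', 0) := by
    rw [zpow_natCast, haN, h.apply_atPoint h0 (norm_axis_lt ha'R)]
  have hinv : ∀ᶠ w in 𝓝 ((a, 0) : Plane), (Θ (0, (f 0 ^ (-N : ℤ)) (atPoint Θ 0
      (Θ (0, (f 0 ^ (N : ℤ)) (atPoint Θ 0 w))).2))).2 = w := by
    have hc1 : ContinuousAt (fun w : Plane =>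
        ((0, (f 0 ^ (N : ℤ)) (atPoint Θ 0 w)) : Params × Plane)) (a, 0) := by
      refine continuousAt_const.prodMk ?_
      exact ContinuousAt.comp (x := ((a, 0) : Plane))
        (g := fun x : Params × Plane => (f x.1 ^ (N : ℤ)) (atPoint Θ x.1 x.2))
        (f := fun w : Plane => ((0, w) : Params × Plane))
        (h.contDiffAt_zpow_atPoint N h0 ha').continuousAt (by fun_prop)
    have hc2 : ∀ᶠ w : Plane in 𝓝 (a, 0), ‖w‖ < R :=
      (continuous_norm.tendsto _).eventually (gt_mem_nhds ha')
    filter_upwards [hc1.tendsto.eventually (Θ.open_source.eventually_mem hsrc), hc2] with w h1 h2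
    rw [(h.apply_mem h1).2.2, ← Equiv.Perm.mul_apply, ← zpow_add, neg_add_cancel, zpow_zero,
      Equiv.Perm.one_apply, h.apply_atPoint h0 h2]
  have hDD : ∀ v, D' (D v) = v := by
    intro v
    have h1 := hD.hasFDerivAt
    have h2 := hD'.hasFDerivAt
    rw [← hFa] at h2
    have h3 := (HasFDerivAt.comp
      (g := fun v : Plane => (Θ (0, (f 0 ^ (-N : ℤ)) (atPoint Θ 0 v))).2)
      (f := fun v : Plane => (Θ (0, (f 0 ^ (N : ℤ)) (atPoint Θ 0 v))).2) (a, 0) h2 h1).congr_of_eventuallyEq (f₁ := id)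
      (by filter_upwards [hinv] with w hw using hw.symm)
    exact (congrArg (fun T : Plane →L[ℝ] Plane => T v) (h3.unique (hasFDerivAt_id _)))
  have hD1 : (D (1, 0)).2 = 0 := by
    have h1 : HasDerivAt (fun x : ℝ => ((x, 0) : Plane)) (1, 0) a :=
      (hasDerivAt_id _).prodMk (hasDerivAt_const _ _)
    have h2 : HasDerivAt (fun x : ℝ => (Θ (0, (f 0 ^ (N : ℤ)) (atPoint Θ 0 (x, 0)))).2)
        (D (1, 0)) a := by
      have h3 := hD.hasFDerivAt
      exact h3.comp_hasDerivAt a h1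
    have h4 : HasDerivAt (fun x : ℝ => (Θ (0, (f 0 ^ (N : ℤ)) (atPoint Θ 0 (x, 0)))).2.2)
        (D (1, 0)).2 a := (ContinuousLinearMap.snd ℝ ℝ ℝ).hasFDerivAt.comp_hasDerivAt a h2
    refine h4.unique ((hasDerivAt_const a (0 : ℝ)).congr_of_eventuallyEq ?_)
    filter_upwards [hax] with x hx using hx
  -- An injective derivative that preserves the first axis has nonzero second diagonal entry.
  have hb : (D (0, 1)).2 ≠ 0 := by
    intro hb
    have h1 : D (((D (0, 1)).1 • ((1, 0) : Plane)) - (D (1, 0)).1 • ((0, 1) : Plane)) = 0 := by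
      rw [map_sub, map_smul, map_smul]
      ext
      · simp; ring
      · simp [hb, hD1]
    have h2 := hDD (((D (0, 1)).1 • ((1, 0) : Plane)) - (D (1, 0)).1 • ((0, 1) : Plane))
    rw [h1, map_zero] at h2
    have h3 := congrArg Prod.snd h2
    simp only [Prod.snd_zero, Prod.snd_sub, Prod.smul_snd, smul_eq_mul, mul_zero, mul_one,
      zero_sub] at h3
    have h4 : D (1, 0) = 0 := Prod.ext (by simpa using h3.symm) hD1
    have h5 := hDD (1, 0)
    rw [h4, map_zero] at h5
    simpa using congrArg Prod.fst h5
  -- With relative error `|b| / 2`, vanishing of the height after `N` steps forces the initial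
  -- height to vanish.
  have hev := eventually_abs_snd_sub_le hD hax (half_pos (abs_pos.2 hb))
  have hs0 := h.mem_source h0 ha'
  have hcz : ContinuousAt (fun z : Plane => (Θ (0, z)).2) (atPoint Θ 0 (a, 0)) :=
    (ContinuousAt.comp (x := atPoint Θ 0 (a, 0)) (g := Θ)
      (f := fun z : Plane => ((0, z) : Params × Plane)) (Θ.continuousAt hs0)
      (by fun_prop)).snd
  have hcz' : Tendsto (fun z : Plane => (Θ (0, z)).2) (𝓝 (atPoint Θ 0 (a, 0))) (𝓝 (a, 0)) := by
    have := hcz.tendsto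
    rwa [h.apply_atPoint h0 ha'] at this
  have hsz : ∀ᶠ z in 𝓝 (atPoint Θ 0 (a, 0)), ((0, z) : Params × Plane) ∈ Θ.source := by
    have : ContinuousAt (fun z : Plane => ((0, z) : Params × Plane)) (atPoint Θ 0 (a, 0)) := by
      fun_prop
    exact this.tendsto.eventually (Θ.open_source.eventually_mem hs0)
  filter_upwards [hcz'.eventually hev, hsz] with z h1 h2 hzE
  rw [(h.apply_mem h2).2.2, zpow_natCast, hEN z hzE, zero_sub, abs_neg, abs_mul] at h1
  by_contra hne
  have hpos : 0 < |(Θ (0, z)).2.2| := abs_pos.2 hne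
  nlinarith [abs_pos.2 hb]

end AxisChart

/-- Existence of adapted coordinates whose domain contains two points of the homoclinic orbit. -/
theorem exists_adaptedChart_globalMapData {r : ℕ∞} (hr : 1 ≤ r) {V : Set Params}
    {f : Params → Equiv.Perm Plane} (hf : IsSymplecticFamily r V f) {O : Plane} {lam : ℝ}
    (hO : IsSaddle (f 0) O lam) {M : Plane} (hM : IsHomoclinic (f 0) O M) :
    ∃ (Θ : OpenPartialHomeomorph (Params × Plane) (Params × Plane)) (δ R : ℝ)
      (j : ℤ) (q : ℕ) (ym xp : ℝ),
      IsAdaptedChart r V f O Θ δ R ∧ IsGlobalMapData f M Θ R j q ym xp := by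
  obtain ⟨Θ, δ, R, hΘ⟩ := exists_isAdaptedChart hr hf hO
  obtain ⟨κ, h⟩ := hΘ.exists_axisChart le_rfl hr hf
  obtain ⟨W₁, hW₁, hs₁⟩ := h.exists_nhds_stable hr
  obtain ⟨W₂, hW₂, hs₂⟩ := h.swap.exists_nhds_stable hr
  rw [atPoint_swapChart, Prod.swap_zero] at hW₂
  rw [hΘ.origin] at hW₁ hW₂
  have hst : Tendsto (fun n : ℕ => (f 0 ^ n) M) atTop (𝓝 O) := hM.2.2
  have hun : Tendsto (fun n : ℕ => (f 0 ^ n).symm M) atTop (𝓝 O) := hM.2.1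
  -- The whole forward orbit from time `N` and the whole backward orbit from time `-N'` stay in the
  -- trapping neighbourhoods. The points at these two times therefore lie on the axes and serve as
  -- `M⁺` and `M⁻`.
  obtain ⟨N, hN⟩ := eventually_atTop.1 (hst.eventually hW₁)
  obtain ⟨N', hN'⟩ := eventually_atTop.1 (hun.eventually hW₂)
  obtain ⟨a1, a2⟩ := hs₁ ((f 0 ^ N) M) (fun n => by
    rw [← Equiv.Perm.mul_apply, ← pow_add]
    exact hN _ (by omega))
  obtain ⟨b1, b2⟩ := hs₂ ((f 0 ^ N').symm M) (fun n => by
    have h1 : ((f 0)⁻¹ ^ n) ((f 0 ^ N').symm M) = (f 0 ^ (n + N')).symm M := by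
      rw [← Equiv.Perm.inv_def, ← Equiv.Perm.inv_def, ← inv_pow, ← inv_pow,
        ← Equiv.Perm.mul_apply, ← pow_add]
    rw [h1]
    exact hN' _ (by omega))
  rw [swapChart_source] at b1
  rw [swapChart_apply, Prod.snd_swap] at b2
  obtain ⟨-, a3, a4⟩ := h.apply_mem a1
  obtain ⟨-, b3, b4⟩ := h.apply_mem b1
  refine ⟨Θ, δ, R, -N', N' + N, (Θ (0, (f 0 ^ N').symm M)).2.2, (Θ (0, (f 0 ^ N) M)).2.1, hΘ,
    (norm_snd_le _).trans_lt b3, (norm_fst_le _).trans_lt a3, ?_, ?_⟩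
  · rw [zpow_neg, zpow_natCast, Equiv.Perm.inv_def, ← b2]
    exact b4
  · rw [Nat.cast_add, neg_add_cancel_left, zpow_natCast, ← a2]
    exact a4

/-! ### Contacts of the invariant manifolds and zeros of the splitting function. -/

namespace AxisChart

variable {k : ℕ∞} {f : Params → Equiv.Perm Plane}
  {Θ : OpenPartialHomeomorph (Params × Plane) (Params × Plane)} {δ R κ : ℝ}

theorem coe_ne_zero (hk : 1 ≤ k) : (k : WithTop ℕ∞) ≠ 0 := by
  have : (1 : WithTop ℕ∞) ≤ k := by exact_mod_cast hk
  exact (zero_lt_one.trans_le this).ne'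

theorem zpow_neg_apply (g : Equiv.Perm Plane) (m : ℤ) (z : Plane) : (g ^ (-m)) ((g ^ m) z) = z := by
  rw [← Equiv.Perm.mul_apply, ← zpow_add, neg_add_cancel, zpow_zero, Equiv.Perm.one_apply]

theorem zpow_apply_neg (g : Equiv.Perm Plane) (m : ℤ) (z : Plane) : (g ^ m) ((g ^ (-m)) z) = z := by
  rw [← Equiv.Perm.mul_apply, ← zpow_add, add_neg_cancel, zpow_zero, Equiv.Perm.one_apply]

theorem contDiffAt_zpow_fiber (h : AxisChart k f Θ δ R κ) (m : ℤ) {ε : Params} (hε : ‖ε‖ < δ)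
    (z : Plane) : ContDiffAt ℝ k (f ε ^ m) z :=
  ContDiffAt.comp z (g := fun x : Params × Plane => (f x.1 ^ m) x.2)
    (f := fun v : Plane => (ε, v)) (h.contDiffAt_zpow m hε z)
    (contDiffAt_const.prodMk contDiffAt_id)

theorem contDiffAt_chart_zpow_fiber (h : AxisChart k f Θ δ R κ) (m : ℤ) {ε : Params} {z : Plane}
    (hε : ‖ε‖ < δ) (hz : (ε, (f ε ^ m) z) ∈ Θ.source) :
    ContDiffAt ℝ k (fun w : Plane => (Θ (ε, (f ε ^ m) w)).2) z :=
  ContDiffAt.comp z (g := fun x : Params × Plane => (Θ (x.1, (f x.1 ^ m) x.2)).2)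
    (f := fun v : Plane => (ε, v)) (h.contDiffAt_chart_zpow m hε hz)
    (contDiffAt_const.prodMk contDiffAt_id)

theorem contDiffAt_zpow_atPoint_fiber (h : AxisChart k f Θ δ R κ) (m : ℤ) {ε : Params} {w : Plane}
    (hε : ‖ε‖ < δ) (hw : ‖w‖ < R) :
    ContDiffAt ℝ k (fun v : Plane => (f ε ^ m) (atPoint Θ ε v)) w :=
  ContDiffAt.comp w (g := fun x : Params × Plane => (f x.1 ^ m) (atPoint Θ x.1 x.2))
    (f := fun v : Plane => (ε, v)) (h.contDiffAt_zpow_atPoint m hε hw)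
    (contDiffAt_const.prodMk contDiffAt_id)

/-- The images of the unstable axis are regular curves. -/
theorem deriv_curve_ne_zero (h : AxisChart k f Θ δ R κ) (hk : 1 ≤ k) (m : ℤ) {ε : Params} {y : ℝ}
    (hε : ‖ε‖ < δ) (hy : |y| < R) :
    deriv (fun t : ℝ => (f ε ^ m) (atPoint Θ ε (0, y + t))) 0 ≠ 0 := by
  intro h0
  have hy' : ‖((0, y + 0) : Plane)‖ < R := norm_axis_lt' (by simpa using hy)
  have hγ : DifferentiableAt ℝ (fun t : ℝ => (f ε ^ m) (atPoint Θ ε (0, y + t))) 0 :=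
    DifferentiableAt.comp (0 : ℝ) (g := fun v : Plane => (f ε ^ m) (atPoint Θ ε v))
      (f := fun t : ℝ => ((0, y + t) : Plane))
      ((h.contDiffAt_zpow_atPoint_fiber m hε hy').differentiableAt (coe_ne_zero hk)) (by fun_prop)
  have hd := hγ.hasDerivAt
  rw [h0] at hd
  -- Undoing the iterate and the chart turns the curve back into `t ↦ (0, y + t)`, whose velocity is
  -- `(0, 1)`; a zero velocity is therefore impossible.
  have hΦ := (h.contDiffAt_chart_zpow_fiber (-m) (z := (f ε ^ m) (atPoint Θ ε (0, y + 0))) hε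
    (by rw [zpow_neg_apply]; exact h.mem_source hε hy')).differentiableAt (coe_ne_zero hk)
  have h1 := HasFDerivAt.comp_hasDerivAt (0 : ℝ) hΦ.hasFDerivAt hd
  rw [map_zero] at h1
  have h2 : HasDerivAt (fun t : ℝ => ((0, y + t) : Plane)) (0, 1) 0 :=
    (hasDerivAt_const _ _).prodMk ((hasDerivAt_id _).const_add y)
  have hev : ∀ᶠ t : ℝ in 𝓝 0, |y + t| < R := by
    have : ContinuousAt (fun t : ℝ => |y + t|) 0 := by fun_prop
    exact this.tendsto.eventually (gt_mem_nhds (by simpa using hy))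
  have h3 := h2.unique (h1.congr_of_eventuallyEq (by
    filter_upwards [hev] with t ht
    simp only [Function.comp_apply, zpow_neg_apply]
    rw [h.apply_atPoint hε (norm_axis_lt' ht)]))
  simpa using congrArg Prod.snd h3

/-- The functions defining the preimages of the stable axis are regular. -/
theorem fderiv_snd_ne_zero (h : AxisChart k f Θ δ R κ) (hk : 1 ≤ k) (m : ℤ) {ε : Params}
    {z : Plane} (hε : ‖ε‖ < δ) (hz : (ε, (f ε ^ m) z) ∈ Θ.source) :
    fderiv ℝ (fun w : Plane => (Θ (ε, (f ε ^ m) w)).2.2) z ≠ 0 := by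
  intro h0
  obtain ⟨-, hc, hcz⟩ := h.apply_mem hz
  set c := (Θ (ε, (f ε ^ m) z)).2 with hcdef
  have hd : HasFDerivAt (fun w : Plane => (Θ (ε, (f ε ^ m) w)).2.2) (0 : Plane →L[ℝ] ℝ) z := by
    rw [← h0]
    exact ((h.contDiffAt_chart_zpow_fiber m hε hz).snd.differentiableAt
      (coe_ne_zero hk)).hasFDerivAt
  -- The test curve is the preimage of a vertical line, along which the function grows with unit
  -- speed.
  have hline : DifferentiableAt ℝ (fun t : ℝ => (f ε ^ (-m)) (atPoint Θ ε (c + t • (0, 1)))) 0 :=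
    DifferentiableAt.comp (0 : ℝ) (g := fun v : Plane => (f ε ^ (-m)) (atPoint Θ ε v))
      (f := fun t : ℝ => (c + t • (0, 1) : Plane))
      ((h.contDiffAt_zpow_atPoint_fiber (-m) hε (by simpa using hc)).differentiableAt
        (coe_ne_zero hk)) (by fun_prop)
  have hz0 : (f ε ^ (-m)) (atPoint Θ ε (c + (0 : ℝ) • (0, 1))) = z := by
    rw [zero_smul, add_zero, hcz, zpow_neg_apply]
  rw [← hz0] at hd
  have h1 := HasFDerivAt.comp_hasDerivAt (0 : ℝ) hd hline.hasDerivAt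
  rw [zero_apply] at h1
  have h2 : HasDerivAt (fun t : ℝ => c.2 + t) 1 0 := (hasDerivAt_id _).const_add _
  have hev : ∀ᶠ t : ℝ in 𝓝 0, ‖c + t • ((0, 1) : Plane)‖ < R := by
    have : ContinuousAt (fun t : ℝ => ‖c + t • ((0, 1) : Plane)‖) 0 := by fun_prop
    exact this.tendsto.eventually (gt_mem_nhds (by simpa using hc))
  have h3 := h2.unique (h1.congr_of_eventuallyEq (by
    filter_upwards [hev] with t ht
    simp only [Function.comp_apply, zpow_apply_neg]
    rw [h.apply_atPoint hε ht]
    simp))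
  exact one_ne_zero h3

theorem symm_pow_eq (g : Equiv.Perm Plane) (n : ℕ) (z : Plane) :
    (g ^ n).symm z = (g⁻¹ ^ n) z := by
  rw [← Equiv.Perm.inv_def, inv_pow]

theorem inv_zpow_neg (g : Equiv.Perm Plane) (m : ℤ) : (g⁻¹) ^ (-m) = g ^ m := by
  rw [inv_zpow', neg_neg]

/-- A multiple zero of the splitting function gives a contact of the invariant manifolds along
the corresponding homoclinic orbit. -/
theorem exists_hasContact (h : AxisChart k f Θ δ R κ) (hk : 3 ≤ k) (q : ℕ) :
    ∃ δ' > 0, ∀ ε : Params, ‖ε‖ < δ' → ∀ y : ℝ, |y| < R →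
      (ε, (f ε ^ q) (atPoint Θ ε (0, y))) ∈ Θ.source → ∀ m ≤ 2,
      (∀ i ≤ m, iteratedDeriv i (splitting f Θ q ε) y = 0) →
      iteratedDeriv (m + 1) (splitting f Θ q ε) y ≠ 0 → ∀ n : ℤ,
      HasContact (f ε) (atPoint Θ ε 0) ((f ε ^ n) ((f ε ^ q) (atPoint Θ ε (0, y)))) m := by
  have hk1 : 1 ≤ k := le_trans (by norm_num) hk
  obtain ⟨δ₁, hδ₁, hδ₁', hc₁⟩ := h.exists_uniform_contraction hk1
  obtain ⟨δ₂, hδ₂, hδ₂', hc₂⟩ := h.swap.exists_uniform_contraction hk1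
  refine ⟨min δ₁ δ₂, lt_min hδ₁ hδ₂, fun ε hε y hy hsrc m hm hz hnz n => ?_⟩
  rw [lt_min_iff] at hε
  have hεδ : ‖ε‖ < δ := hε.1.trans_le hδ₁'
  have hmk : (((m + 1 : ℕ) : WithTop ℕ∞)) ≤ k := by
    have : ((m + 1 : ℕ) : ℕ∞) ≤ k := le_trans (by exact_mod_cast (by omega : m + 1 ≤ 3)) hk
    exact_mod_cast this
  have hy' : ‖((0, y + 0) : Plane)‖ < R := norm_axis_lt' (by simpa using hy)
  set z := (f ε ^ n) ((f ε ^ q) (atPoint Θ ε (0, y))) with hzdef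
  have hγz : ∀ w, (f ε ^ (n + q)) w = (f ε ^ n) ((f ε ^ q) w) := fun w => by
    rw [zpow_add, zpow_natCast, Equiv.Perm.mul_apply]
  have hzs : (ε, (f ε ^ (-n)) z) ∈ Θ.source := by rw [hzdef, zpow_neg_apply]; exact hsrc
  -- The iterate `n` cancels between the curve and the defining function, so the order of contact is
  -- the same at every point of the orbit.
  have hcomp : ((fun w : Plane => (Θ (ε, (f ε ^ (-n)) w)).2.2) ∘
      fun t : ℝ => (f ε ^ (n + q)) (atPoint Θ ε (0, y + t))) =
      fun t => splitting f Θ q ε (y + t) := by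
    funext t
    simp only [Function.comp_apply, hγz, zpow_neg_apply]
    rfl
  refine ⟨fun t => (f ε ^ (n + q)) (atPoint Θ ε (0, y + t)),
    fun w => (Θ (ε, (f ε ^ (-n)) w)).2.2, ?_, ?_, h.deriv_curve_ne_zero hk1 _ hεδ hy,
    ?_, ?_, h.fderiv_snd_ne_zero hk1 (-n) hεδ hzs, ?_, ?_, ?_⟩
  · refine ContDiffAt.of_le ?_ hmk
    exact ContDiffAt.comp (0 : ℝ) (g := fun v : Plane => (f ε ^ (n + q)) (atPoint Θ ε v))
      (f := fun t : ℝ => ((0, y + t) : Plane)) (h.contDiffAt_zpow_atPoint_fiber _ hεδ hy')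
      (by fun_prop)
  · simp only [add_zero, hγz, hzdef]
  · refine ⟨{t | |y + t| < R}, ?_, ?_⟩
    · have : ContinuousAt (fun t : ℝ => |y + t|) 0 := by fun_prop
      exact this.tendsto.eventually (gt_mem_nhds (by simpa using hy))
    · rw [Metric.tendstoUniformlyOn_iff]
      intro η hη
      obtain ⟨N, hN⟩ := hc₂ (-(n + q)) η hη
      filter_upwards [eventually_ge_atTop N] with l hl t ht
      rw [dist_comm, symm_pow_eq]
      have := hN l hl ε hε.2 (y + t) ht
      rwa [inv_zpow_neg] at this
  · exact ((h.contDiffAt_chart_zpow_fiber (-n) hεδ hzs).snd).of_le hmk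
  · refine ⟨{w | (ε, (f ε ^ (-n)) w) ∈ Θ.source}, ?_, ?_⟩
    · have h1 : ContinuousAt (fun w : Plane => (ε, (f ε ^ (-n)) w)) z :=
        continuousAt_const.prodMk (h.contDiffAt_zpow_fiber (-n) hεδ z).continuousAt
      exact h1.tendsto.eventually (Θ.open_source.eventually_mem hzs)
    · rw [Metric.tendstoUniformlyOn_iff]
      intro η hη
      obtain ⟨N, hN⟩ := hc₁ n η hη
      filter_upwards [eventually_ge_atTop N] with l hl w hw
      obtain ⟨-, h2, h3⟩ := h.apply_mem hw.1
      have h4 : (Θ (ε, (f ε ^ (-n)) w)).2 = ((Θ (ε, (f ε ^ (-n)) w)).2.1, 0) :=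
        Prod.ext rfl hw.2
      have h5 := hN l hl ε hε.1 _ ((norm_fst_le _).trans_lt h2)
      rw [← h4, h3, zpow_apply_neg] at h5
      rw [dist_comm]
      exact h5
  · intro i hi
    rw [hcomp, iteratedDeriv_comp_const_add]
    simpa using hz i hi
  · rw [hcomp, iteratedDeriv_comp_const_add]
    simpa using hnz

end AxisChart

namespace AxisChart

variable {k : ℕ∞} {f : Params → Equiv.Perm Plane}
  {Θ : OpenPartialHomeomorph (Params × Plane) (Params × Plane)} {δ R κ : ℝ}

/-- The coordinate axes provide regular descriptions of the invariant manifolds along the orbit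
of a homoclinic point. -/
theorem describesManifolds (h : AxisChart k f Θ δ R κ) (hk : 2 ≤ k) {O M : Plane}
    (hO : atPoint Θ 0 0 = O) {j : ℤ} {q : ℕ} {ym xp : ℝ} (hD : IsGlobalMapData f M Θ R j q ym xp) :
    DescribesManifolds f O M (fun ε => atPoint Θ ε 0)
      (fun x => (Θ (x.1, (f x.1 ^ (j + q)) x.2)).2.2)
      (fun x => (f x.1 ^ (-j)) (atPoint Θ x.1 (0, ym + x.2))) := by
  obtain ⟨hym, hxp, hm, hp⟩ := hD
  have hδ := h.δ_pos
  have hR := h.R_pos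
  have hk1 : 1 ≤ k := le_trans (by norm_num) hk
  have hk2 : (2 : WithTop ℕ∞) ≤ k := WithTop.coe_le_coe.2 hk
  have h0 : ‖(0 : Params)‖ < δ := by simpa using hδ
  have hy0 : ‖((0, ym + 0) : Plane)‖ < R := norm_axis_lt' (by simpa using hym)
  obtain ⟨δ₁, hδ₁, hδ₁', hc₁⟩ := h.exists_uniform_contraction hk1
  obtain ⟨δ₂, hδ₂, hδ₂', hc₂⟩ := h.swap.exists_uniform_contraction hk1
  have hsrc : ((0, (f 0 ^ (j + q)) M) : Params × Plane) ∈ Θ.source := by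
    rw [← hp]; exact h.mem_source h0 (norm_axis_lt hxp)
  have hγ0 : (f 0 ^ (-j)) (atPoint Θ 0 (0, ym + 0)) = M := by
    rw [add_zero, hm, zpow_neg_apply]
  refine ⟨hO, ?_, ?_, ?_, hγ0, h.deriv_curve_ne_zero hk1 (-j) h0 hym, ?_, ?_, ?_,
    h.fderiv_snd_ne_zero hk1 _ h0 hsrc, ?_⟩
  · exact ContinuousAt.comp (x := (0 : Params))
      (g := fun x : Params × Plane => atPoint Θ x.1 x.2) (f := fun ε : Params => (ε, (0 : Plane)))
      (h.contDiffAt_atPoint h0 (by simpa using hR)).continuousAt (by fun_prop)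
  · filter_upwards [Metric.ball_mem_nhds (0 : Params) hδ] with ε hε
    exact h.fixed (by simpa using hε)
  · refine ContDiffAt.of_le ?_ hk2
    exact ContDiffAt.comp ((0, 0) : Params × ℝ)
      (g := fun x : Params × Plane => (f x.1 ^ (-j)) (atPoint Θ x.1 x.2))
      (f := fun x : Params × ℝ => (x.1, ((0, ym + x.2) : Plane)))
      (h.contDiffAt_zpow_atPoint _ h0 hy0) (by fun_prop)
  · refine ⟨{x | ‖x.1‖ < δ₂ ∧ |ym + x.2| < R}, ?_, ?_⟩
    · have h1 : ContinuousAt (fun x : Params × ℝ => ‖x.1‖) (0, 0) := by fun_prop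
      have h2 : ContinuousAt (fun x : Params × ℝ => |ym + x.2|) (0, 0) := by fun_prop
      exact (h1.tendsto.eventually (gt_mem_nhds (by simpa using hδ₂))).and
        (h2.tendsto.eventually (gt_mem_nhds (by simpa using hym)))
    · rw [Metric.tendstoUniformlyOn_iff]
      intro η hη
      obtain ⟨N, hN⟩ := hc₂ j η hη
      filter_upwards [eventually_ge_atTop N] with l hl x hx
      rw [dist_comm, symm_pow_eq]
      have := hN l hl x.1 hx.1 (ym + x.2) hx.2
      rw [← neg_neg j, inv_zpow_neg] at this
      exact this
  · exact ((h.contDiffAt_chart_zpow (j + q) h0 hsrc).snd).of_le hk2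
  · simp only [← hp, h.apply_atPoint h0 (norm_axis_lt hxp)]
  · refine ⟨{x | ‖x.1‖ < δ₁ ∧ (x.1, (f x.1 ^ (j + q)) x.2) ∈ Θ.source}, ?_, ?_⟩
    · have h1 : ContinuousAt (fun x : Params × Plane => ‖x.1‖) (0, M) := by fun_prop
      have h2 : ContinuousAt (fun x : Params × Plane => (x.1, (f x.1 ^ (j + q)) x.2)) (0, M) :=
        continuousAt_fst.prodMk (h.contDiffAt_zpow _ h0 M).continuousAt
      exact (h1.tendsto.eventually (gt_mem_nhds (by simpa using hδ₁))).and
        (h2.tendsto.eventually (Θ.open_source.eventually_mem hsrc))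
    · rw [Metric.tendstoUniformlyOn_iff]
      intro η hη
      obtain ⟨N, hN⟩ := hc₁ (-(j + q)) η hη
      filter_upwards [eventually_ge_atTop N] with l hl x hx
      obtain ⟨-, h2, h3⟩ := h.apply_mem hx.1.2
      have h4 : (Θ (x.1, (f x.1 ^ (j + q)) x.2)).2 =
        ((Θ (x.1, (f x.1 ^ (j + q)) x.2)).2.1, 0) := Prod.ext rfl hx.2
      have h5 := hN l hl x.1 hx.1.1 _ ((norm_fst_le _).trans_lt h2)
      rw [← h4, h3, zpow_neg_apply] at h5
      rw [dist_comm]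
      exact h5

/-- For a general unfolding the splitting function and its derivative have nonzero Jacobian. -/
theorem splitting_jacobian_ne_zero (h : AxisChart k f Θ δ R κ) (hk : 2 ≤ k) {O M : Plane}
    (hO : atPoint Θ 0 0 = O) {j : ℤ} {q : ℕ} {ym xp : ℝ} (hD : IsGlobalMapData f M Θ R j q ym xp)
    (hC : UnfoldsGenerally f O M) :
    (fderiv ℝ (fun ε : Params =>
      ((splitting f Θ q ε ym, deriv (splitting f Θ q ε) ym) : Params)) 0).det ≠ 0 := by
  have h1 := hC _ _ _ (h.describesManifolds hk hO hD)
  -- The hypothesis is tested on the images of the axes. The exponents `-j` and `j + q` combine to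
  -- `q`, and the splitting at `M` becomes `G(0, ym + t, ε)`.
  have h2 : ∀ (ε : Params) (t : ℝ), (Θ (ε, (f ε ^ (j + q)) ((f ε ^ (-j))
      (atPoint Θ ε (0, ym + t))))).2.2 = splitting f Θ q ε (ym + t) := fun ε t => by
    rw [← Equiv.Perm.mul_apply, ← zpow_add, show j + (q : ℤ) + -j = q by ring, zpow_natCast]
    rfl
  have h2' := fun ε => h2 ε 0
  simp only [add_zero] at h2'
  simp only [h2, h2', add_zero] at h1
  have h3 : ∀ ε, deriv (fun t => splitting f Θ q ε (ym + t)) 0 = deriv (splitting f Θ q ε) ym :=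
    fun ε => by rw [deriv_comp_const_add, add_zero]
  simp only [h3] at h1
  exact h1

end AxisChart

/-! ### Order of vanishing in terms of asymptotics. -/

section Taylor

open Asymptotics

theorem taylor_isLittleO_of_contDiffAt {φ : ℝ → ℝ} {x₀ : ℝ} {n : ℕ} (hφ : ContDiffAt ℝ n φ x₀) :
    (fun t => φ (x₀ + t) - ∑ i ∈ Finset.range (n + 1),
      (iteratedDeriv i φ x₀ / (Nat.factorial i : ℝ)) * t ^ i) =o[𝓝 0] fun t => t ^ n := by
  obtain ⟨u, hu, hφu⟩ := hφ.contDiffOn le_rfl (by simp)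
  obtain ⟨ρ, hρ, hball⟩ := Metric.mem_nhds_iff.1 hu
  have h1 := taylor_isLittleO (convex_ball x₀ ρ) (Metric.mem_ball_self hρ) (hφu.mono hball)
  rw [Metric.isOpen_ball.nhdsWithin_eq (Metric.mem_ball_self hρ)] at h1
  have ht : Tendsto (fun t : ℝ => x₀ + t) (𝓝 0) (𝓝 x₀) := by
    have : Continuous (fun t : ℝ => x₀ + t) := by fun_prop
    exact this.tendsto' _ _ (by simp)
  refine (h1.comp_tendsto ht).congr (fun t => ?_) (fun t => by simp)
  simp only [Function.comp_apply, taylor_within_apply, add_sub_cancel_left, smul_eq_mul]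
  congr 1
  refine Finset.sum_congr rfl fun i _ => ?_
  rw [iteratedDerivWithin_of_isOpen Metric.isOpen_ball (Metric.mem_ball_self hρ)]
  ring

theorem isLittleO_pow_of_iteratedDeriv_eq_zero {φ : ℝ → ℝ} {x₀ : ℝ} {n : ℕ}
    (hφ : ContDiffAt ℝ n φ x₀) (h : ∀ i ≤ n, iteratedDeriv i φ x₀ = 0) :
    (fun t => φ (x₀ + t)) =o[𝓝 0] fun t => t ^ n := by
  refine (taylor_isLittleO_of_contDiffAt hφ).congr_left fun t => ?_
  rw [Finset.sum_eq_zero fun i hi => ?_, sub_zero]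
  rw [h i (Nat.lt_succ_iff.1 (Finset.mem_range.1 hi)), zero_div, zero_mul]

/-- The first nonzero Taylor term dominates the remainder. -/
theorem isTheta_pow_of_iteratedDeriv {φ : ℝ → ℝ} {x₀ : ℝ} {n : ℕ}
    (hφ : ContDiffAt ℝ n φ x₀) (h : ∀ i < n, iteratedDeriv i φ x₀ = 0)
    (hn : iteratedDeriv n φ x₀ ≠ 0) : (fun t => φ (x₀ + t)) =Θ[𝓝 0] fun t => t ^ n := by
  have h1 : (fun t => φ (x₀ + t) - (iteratedDeriv n φ x₀ / (Nat.factorial n : ℝ)) * t ^ n)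
      =o[𝓝 0] fun t => t ^ n := by
    refine (taylor_isLittleO_of_contDiffAt hφ).congr_left fun t => ?_
    rw [Finset.sum_range_succ, Finset.sum_eq_zero fun i hi => ?_, zero_add]
    rw [h i (Finset.mem_range.1 hi), zero_div, zero_mul]
  set c := iteratedDeriv n φ x₀ / (Nat.factorial n : ℝ) with hc
  have hc0 : c ≠ 0 := div_ne_zero hn (by positivity)
  have h2 : (fun t : ℝ => c * t ^ n) =Θ[𝓝 0] fun t => t ^ n :=
    (isTheta_const_mul_left hc0).2 isTheta_rfl
  have h3 := h1.add_isTheta h2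
  convert! h3 using 1
  ext t
  simp

/-- If the lower derivatives vanish and the `m`-th does not, the function is comparable with `t ^
m`, hence not `o(t ^ m)` along any nontrivial filter that avoids `0`. A general filter is allowed
because the estimate will be known only along the image of a change of parameter. -/
theorem iteratedDeriv_eq_zero_of_isLittleO {φ : ℝ → ℝ} {x₀ : ℝ} {n : ℕ}
    (hφ : ContDiffAt ℝ n φ x₀) {l : Filter ℝ} [l.NeBot] (hl : l ≤ 𝓝[≠] 0) {m : ℕ} (hm : m ≤ n)
    (h : (fun t => φ (x₀ + t)) =o[l] fun t => t ^ m) : iteratedDeriv m φ x₀ = 0 := by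
  have hl0 : l ≤ 𝓝 0 := hl.trans nhdsWithin_le_nhds
  induction m using Nat.strong_induction_on with
  | _ m ih =>
    have hz : ∀ i < m, iteratedDeriv i φ x₀ = 0 := fun i hi => ih i hi (hi.le.trans hm)
      (h.trans ((isLittleO_pow_pow hi).mono hl0))
    by_contra hne
    have hφm : ContDiffAt ℝ m φ x₀ := hφ.of_le (by exact_mod_cast hm)
    have h1 := (isTheta_pow_of_iteratedDeriv hφm hz hne).mono hl0
    have h2 := h1.symm.isBigO.trans_isLittleO h
    have h3 := isLittleO_irrefl' (l := l) (f' := fun t : ℝ => t ^ m) (by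
      refine Eventually.frequently ?_
      have : ∀ᶠ t in l, t ≠ (0 : ℝ) := hl self_mem_nhdsWithin
      filter_upwards [this] with t ht
      simpa using fun h4 : t = 0 => absurd h4 ht)
    exact h3 h2

end Taylor

/-! ### Independence of the order of contact from the description of the manifolds. -/

section Comparison

theorem map_nhds_eq_of_injective {P : Plane → Plane} {D : Plane →L[ℝ] Plane} {p : Plane}
    (hP : HasStrictFDerivAt P D p) (hD : Function.Injective D) : map P (𝓝 p) = 𝓝 (P p) := by
  obtain ⟨e, he⟩ := exists_equiv_of_injective D hD
  rw [← he] at hP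
  exact hP.map_nhds_eq_of_equiv

/-- If the zero set of a function with nonzero differential is contained in the first axis, then
the function is comparable with the second coordinate. -/
theorem isTheta_snd_of_zero_imp {g : Plane → ℝ} {D : Plane →L[ℝ] ℝ} {a : ℝ}
    (hg : HasStrictFDerivAt g D (a, 0)) (hD : D ≠ 0) (h0 : g (a, 0) = 0)
    (hz : ∀ᶠ w in 𝓝 ((a, 0) : Plane), g w = 0 → w.2 = 0) :
    g =Θ[𝓝 (a, 0)] fun w => w.2 := by
  have hDv : ∀ v : Plane, D v = v.1 * D (1, 0) + v.2 * D (0, 1) := fun v => by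
    have : v = v.1 • ((1, 0) : Plane) + v.2 • ((0, 1) : Plane) := by ext <;> simp
    conv_lhs => rw [this]
    rw [map_add, map_smul, map_smul, smul_eq_mul, smul_eq_mul]
  -- Otherwise `(g, y)` would be a local diffeomorphism and would take values `(0, s)` with `s ≠ 0`,
  -- giving zeros of `g` off the axis.
  have hα : D (1, 0) = 0 := by
    by_contra hα
    have hP : HasStrictFDerivAt (fun w : Plane => (g w, w.2)) _ (a, 0) :=
      hg.prodMk hasStrictFDerivAt_snd
    have hmap := map_nhds_eq_of_injective hP (by
      rw [injective_iff_map_eq_zero]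
      intro v hv
      simp only [ContinuousLinearMap.prod_apply, ContinuousLinearMap.coe_snd',
        Prod.mk_eq_zero] at hv
      have h1 := hDv v
      rw [hv.1, hv.2, zero_mul, add_zero] at h1
      exact Prod.ext ((mul_eq_zero.1 h1.symm).resolve_right hα) hv.2)
    have h2 : ∀ᶠ v in map (fun w : Plane => (g w, w.2)) (𝓝 (a, 0)), v.1 = 0 → v.2 = 0 := hz
    rw [hmap, h0] at h2
    have h3 : Tendsto (fun s : ℝ => ((0, s) : Plane)) (𝓝 0) (𝓝 (0, 0)) := by
      have : Continuous (fun s : ℝ => ((0, s) : Plane)) := by fun_prop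
      exact this.tendsto' _ _ rfl
    obtain ⟨s, hs, hs0⟩ := (((h3.eventually h2).filter_mono nhdsWithin_le_nhds).and
      (self_mem_nhdsWithin : {(0 : ℝ)}ᶜ ∈ 𝓝[≠] (0 : ℝ))).exists
    exact hs0 (hs rfl)
  have hβ : D (0, 1) ≠ 0 := fun hβ => hD (ContinuousLinearMap.ext fun v => by
    rw [hDv, hα, hβ]; simp)
  -- Now `(x, g)` is a local diffeomorphism, so every `(x, 0)` near `(a, 0)` is attained at a zero
  -- of `g`. This zero lies on the axis and has first coordinate `x`, so `g` vanishes on the axis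
  -- near `a`.
  have hQ : HasStrictFDerivAt (fun w : Plane => (w.1, g w)) _ (a, 0) :=
    hasStrictFDerivAt_fst.prodMk hg
  have hmap := map_nhds_eq_of_injective hQ (by
    rw [injective_iff_map_eq_zero]
    intro v hv
    simp only [ContinuousLinearMap.prod_apply, ContinuousLinearMap.coe_fst',
      Prod.mk_eq_zero] at hv
    have h1 := hDv v
    rw [hv.1, hv.2, zero_mul, zero_add] at h1
    exact Prod.ext hv.1 ((mul_eq_zero.1 h1.symm).resolve_right hβ))
  rw [h0] at hmap
  have himg := image_mem_map (m := fun w : Plane => (w.1, g w)) hz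
  rw [hmap] at himg
  have hax : ∀ᶠ x : ℝ in 𝓝 a, g (x, 0) = 0 := by
    have h3 : Tendsto (fun x : ℝ => ((x, 0) : Plane)) (𝓝 a) (𝓝 (a, 0)) := by
      have : Continuous (fun x : ℝ => ((x, 0) : Plane)) := by fun_prop
      exact this.tendsto' _ _ rfl
    filter_upwards [h3 himg] with x hx
    obtain ⟨w, hw, hwx⟩ := hx
    have h4 : w.1 = x := congrArg Prod.fst hwx
    have h5 : g w = 0 := congrArg Prod.snd hwx
    have h6 : w = (x, 0) := Prod.ext h4 (hw h5)
    rw [← h6, h5]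
  have hev := eventually_abs_snd_sub_le hQ hax (half_pos (abs_pos.2 hβ))
  simp only [ContinuousLinearMap.prod_apply] at hev
  refine ⟨Asymptotics.IsBigO.of_bound (2 * |D (0, 1)|) ?_,
    Asymptotics.IsBigO.of_bound (2 / |D (0, 1)|) ?_⟩
  · filter_upwards [hev] with w hw
    rw [Real.norm_eq_abs, Real.norm_eq_abs]
    have h1 := abs_sub_abs_le_abs_sub (g w) (D (0, 1) * w.2)
    rw [abs_mul] at h1
    nlinarith [mul_nonneg (abs_nonneg (D (0, 1))) (abs_nonneg w.2)]
  · filter_upwards [hev] with w hw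
    rw [Real.norm_eq_abs, Real.norm_eq_abs]
    have h1 := abs_sub_abs_le_abs_sub (D (0, 1) * w.2) (g w)
    rw [abs_mul, abs_sub_comm] at h1
    rw [div_mul_eq_mul_div, le_div_iff₀ (abs_pos.2 hβ)]
    nlinarith

end Comparison

namespace AxisChart

variable {k : ℕ∞} {f : Params → Equiv.Perm Plane}
  {Θ : OpenPartialHomeomorph (Params × Plane) (Params × Plane)} {δ R κ : ℝ}

/-- Applying `g ^ m` only shifts time by at most `m.natAbs`. This carries pieces of the invariant
manifolds at `M` to the points `M⁻` and `M⁺` inside the chart. -/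
theorem tendstoUniformlyOn_zpow_image {ι : Type*} {g : Equiv.Perm Plane} {p : Plane} {c : ι → Plane}
    {s : Set ι} (h : TendstoUniformlyOn (fun (n : ℕ) x => (g ^ n) (c x)) (fun _ => p) atTop s)
    (m : ℤ) : TendstoUniformlyOn (fun (n : ℕ) z => (g ^ n) z) (fun _ => p) atTop
      ((fun x => (g ^ m) (c x)) '' s) := by
  rw [Metric.tendstoUniformlyOn_iff] at h ⊢
  intro η hη
  obtain ⟨N, hN⟩ := eventually_atTop.1 (h η hη)
  filter_upwards [eventually_ge_atTop (N + m.natAbs)] with n hn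
  rintro _ ⟨x, hx, rfl⟩
  obtain ⟨l, hl⟩ : ∃ l : ℕ, (l : ℤ) = n + m := ⟨(n + m).toNat, by omega⟩
  have h1 : (g ^ n) ((g ^ m) (c x)) = (g ^ l) (c x) := by
    rw [← zpow_natCast, ← Equiv.Perm.mul_apply, ← zpow_add, ← hl, zpow_natCast]
  simp only [h1]
  exact hN l (by omega) x hx

open Asymptotics in
/-- A cubic tangency at a homoclinic point is a triple zero of the splitting function. -/
theorem splitting_of_cubicTangency (h : AxisChart k f Θ δ R κ) (hk : 3 ≤ k) {O M : Plane}
    (hO : atPoint Θ 0 0 = O) {j : ℤ} {q : ℕ} {ym xp : ℝ} (hD : IsGlobalMapData f M Θ R j q ym xp)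
    (hB : CubicTangency (f 0) O M) :
    (∀ i ≤ 2, iteratedDeriv i (splitting f Θ q 0) ym = 0) ∧
      iteratedDeriv 3 (splitting f Θ q 0) ym ≠ 0 := by
  obtain ⟨hym, hxp, hm, hp⟩ := hD
  have hk1 : 1 ≤ k := le_trans (by norm_num) hk
  have hk3 : ((3 : ℕ) : WithTop ℕ∞) ≤ k := WithTop.coe_le_coe.2 hk
  have hk0 := coe_ne_zero hk1
  have h0 : ‖(0 : Params)‖ < δ := by simpa using h.δ_pos
  have hy' : ‖((0, ym) : Plane)‖ < R := norm_axis_lt' hym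
  have hx' : ‖((xp, 0) : Plane)‖ < R := norm_axis_lt hxp
  obtain ⟨γ, g, hγs, hγ0, hγr, ⟨I, hI, hIu⟩, hgs, hgr, ⟨N, hN, hNu⟩, hz, hnz⟩ := hB
  rw [← hO] at hIu hNu
  have hγd : DifferentiableAt ℝ γ 0 := hγs.differentiableAt (by simp)
  have hγc : Tendsto γ (𝓝 0) (𝓝 M) := by
    have := hγd.continuousAt.tendsto
    rwa [hγ0] at this
  have hmsrc : ((0, (f 0 ^ j) M) : Params × Plane) ∈ Θ.source := by
    rw [← hm]; exact h.mem_source h0 hy'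
  have hpsrc : ((0, (f 0 ^ (j + q)) M) : Params × Plane) ∈ Θ.source := by
    rw [← hp]; exact h.mem_source h0 hx'
  -- the curve lies on the unstable axis
  have hE₁ := tendstoUniformlyOn_zpow_image (g := (f 0)⁻¹) (c := γ) (s := I) (by
    simpa only [symm_pow_eq] using hIu) (-j)
  rw [inv_zpow_neg] at hE₁
  have hst₁ := h.swap.eventually_mem_stable hk1 hym hE₁
  rw [atPoint_swapChart, Prod.swap_prod_mk, hm] at hst₁
  simp only [swapChart_apply, Prod.snd_swap] at hst₁
  have hγj : Tendsto (fun t => (f 0 ^ j) (γ t)) (𝓝 0) (𝓝 ((f 0 ^ j) M)) :=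
    (h.contDiffAt_zpow_fiber j h0 M).continuousAt.tendsto.comp hγc
  have hsrc₁ : ∀ᶠ t in 𝓝 (0 : ℝ), ((0, (f 0 ^ j) (γ t)) : Params × Plane) ∈ Θ.source :=
    (tendsto_const_nhds.prodMk_nhds hγj).eventually (Θ.open_source.eventually_mem hmsrc)
  have haxis : ∀ᶠ t in 𝓝 (0 : ℝ), (Θ (0, (f 0 ^ j) (γ t))).2.1 = 0 := by
    filter_upwards [hγj.eventually hst₁, hI] with t ht htI
    exact ht ⟨t, htI, rfl⟩
  set c : ℝ → Plane := fun t => (Θ (0, (f 0 ^ j) (γ t))).2 with hc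
  have hc0 : c 0 = (0, ym) := by
    simp only [hc, hγ0, ← hm, h.apply_atPoint h0 hy']
  have hcd : DifferentiableAt ℝ c 0 := by
    have h1 := (h.contDiffAt_chart_zpow_fiber j h0 hmsrc).differentiableAt hk0
    rw [← hγ0] at h1
    exact DifferentiableAt.comp (0 : ℝ) (g := fun w : Plane => (Θ (0, (f 0 ^ j) w)).2) h1 hγd
  have hv1 : (deriv c 0).1 = 0 := by
    have h1 : HasDerivAt (fun t => (c t).1) (deriv c 0).1 0 :=
      (ContinuousLinearMap.fst ℝ ℝ ℝ).hasFDerivAt.comp_hasDerivAt 0 hcd.hasDerivAt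
    refine h1.unique ((hasDerivAt_const 0 (0 : ℝ)).congr_of_eventuallyEq ?_)
    filter_upwards [haxis] with t ht using ht
  have hv2 : (deriv c 0).2 ≠ 0 := by
    intro hv2
    have hv : deriv c 0 = 0 := Prod.ext hv1 hv2
    have h1 := hcd.hasDerivAt
    rw [hv] at h1
    have h2 := (h.contDiffAt_zpow_atPoint_fiber (-j) (w := c 0) h0
      (by rw [hc0]; exact hy')).differentiableAt hk0
    have h3 := h2.hasFDerivAt.comp_hasDerivAt (0 : ℝ) h1
    rw [map_zero] at h3
    refine hγr (h3.congr_of_eventuallyEq ?_).deriv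
    filter_upwards [hsrc₁] with t ht
    simp only [Function.comp_apply, hc]
    rw [(h.apply_mem ht).2.2, zpow_neg_apply]
  -- The position of the given curve on the unstable axis, relative to `M⁻`; its derivative at `0`
  -- is nonzero, so `s` is comparable with `t`.
  set s : ℝ → ℝ := fun t => (c t).2 - ym with hs
  have hs0 : s 0 = 0 := by simp [hs, hc0]
  have hsd : HasDerivAt s (deriv c 0).2 0 :=
    ((ContinuousLinearMap.snd ℝ ℝ ℝ).hasFDerivAt.comp_hasDerivAt 0 hcd.hasDerivAt).sub_const ym
  have hsθ : s =Θ[𝓝 0] fun t => t := by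
    have h1 := HasDerivAtFilter.isTheta_sub hsd hv2
    have h2 : Tendsto (fun t : ℝ => (t, (0 : ℝ))) (𝓝 0) (𝓝 0 ×ˢ pure 0) :=
      tendsto_id.prodMk tendsto_const_pure
    have h3 := h1.isBigO.comp_tendsto h2
    have h4 := h1.symm.isBigO.comp_tendsto h2
    simp only [Function.comp_def, hs0, sub_zero] at h3 h4
    exact ⟨h3, h4⟩
  -- the defining function of the stable manifold in the coordinates
  have hE₂ := tendstoUniformlyOn_zpow_image (g := f 0) (c := fun w => w) hNu (j + q)
  have hst₂ := h.eventually_mem_stable hk1 hxp hE₂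
  rw [hp] at hst₂
  -- The given defining function, transported to `M⁺` and written in the coordinates. Its zeros lie
  -- on the stable axis, so it is comparable with the second coordinate.
  set gt : Plane → ℝ := fun w => g ((f 0 ^ (-(j + (q : ℤ)))) (atPoint Θ 0 w)) with hgt
  have hMp : (f 0 ^ (-(j + (q : ℤ)))) (atPoint Θ 0 (xp, 0)) = M := by
    rw [hp, zpow_neg_apply]
  have hins := h.contDiffAt_zpow_atPoint_fiber (-(j + (q : ℤ))) h0 hx'
  have hgts : ContDiffAt ℝ ((2 + 1 : ℕ) : WithTop ℕ∞) gt (xp, 0) := by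
    refine ContDiffAt.comp (xp, 0) (g := g) ?_ (hins.of_le hk3)
    rw [hMp]; exact hgs
  have hgt0 : gt (xp, 0) = 0 := by
    have := hz 0 (by norm_num)
    rw [iteratedDeriv_zero, Function.comp_apply, hγ0] at this
    simp only [hgt, hMp, this]
  have hchart := h.contDiffAt_chart_zpow_fiber (j + q) h0 hpsrc
  have hcp : (Θ (0, (f 0 ^ (j + (q : ℤ))) M)).2 = (xp, 0) := by
    rw [← hp, h.apply_atPoint h0 hx']
  have hsrcM : ∀ᶠ w in 𝓝 M, ((0, (f 0 ^ (j + (q : ℤ))) w) : Params × Plane) ∈ Θ.source := by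
    have h1 : ContinuousAt (fun w : Plane => ((0, (f 0 ^ (j + (q : ℤ))) w) : Params × Plane)) M :=
      continuousAt_const.prodMk (h.contDiffAt_zpow_fiber _ h0 M).continuousAt
    exact h1.tendsto.eventually (Θ.open_source.eventually_mem hpsrc)
  have hggt : ∀ᶠ w in 𝓝 M, g w = gt (Θ (0, (f 0 ^ (j + (q : ℤ))) w)).2 := by
    filter_upwards [hsrcM] with w hw
    simp only [hgt]
    rw [(h.apply_mem hw).2.2, zpow_neg_apply]
  have hgtD : fderiv ℝ gt (xp, 0) ≠ 0 := by
    intro hD0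
    have h1 := (hgts.differentiableAt (by simp)).hasFDerivAt
    rw [hD0, ← hcp] at h1
    have h2 := HasFDerivAt.comp (g := gt)
      (f := fun w : Plane => (Θ (0, (f 0 ^ (j + (q : ℤ))) w)).2) M h1
      (hchart.differentiableAt hk0).hasFDerivAt
    rw [ContinuousLinearMap.zero_comp] at h2
    refine hgr (h2.congr_of_eventuallyEq ?_).fderiv
    filter_upwards [hggt] with w hw using hw
  have hgtz : ∀ᶠ w in 𝓝 ((xp, 0) : Plane), gt w = 0 → w.2 = 0 := by
    have h1 := hins.continuousAt.tendsto
    rw [hMp] at h1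
    have h2 := ((h.contDiffAt_zpow_atPoint_fiber 0 h0 hx').continuousAt).tendsto
    simp only [zpow_zero, Equiv.Perm.one_apply, hp] at h2
    have h3 : ∀ᶠ w : Plane in 𝓝 (xp, 0), ‖w‖ < R :=
      (continuous_norm.tendsto _).eventually (gt_mem_nhds hx')
    filter_upwards [h1 hN, h2.eventually hst₂, h3] with w hw1 hw2 hw3 hw0
    have := hw2 ⟨(f 0 ^ (-(j + (q : ℤ)))) (atPoint Θ 0 w), ⟨hw1, hw0⟩, zpow_apply_neg _ _ _⟩
    rwa [h.apply_atPoint h0 hw3] at this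
  have hθ := isTheta_snd_of_zero_imp (hgts.hasStrictFDerivAt (by simp)) hgtD hgt0 hgtz
  -- comparison along the curve
  have hY : Tendsto (fun t => (Θ (0, (f 0 ^ (j + (q : ℤ))) (γ t))).2) (𝓝 0) (𝓝 (xp, 0)) := by
    have := hchart.continuousAt.tendsto.comp hγc
    rwa [hcp] at this
  have hθ' : (g ∘ γ) =Θ[𝓝 0] fun t => (Θ (0, (f 0 ^ (j + (q : ℤ))) (γ t))).2.2 := by
    have e1 := hθ.isBigO.comp_tendsto hY
    have e2 := hθ.symm.isBigO.comp_tendsto hY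
    have e3 : (gt ∘ fun t => (Θ (0, (f 0 ^ (j + (q : ℤ))) (γ t))).2) =ᶠ[𝓝 0] g ∘ γ := by
      filter_upwards [hγc.eventually hggt] with t ht using ht.symm
    exact ⟨e1.congr' e3 EventuallyEq.rfl, e2.congr' EventuallyEq.rfl e3⟩
  have hcomp : ContDiffAt ℝ ((2 + 1 : ℕ) : WithTop ℕ∞) (g ∘ γ) 0 := by
    refine ContDiffAt.comp (0 : ℝ) ?_ hγs
    rw [hγ0]; exact hgs
  have hθ3 : (g ∘ γ) =Θ[𝓝 0] fun t => t ^ 3 := by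
    have := isTheta_pow_of_iteratedDeriv hcomp (fun i hi => hz i (Nat.lt_succ_iff.1 hi)) hnz
    simpa [Function.comp_def] using this
  have hsplit : (fun t => splitting f Θ q 0 (ym + s t)) =ᶠ[𝓝 0]
      fun t => (Θ (0, (f 0 ^ (j + (q : ℤ))) (γ t))).2.2 := by
    filter_upwards [hsrc₁, haxis] with t ht1 ht2
    have h1 : ((0, ym + s t) : Plane) = (Θ (0, (f 0 ^ j) (γ t))).2 :=
      Prod.ext ht2.symm (by simp [hs, hc])
    simp only [splitting]
    rw [h1, (h.apply_mem ht1).2.2, ← zpow_natCast, ← Equiv.Perm.mul_apply, ← zpow_add,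
      add_comm (q : ℤ)]
  -- Chain of comparisons: the splitting at `ym + s t` with `g ∘ γ`, then with `t ^ 3`, then with `s
  -- t ^ 3`.
  have hmain : (fun t => splitting f Θ q 0 (ym + s t)) =Θ[𝓝 0] fun t => s t ^ 3 :=
    (hsplit.isTheta.trans hθ'.symm).trans (hθ3.trans (hsθ.pow 3).symm)
  -- pass to the image filter
  have hsne : Tendsto s (𝓝[≠] 0) (𝓝[≠] 0) := by
    have := hsd.tendsto_nhdsNE hv2
    rwa [hs0] at this
  -- Working along the image filter replaces `s t` by a free variable without inverting `s`.
  set l : Filter ℝ := map s (𝓝[≠] 0) with hl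
  have hmain' : (fun u => splitting f Θ q 0 (ym + u)) =Θ[l] fun u => u ^ 3 := by
    have := hmain.mono (nhdsWithin_le_nhds (s := {(0 : ℝ)}ᶜ))
    exact ⟨isBigO_map.2 this.isBigO, isBigO_map.2 this.symm.isBigO⟩
  have hl0 : l ≤ 𝓝 0 := hsne.trans nhdsWithin_le_nhds
  have hGs : ContDiffAt ℝ (3 : ℕ) (splitting f Θ q 0) ym := by
    have h1 : ((0, (f 0 ^ (q : ℤ)) (atPoint Θ 0 (0, ym))) : Params × Plane) ∈ Θ.source := by
      rw [hm, ← Equiv.Perm.mul_apply, ← zpow_add, add_comm]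
      exact hpsrc
    have h2 := (h.contDiffAt_transition q h0 hy' h1).snd
    simp only [zpow_natCast] at h2
    exact (ContDiffAt.comp ym
      (g := fun x : Params × Plane => (Θ (x.1, (f x.1 ^ q) (atPoint Θ x.1 x.2))).2.2)
      (f := fun y : ℝ => ((0, (0, y)) : Params × Plane)) h2 (by fun_prop)).of_le hk3
  have hzero : ∀ i ≤ 2, iteratedDeriv i (splitting f Θ q 0) ym = 0 := fun i hi =>
    iteratedDeriv_eq_zero_of_isLittleO hGs hsne (hi.trans (by norm_num))
      (hmain'.isBigO.trans_isLittleO ((isLittleO_pow_pow (by omega)).mono hl0))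
  refine ⟨hzero, fun h3 => ?_⟩
  have h4 := isLittleO_pow_of_iteratedDeriv_eq_zero hGs (fun i hi => by
    rcases Nat.lt_or_ge i 3 with hi3 | hi3
    · exact hzero i (by omega)
    · rw [le_antisymm hi hi3]; exact h3)
  have h5 := hmain'.symm.isBigO.trans_isLittleO (h4.mono hl0)
  refine isLittleO_irrefl' (l := l) (f' := fun t : ℝ => t ^ 3) ?_ h5
  refine Eventually.frequently ?_
  have : ∀ᶠ t in l, t ≠ (0 : ℝ) := hsne self_mem_nhdsWithin
  filter_upwards [this] with t ht
  simpa using ht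

end AxisChart

/-! ### The semicubical parabola of double zeros. -/

/-- A bound for a function in terms of its derivative, on a symmetric interval. -/
theorem abs_sub_le_of_hasDerivAt {F F' : ℝ → ℝ} {t B : ℝ}
    (hF : ∀ s, |s| ≤ |t| → HasDerivAt F (F' s) s) (hB : ∀ s, |s| ≤ |t| → |F' s| ≤ B) {s : ℝ}
    (hs : |s| ≤ |t|) : |F s - F 0| ≤ B * |t| := by
  have hmem : ∀ x : ℝ, x ∈ Metric.closedBall (0 : ℝ) |t| ↔ |x| ≤ |t| := fun x => by simp
  have h1 := (convex_closedBall (0 : ℝ) |t|).norm_image_sub_le_of_norm_hasDerivWithin_le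
    (f := F) (f' := F') (C := B) (fun x hx => (hF x ((hmem x).1 hx)).hasDerivWithinAt)
    (fun x hx => hB x ((hmem x).1 hx)) (x := 0) (y := s) ((hmem 0).2 (by simp)) ((hmem s).2 hs)
  rw [sub_zero] at h1
  have hB0 : 0 ≤ B := (abs_nonneg _).trans (hB 0 (by simp))
  exact h1.trans (mul_le_mul_of_nonneg_left hs hB0)

/-- Coefficients of a function with vanishing second derivative at `0`, third derivative close to
`6 d` and a double zero at `t`. -/
theorem cubic_double_zero {H₀ H₁ H₂ H₃ : ℝ → ℝ} {d t B : ℝ}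
    (h₀ : ∀ s, |s| ≤ |t| → HasDerivAt H₀ (H₁ s) s) (h₁ : ∀ s, |s| ≤ |t| → HasDerivAt H₁ (H₂ s) s)
    (h₂ : ∀ s, |s| ≤ |t| → HasDerivAt H₂ (H₃ s) s) (h₃ : ∀ s, |s| ≤ |t| → |H₃ s - 6 * d| ≤ B)
    (e₀ : H₀ t = 0) (e₁ : H₁ t = 0) (e₂ : H₂ 0 = 0) :
    |H₂ t - 6 * d * t| ≤ B * |t| ∧ |H₁ 0 + 3 * d * t ^ 2| ≤ B * |t| ^ 2 ∧
      |H₀ 0 - 2 * d * t ^ 3| ≤ 2 * B * |t| ^ 3 := by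
  -- The bound on `H₃ - 6 * d` is integrated three times from `0`; each integration costs a factor
  -- `|t|`.
  have k₂ : ∀ s, |s| ≤ |t| → |H₂ s - 6 * d * s| ≤ B * |t| := fun s hs => by
    have := abs_sub_le_of_hasDerivAt (F := fun s => H₂ s - 6 * d * s)
      (F' := fun s => H₃ s - 6 * d) (fun s hs => by
        have := (h₂ s hs).sub ((hasDerivAt_id s).const_mul (6 * d))
        exact this.congr_deriv (by simp)) h₃ hs
    simpa [e₂] using this
  have k₁ : ∀ s, |s| ≤ |t| → |H₁ s - H₁ 0 - 3 * d * s ^ 2| ≤ B * |t| * |t| := fun s hs => by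
    have := abs_sub_le_of_hasDerivAt (F := fun s => H₁ s - 3 * d * s ^ 2)
      (F' := fun s => H₂ s - 6 * d * s) (fun s hs => by
        have := (h₁ s hs).sub ((hasDerivAt_pow 2 s).const_mul (3 * d))
        refine this.congr_deriv ?_
        norm_num; ring) k₂ hs
    rw [show H₁ s - H₁ 0 - 3 * d * s ^ 2 = (H₁ s - 3 * d * s ^ 2) - (H₁ 0 - 3 * d * 0 ^ 2) by ring]
    exact this
  have k₀ : |H₀ t - H₀ 0 - H₁ 0 * t - d * t ^ 3| ≤ B * |t| * |t| * |t| := by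
    have := abs_sub_le_of_hasDerivAt (F := fun s => H₀ s - H₁ 0 * s - d * s ^ 3)
      (F' := fun s => H₁ s - H₁ 0 - 3 * d * s ^ 2) (fun s hs => by
        have := ((h₀ s hs).sub ((hasDerivAt_id s).const_mul (H₁ 0))).sub
          ((hasDerivAt_pow 3 s).const_mul d)
        refine this.congr_deriv ?_
        norm_num; ring) k₁ (le_refl |t|)
    rw [show H₀ t - H₀ 0 - H₁ 0 * t - d * t ^ 3 =
      (H₀ t - H₁ 0 * t - d * t ^ 3) - (H₀ 0 - H₁ 0 * 0 - d * 0 ^ 3) by ring]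
    exact this
  have k₁' := k₁ t le_rfl
  rw [e₁, show (0 : ℝ) - H₁ 0 - 3 * d * t ^ 2 = -(H₁ 0 + 3 * d * t ^ 2) by ring, abs_neg] at k₁'
  refine ⟨k₂ t le_rfl, k₁'.trans_eq (by ring), ?_⟩
  rw [e₀] at k₀
  -- At the double zero `H₀ 0 ≈ -H₁ 0 * t - d * t ^ 3` and `H₁ 0 ≈ -3 * d * t ^ 2`, which gives `2 *
  -- d * t ^ 3`. The two errors add up to the factor `2`.
  have h4 : |t * (H₁ 0 + 3 * d * t ^ 2)| ≤ |t| * (B * |t| * |t|) := by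
    rw [abs_mul]
    exact mul_le_mul_of_nonneg_left k₁' (abs_nonneg t)
  rw [show H₀ 0 - 2 * d * t ^ 3 = -(0 - H₀ 0 - H₁ 0 * t - d * t ^ 3) -
    t * (H₁ 0 + 3 * d * t ^ 2) by ring]
  refine (abs_sub _ _).trans ?_
  rw [abs_neg]
  calc _ ≤ B * |t| * |t| * |t| + |t| * (B * |t| * |t|) := add_le_add k₀ h4
    _ = _ := by ring

open Asymptotics in
/-- `t² + O(t³)` is strictly increasing on some interval `[0, t₀]`. -/
theorem exists_strictMonoOn_sq_add {v : ℝ → ℝ} (hv : ContDiffAt ℝ 2 v 0)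
    (hO : (fun t => v t - t ^ 2) =O[𝓝 0] fun t => t ^ 3) :
    ∃ t₀ > 0, StrictMonoOn v (Icc 0 t₀) := by
  set ψ : ℝ → ℝ := fun t => v t - t ^ 2 with hψdef
  have hψ : ContDiffAt ℝ (2 : ℕ) ψ 0 := hv.sub (by fun_prop)
  -- A `C²` function that is `O(t³)` has vanishing 2-jet, so `ψ' = o(t)` and `v' = 2t + o(t)` is
  -- positive for small `t > 0`.
  have hz : ∀ i ≤ 2, iteratedDeriv i ψ 0 = 0 := fun i hi =>
    iteratedDeriv_eq_zero_of_isLittleO hψ (l := 𝓝[≠] 0) le_rfl hi (by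
      simp only [zero_add]
      exact (hO.trans_isLittleO (isLittleO_pow_pow (by omega))).mono nhdsWithin_le_nhds)
  have hd0 : deriv ψ 0 = 0 := by simpa using hz 1 (by norm_num)
  have hd1 : HasDerivAt (deriv ψ) 0 0 := by
    have h1 : DifferentiableAt ℝ (deriv ψ) 0 := by
      have := ((hψ.fderiv_right (m := 1) (by norm_num)).differentiableAt (by simp)).clm_apply
        (differentiableAt_const (1 : ℝ))
      exact this.congr_of_eventuallyEq (.of_forall fun x => fderiv_apply_one_eq_deriv.symm)
    have h2 := h1.hasDerivAt
    have h3 := hz 2 le_rfl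
    rw [iteratedDeriv_succ, iteratedDeriv_one] at h3
    rwa [h3] at h2
  have h1 := hd1.isLittleO.def (c := 1) one_pos
  have h1' : ∀ᶠ t in 𝓝 (0 : ℝ), |deriv ψ t| ≤ |t| := by
    filter_upwards [h1] with t ht
    simpa [hd0] using ht
  have h2 : ∀ᶠ t in 𝓝 (0 : ℝ), DifferentiableAt ℝ ψ t := by
    filter_upwards [hψ.eventually (by simp)] with t ht
    exact ht.differentiableAt (by simp)
  obtain ⟨ρ, hρ, hball⟩ := Metric.eventually_nhds_iff_ball.1 (h1'.and h2)
  have hmem : ∀ t ∈ Icc (0 : ℝ) (ρ / 2), t ∈ Metric.ball (0 : ℝ) ρ := fun t ht => by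
    rw [mem_ball_zero_iff, Real.norm_eq_abs, abs_of_nonneg ht.1]
    linarith [ht.2]
  have hvd : ∀ t ∈ Icc (0 : ℝ) (ρ / 2), HasDerivAt v (deriv ψ t + 2 * t) t := fun t ht => by
    have h3 := (hball t (hmem t ht)).2.hasDerivAt.add (hasDerivAt_pow 2 t)
    have h4 : (ψ + fun t => t ^ 2) = v := by ext t; simp [hψdef]
    rw [h4] at h3
    simpa using h3
  refine ⟨ρ / 2, by positivity, strictMonoOn_of_deriv_pos (convex_Icc _ _)
    (fun t ht => (hvd t ht).continuousAt.continuousWithinAt) fun t ht => ?_⟩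
  rw [interior_Icc] at ht
  have ht' : t ∈ Icc (0 : ℝ) (ρ / 2) := ⟨ht.1.le, ht.2.le⟩
  rw [(hvd t ht').deriv]
  have h5 := (hball t (hmem t ht')).1
  rw [abs_of_pos ht.1] at h5
  linarith [neg_abs_le (deriv ψ t), ht.1]

/-- The power `y ^ (2/3)` lies between `1` and `y`. -/
theorem abs_rpow_two_thirds_sub_one_le {y : ℝ} (hy : 0 < y) :
    |y ^ (2 / 3 : ℝ) - 1| ≤ |y - 1| := by
  rcases le_total 1 y with h | h
  · have h1 : 1 ≤ y ^ (2 / 3 : ℝ) := Real.one_le_rpow h (by norm_num)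
    have h2 : y ^ (2 / 3 : ℝ) ≤ y ^ (1 : ℝ) := Real.rpow_le_rpow_of_exponent_le h (by norm_num)
    rw [Real.rpow_one] at h2
    rw [abs_of_nonneg (by linarith), abs_of_nonneg (by linarith)]
    linarith
  · have h1 : y ^ (2 / 3 : ℝ) ≤ 1 := Real.rpow_le_one hy.le h (by norm_num)
    have h2 : y ^ (1 : ℝ) ≤ y ^ (2 / 3 : ℝ) :=
      Real.rpow_le_rpow_of_exponent_ge hy h (by norm_num)
    rw [Real.rpow_one] at h2
    rw [abs_of_nonpos (by linarith), abs_of_nonpos (by linarith)]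
    linarith

/-- A curve `(v, w) = (t² + O(t³), t³ + O(t⁴))`, `t ≥ 0`, is a graph
`w = (v (1 + σ(v)))^{3/2}` with `σ = O(√v)`. -/
theorem exists_branch {v w : ℝ → ℝ} {t₀ C : ℝ} (ht₀ : 0 < t₀) (hC : 0 ≤ C) (hCt : C * t₀ ≤ 1 / 2)
    (hvc : ContinuousOn v (Icc 0 t₀)) (hwc : ContinuousOn w (Icc 0 t₀))
    (hvm : StrictMonoOn v (Icc 0 t₀)) (hv : ∀ t ∈ Icc 0 t₀, |v t - t ^ 2| ≤ C * t ^ 3)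
    (hw : ∀ t ∈ Icc 0 t₀, |w t - t ^ 3| ≤ C * t ^ 4) :
    ∃ (σ τ : ℝ → ℝ) (v₀ : ℝ), 0 < v₀ ∧ ContinuousOn σ (Ico 0 v₀) ∧
      (∀ x ∈ Ico 0 v₀, |σ x| ≤ 8 * C * √x ∧ 0 < 1 + σ x ∧ τ x ∈ Ico 0 t₀ ∧ v (τ x) = x ∧
        w (τ x) = (x * (1 + σ x)) ^ (3 / 2 : ℝ)) ∧
      ∀ t ∈ Icc 0 t₀, v t < v₀ → 0 ≤ v t ∧ τ (v t) = t := by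
  have h0mem : (0 : ℝ) ∈ Icc 0 t₀ := ⟨le_rfl, ht₀.le⟩
  have htmem : t₀ ∈ Icc 0 t₀ := ⟨ht₀.le, le_rfl⟩
  have hv0 : v 0 = 0 := by simpa using hv 0 h0mem
  have hw0 : w 0 = 0 := by simpa using hw 0 h0mem
  have hCle : ∀ t ∈ Icc 0 t₀, C * t ≤ 1 / 2 := fun t ht =>
    (mul_le_mul_of_nonneg_left ht.2 hC).trans hCt
  have hvlow : ∀ t ∈ Icc 0 t₀, t ^ 2 / 2 ≤ v t := fun t ht => by
    have h1 := (abs_le.1 (hv t ht)).1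
    nlinarith [mul_le_mul_of_nonneg_right (hCle t ht) (sq_nonneg t)]
  have hinj : InjOn v (Icc 0 t₀) := hvm.injOn
  set τ : ℝ → ℝ := Function.invFunOn v (Icc 0 t₀) with hτ
  set v₀ := v t₀ with hv₀
  have hv₀pos : 0 < v₀ := by
    have := hvm h0mem htmem ht₀
    rwa [hv0] at this
  have hsurj : ∀ x ∈ Icc 0 v₀, x ∈ v '' Icc 0 t₀ := fun x hx => by
    have := intermediate_value_Icc ht₀.le hvc
    rw [hv0] at this
    exact this hx
  have hτmem : ∀ x ∈ Icc 0 v₀, τ x ∈ Icc 0 t₀ := fun x hx => Function.invFunOn_mem (hsurj x hx)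
  have hvτ : ∀ x ∈ Icc 0 v₀, v (τ x) = x := fun x hx => Function.invFunOn_eq (hsurj x hx)
  have hτv : ∀ t ∈ Icc 0 t₀, τ (v t) = t := fun t ht =>
    hinj.leftInvOn_invFunOn ht
  have hτmono : MonotoneOn τ (Icc 0 v₀) := fun x hx y hy hxy => by
    rw [← hvm.le_iff_le (hτmem x hx) (hτmem y hy), hvτ x hx, hvτ y hy]
    exact hxy
  have hvpos : ∀ t ∈ Icc 0 t₀, 0 ≤ v t := fun t ht => (by positivity : 0 ≤ t ^ 2 / 2).trans
    (hvlow t ht)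
  have hτpos : ∀ x ∈ Ioo 0 v₀, τ x ∈ Ioo 0 t₀ := fun x hx => by
    have hx' : x ∈ Icc 0 v₀ := ⟨hx.1.le, hx.2.le⟩
    have h1 := hτmem x hx'
    refine ⟨lt_of_le_of_ne h1.1 fun h => ?_, lt_of_le_of_ne h1.2 fun h => ?_⟩
    · have := hvτ x hx'
      rw [← h, hv0] at this
      exact hx.1.ne this
    · have := hvτ x hx'
      rw [h] at this
      exact hx.2.ne' this
  have hτcont : ∀ x ∈ Ioo 0 v₀, ContinuousAt τ x := fun x hx => by
    refine continuousAt_of_monotoneOn_of_image_mem_nhds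
      (hτmono.mono Ioo_subset_Icc_self) (Ioo_mem_nhds hx.1 hx.2) ?_
    refine mem_of_superset (Ioo_mem_nhds (hτpos x hx).1 (hτpos x hx).2) fun t ht => ?_
    have ht' : t ∈ Icc 0 t₀ := ⟨ht.1.le, ht.2.le⟩
    refine ⟨v t, ⟨?_, hvm ht' htmem ht.2⟩, hτv t ht'⟩
    have := hvm h0mem ht' ht.1
    rwa [hv0] at this
  have hwpos : ∀ t ∈ Icc 0 t₀, 0 < t → 0 < w t := fun t ht htp => by
    have h1 := (abs_le.1 (hw t ht)).1
    have h3 : 0 < t ^ 3 := by positivity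
    nlinarith [mul_le_mul_of_nonneg_right (hCle t ht) h3.le]
  -- Both `w ^ (2/3)` and `v` differ from `t ^ 2` by at most `C * t ^ 3`. The constant `8` collects
  -- this factor `2` with `t ^ 2 ≤ 2 * v` and `t ≤ 2 * √v`.
  have hest : ∀ t ∈ Icc 0 t₀, 0 < t → |w t ^ (2 / 3 : ℝ) / v t - 1| ≤ 8 * C * √(v t) := by
    intro t ht htp
    have hvt : 0 < v t := lt_of_lt_of_le (by positivity) (hvlow t ht)
    have ht3 : 0 < t ^ 3 := by positivity
    have h1 : w t = t ^ 3 * (w t / t ^ 3) := by field_simp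
    have hy : 0 < w t / t ^ 3 := div_pos (hwpos t ht htp) ht3
    have h2 : (t ^ 3 : ℝ) ^ (2 / 3 : ℝ) = t ^ 2 := by
      rw [← Real.rpow_natCast, ← Real.rpow_mul htp.le, ← Real.rpow_natCast]
      norm_num
    have h3 : w t ^ (2 / 3 : ℝ) = t ^ 2 * (w t / t ^ 3) ^ (2 / 3 : ℝ) := by
      conv_lhs => rw [h1]
      rw [Real.mul_rpow ht3.le hy.le, h2]
    have h4 : |w t / t ^ 3 - 1| ≤ C * t := by
      rw [div_sub_one ht3.ne', abs_div, abs_of_pos ht3, div_le_iff₀ ht3]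
      calc _ ≤ C * t ^ 4 := hw t ht
        _ = _ := by ring
    have h5 := (abs_rpow_two_thirds_sub_one_le hy).trans h4
    have h6 : |w t ^ (2 / 3 : ℝ) - t ^ 2| ≤ C * t ^ 3 := by
      rw [h3, show t ^ 2 * (w t / t ^ 3) ^ (2 / 3 : ℝ) - t ^ 2 =
        t ^ 2 * ((w t / t ^ 3) ^ (2 / 3 : ℝ) - 1) by ring, abs_mul, abs_of_nonneg (sq_nonneg t)]
      calc _ ≤ t ^ 2 * (C * t) := mul_le_mul_of_nonneg_left h5 (sq_nonneg t)
        _ = _ := by ring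
    have h7 : |w t ^ (2 / 3 : ℝ) - v t| ≤ 2 * (C * t ^ 3) := by
      have := abs_sub_le (w t ^ (2 / 3 : ℝ)) (t ^ 2) (v t)
      rw [abs_sub_comm (t ^ 2)] at this
      linarith [hv t ht]
    have h8 : t ≤ 2 * √(v t) := by
      have h9 : (t / 2) ^ 2 ≤ v t := by nlinarith [hvlow t ht, sq_nonneg t]
      have := Real.le_sqrt_of_sq_le h9
      linarith
    rw [div_sub_one hvt.ne', abs_div, abs_of_pos hvt, div_le_iff₀ hvt]
    calc _ ≤ 2 * (C * t ^ 3) := h7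
      _ = 4 * C * t * (t ^ 2 / 2) := by ring
      _ ≤ 4 * C * t * v t := mul_le_mul_of_nonneg_left (hvlow t ht) (by positivity)
      _ ≤ 4 * C * (2 * √(v t)) * v t := by gcongr
      _ = _ := by ring
  -- The equation `w (τ x) = (x * (1 + σ x)) ^ (3/2)` solved for `σ`; the value `0` at `x = 0` is
  -- the limit forced by the bound `8 * C * √x`.
  set σ : ℝ → ℝ := fun x => if x = 0 then 0 else w (τ x) ^ (2 / 3 : ℝ) / x - 1 with hσ
  have hσ0 : σ 0 = 0 := by simp [hσ]
  have hσpos : ∀ x, x ≠ 0 → σ x = w (τ x) ^ (2 / 3 : ℝ) / x - 1 := fun x hx => by simp [hσ, hx]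
  have hσb : ∀ x ∈ Ico 0 v₀, |σ x| ≤ 8 * C * √x := fun x hx => by
    rcases eq_or_lt_of_le hx.1 with h | h
    · rw [← h, hσ0]; simp
    · have hx' : x ∈ Icc 0 v₀ := ⟨hx.1, hx.2.le⟩
      have := hest (τ x) (hτmem x hx') (hτpos x ⟨h, hx.2⟩).1
      rwa [hvτ x hx', ← hσpos x h.ne'] at this
  refine ⟨σ, τ, v₀, hv₀pos, fun x hx => ?_, fun x hx => ?_, fun t ht _ => ⟨hvpos t ht, hτv t ht⟩⟩
  · rcases eq_or_lt_of_le hx.1 with h | h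
    · rw [← h]
      unfold ContinuousWithinAt
      rw [hσ0]
      have h1 : Tendsto (fun x : ℝ => 8 * C * √x) (𝓝[Ico 0 v₀] 0) (𝓝 0) := by
        have : Continuous (fun x : ℝ => 8 * C * √x) := by fun_prop
        exact (this.tendsto' 0 0 (by simp)).mono_left nhdsWithin_le_nhds
      refine squeeze_zero_norm' ?_ h1
      filter_upwards [self_mem_nhdsWithin] with y hy
      exact hσb y hy
    · have hx' : x ∈ Icc 0 v₀ := ⟨hx.1, hx.2.le⟩
      have hτx := hτpos x ⟨h, hx.2⟩
      have h1 : ContinuousAt (fun x => w (τ x)) x :=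
        ContinuousAt.comp (hwc.continuousAt (Icc_mem_nhds hτx.1 hτx.2)) (hτcont x ⟨h, hx.2⟩)
      have h2 : ContinuousAt (fun x => w (τ x) ^ (2 / 3 : ℝ) / x - 1) x :=
        ((h1.rpow_const (Or.inr (by norm_num))).div continuousAt_id h.ne').sub continuousAt_const
      refine (h2.congr ?_).continuousWithinAt
      filter_upwards [eventually_ne_nhds h.ne'] with y hy
      exact (hσpos y hy).symm
  · have hx' : x ∈ Icc 0 v₀ := ⟨hx.1, hx.2.le⟩
    have hlt : τ x < t₀ := lt_of_le_of_ne (hτmem x hx').2 fun hh => by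
      have := hvτ x hx'
      rw [hh] at this
      exact hx.2.ne' this
    refine ⟨hσb x hx, ?_, ⟨(hτmem x hx').1, hlt⟩, hvτ x hx', ?_⟩
    · rcases eq_or_lt_of_le hx.1 with h | h
      · rw [← h, hσ0]; norm_num
      · rw [hσpos x h.ne', add_sub_cancel]
        exact div_pos (Real.rpow_pos_of_pos (hwpos _ (hτmem x hx') (hτpos x ⟨h, hx.2⟩).1) _) h
    · rcases eq_or_lt_of_le hx.1 with h | h
      · have h1 : τ 0 = 0 := by
          have := hτv 0 h0mem
          rwa [hv0] at this
        rw [← h, h1, hw0, zero_mul, Real.zero_rpow (by norm_num)]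
      · have hwp := hwpos _ (hτmem x hx') (hτpos x ⟨h, hx.2⟩).1
        rw [hσpos x h.ne', add_sub_cancel, mul_div_cancel₀ _ h.ne', ← Real.rpow_mul hwp.le]
        norm_num

theorem IsCorrection.mono {d δ δ' : ℝ} {ρ : ℝ → ℝ} (h : IsCorrection d δ ρ) (hδ : δ' ≤ δ) :
    IsCorrection d δ' ρ := by
  obtain ⟨h1, C, hC⟩ := h
  exact ⟨h1.mono fun m hm => ⟨hm.1.trans_le hδ, hm.2⟩, C, fun m hm => hC m (hm.trans_le hδ)⟩

theorem isCorrection_of_branch {d C v₀ δ : ℝ} {σ : ℝ → ℝ} (hd : d ≠ 0)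
    (hδ : δ ≤ 3 * |d| * v₀) (hσ : ContinuousOn σ (Ico 0 v₀))
    (hb : ∀ x ∈ Ico 0 v₀, |σ x| ≤ C * √x ∧ 0 < 1 + σ x) :
    IsCorrection d δ fun m => σ (-m / (3 * d)) := by
  have hd' : 0 < 3 * |d| := by positivity
  have hmem : ∀ m : ℝ, |m| < δ → 0 ≤ -m / (3 * d) → -m / (3 * d) ∈ Ico 0 v₀ ∧
      -m / (3 * d) = |m| / (3 * |d|) := fun m hm h0 => by
    have h1 : -m / (3 * d) = |m| / (3 * |d|) := by
      rw [← abs_of_nonneg h0, abs_div, abs_neg, abs_mul]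
      norm_num
    refine ⟨⟨h0, ?_⟩, h1⟩
    rw [h1, div_lt_iff₀ hd']
    linarith
  refine ⟨hσ.comp (by fun_prop) fun m hm => (hmem m hm.1 hm.2).1, C / √(3 * |d|),
    fun m hm h0 => ?_⟩
  obtain ⟨h1, h2⟩ := hmem m hm h0
  obtain ⟨h3, h4⟩ := hb _ h1
  refine ⟨h3.trans_eq ?_, h4⟩
  rw [h2, Real.sqrt_div (abs_nonneg m)]
  ring

open Asymptotics in
/-- A parametrized semicubical parabola is a curve `H₀`. -/
theorem exists_curveH0 {m : ℝ → Params} {d K t₂ : ℝ} (hd : d ≠ 0) (hm : ContDiffAt ℝ 2 m 0)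
    (hK : 0 ≤ K)
    (hb : ∀ᶠ t in 𝓝 (0 : ℝ), |(m t).2 + 3 * d * t ^ 2| ≤ K * |t| ^ 3 ∧
      |(m t).1 - 2 * d * t ^ 3| ≤ 2 * K * |t| ^ 4) (ht₂ : 0 < t₂) :
    ∃ (ρp ρm : ℝ → ℝ) (t₀ δ₁ : ℝ), 0 < t₀ ∧ t₀ ≤ t₂ ∧ 0 < δ₁ ∧ IsCorrection d δ₁ ρp ∧
      IsCorrection d δ₁ ρm ∧ ∀ μ ∈ Metric.ball (0 : Params) δ₁,
        μ ∈ curveH0 d ρp ρm ↔ ∃ t, |t| < t₀ ∧ m t = μ := by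
  set v : ℝ → ℝ := fun t => -(m t).2 / (3 * d) with hv
  set w : ℝ → ℝ := fun t => (m t).1 / (2 * d) with hw
  set C : ℝ := K / |d| with hC
  have hdp : 0 < |d| := abs_pos.2 hd
  have hC0 : 0 ≤ C := by positivity
  have hbv : ∀ᶠ t in 𝓝 (0 : ℝ), |v t - t ^ 2| ≤ C * |t| ^ 3 ∧ |w t - t ^ 3| ≤ C * |t| ^ 4 := by
    filter_upwards [hb] with t ht
    constructor
    · have h1 : v t - t ^ 2 = -((m t).2 + 3 * d * t ^ 2) / (3 * d) := by
        simp only [hv]; field_simp; ring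
      rw [h1, abs_div, abs_neg, abs_mul, abs_of_pos (zero_lt_three : (0 : ℝ) < 3),
        div_le_iff₀ (by positivity), hC]
      calc _ ≤ K * |t| ^ 3 := ht.1
        _ ≤ 3 * (K * |t| ^ 3) := by linarith [show 0 ≤ K * |t| ^ 3 by positivity]
        _ = _ := by field_simp
    · have h1 : w t - t ^ 3 = ((m t).1 - 2 * d * t ^ 3) / (2 * d) := by
        simp only [hw]; field_simp
      rw [h1, abs_div, abs_mul, abs_of_pos (two_pos : (0 : ℝ) < 2), div_le_iff₀ (by positivity), hC]
      calc _ ≤ 2 * K * |t| ^ 4 := ht.2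
        _ = _ := by field_simp
  have hvs : ContDiffAt ℝ 2 v 0 := by
    have : ContDiffAt ℝ 2 (fun t => (m t).2) 0 := contDiff_snd.contDiffAt.comp _ hm
    exact this.neg.div_const _
  have hvs' : ContDiffAt ℝ 2 (fun t => v (-t)) 0 := by
    refine ContDiffAt.comp (g := v) (f := fun t => -t) 0 (by simpa using hvs) (by fun_prop)
  have hO : (fun t => v t - t ^ 2) =O[𝓝 0] fun t => t ^ 3 :=
    IsBigO.of_bound C (hbv.mono fun t ht => by simpa using ht.1)
  have hneg : Tendsto (fun t : ℝ => -t) (𝓝 0) (𝓝 0) := by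
    simpa using (continuous_neg (G := ℝ)).tendsto 0
  have hO' : (fun t => v (-t) - t ^ 2) =O[𝓝 0] fun t => t ^ 3 :=
    IsBigO.of_bound C ((hneg.eventually hbv).mono fun t ht => by simpa using ht.1)
  obtain ⟨tp, htp, hmp⟩ := exists_strictMonoOn_sq_add hvs hO
  obtain ⟨tm, htm, hmm⟩ := exists_strictMonoOn_sq_add hvs' hO'
  have hmc : ∀ᶠ t in 𝓝 (0 : ℝ), ContinuousAt m t := by
    filter_upwards [hm.eventually (by simp)] with t ht
    exact ht.continuousAt
  obtain ⟨ta, hta, hball⟩ := Metric.eventually_nhds_iff_ball.1 (hbv.and hmc)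
  obtain ⟨t₀, ht₀, ht₀2, ht₀p, ht₀m, ht₀a, ht₀C⟩ : ∃ t₀ : ℝ, 0 < t₀ ∧ t₀ ≤ t₂ ∧ t₀ ≤ tp ∧ t₀ ≤ tm ∧
      t₀ < ta ∧ C * t₀ ≤ 1 / 2 := by
    have h1 : ∀ᶠ t in 𝓝[>] (0 : ℝ), C * t < 1 / 2 :=
      ((continuous_const.mul continuous_id).tendsto' (0 : ℝ) 0 (by simp)).mono_left
        nhdsWithin_le_nhds |>.eventually (gt_mem_nhds (by norm_num))
    have h2 : ∀ b > 0, ∀ᶠ t in 𝓝[>] (0 : ℝ), t < b := fun b hb =>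
      (gt_mem_nhds hb : ∀ᶠ t in 𝓝 (0 : ℝ), t < b).filter_mono nhdsWithin_le_nhds
    obtain ⟨t, ⟨⟨⟨⟨h3, h4⟩, h5⟩, h6⟩, h7⟩, h8⟩ := (((((h1.and (h2 t₂ ht₂)).and (h2 tp htp)).and
      (h2 tm htm)).and (h2 ta hta)).and self_mem_nhdsWithin).exists
    exact ⟨t, h8, h4.le, h5.le, h6.le, h7, h3.le⟩
  have hin : ∀ t ∈ Icc 0 t₀, t ∈ Metric.ball (0 : ℝ) ta ∧ -t ∈ Metric.ball (0 : ℝ) ta :=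
    fun t ht => by
      simp only [mem_ball_zero_iff, norm_neg, Real.norm_eq_abs, abs_of_nonneg ht.1]
      exact ⟨ht.2.trans_lt ht₀a, ht.2.trans_lt ht₀a⟩
  have hvc : ∀ t, ContinuousAt m t → ContinuousAt v t := fun t h => by
    have : ContinuousAt (fun t => (m t).2) t := continuous_snd.continuousAt.comp h
    exact this.neg.div_const _
  have hwc : ∀ t, ContinuousAt m t → ContinuousAt w t := fun t h => by
    have : ContinuousAt (fun t => (m t).1) t := continuous_fst.continuousAt.comp h
    exact this.div_const _
  have hnc : ∀ {u : ℝ → ℝ} {t : ℝ}, ContinuousAt u (-t) → ContinuousAt (fun t => u (-t)) t :=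
    fun {u t} h => ContinuousAt.comp (g := u) (f := fun t => -t) h continuous_neg.continuousAt
  obtain ⟨σp, τp, vp, hvp, hσpc, hσp, hτp⟩ := exists_branch (v := v) (w := w) ht₀ hC0 ht₀C
    (fun t ht => (hvc t (hball t (hin t ht).1).2).continuousWithinAt)
    (fun t ht => (hwc t (hball t (hin t ht).1).2).continuousWithinAt)
    (hmp.mono (Icc_subset_Icc_right ht₀p))
    (fun t ht => by simpa [abs_of_nonneg ht.1] using (hball t (hin t ht).1).1.1)
    (fun t ht => by simpa [abs_of_nonneg ht.1] using (hball t (hin t ht).1).1.2)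
  -- The half `t ≤ 0` is brought to the same form by `t ↦ -t` and `w ↦ -w`; this is the origin of
  -- the minus sign in the second branch.
  obtain ⟨σm, τm, vm, hvm, hσmc, hσm, hτm⟩ := exists_branch (v := fun t => v (-t))
    (w := fun t => -w (-t)) ht₀ hC0 ht₀C
    (fun t ht => (hnc (hvc _ (hball _ (hin t ht).2).2)).continuousWithinAt)
    (fun t ht => (hnc (hwc _ (hball _ (hin t ht).2).2)).neg.continuousWithinAt)
    (hmm.mono (Icc_subset_Icc_right ht₀m))
    (fun t ht => by simpa [abs_of_nonneg ht.1] using (hball _ (hin t ht).2).1.1)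
    (fun t ht => by
      have := (hball _ (hin t ht).2).1.2
      rw [abs_neg, abs_of_nonneg ht.1] at this
      rw [← abs_neg, show -(-w (-t) - t ^ 3) = w (-t) - (-t) ^ 3 by ring]
      exact this)
  -- For `‖μ‖ < δ₁` the quantity `-μ.2 / (3 * d)` is below the ends of both branches.
  set δ₁ : ℝ := 3 * |d| * min vp vm with hδ₁
  have hx : ∀ μ ∈ Metric.ball (0 : Params) δ₁, -μ.2 / (3 * d) < vp ∧ -μ.2 / (3 * d) < vm :=
    fun μ hμ => by
      rw [mem_ball_zero_iff] at hμ
      have h1 : |μ.2| < 3 * |d| * min vp vm := (norm_snd_le μ).trans_lt hμ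
      have h2 : -μ.2 / (3 * d) ≤ |μ.2| / (3 * |d|) := by
        refine (le_abs_self _).trans_eq ?_
        rw [abs_div, abs_neg, abs_mul]
        norm_num
      have h3 : |μ.2| / (3 * |d|) < min vp vm := by
        rw [div_lt_iff₀ (by positivity)]
        linarith
      exact lt_min_iff.1 (h2.trans_lt h3)
  refine ⟨fun y => σp (-y / (3 * d)), fun y => σm (-y / (3 * d)), t₀, δ₁, ht₀, ht₀2, by positivity,
    isCorrection_of_branch hd (mul_le_mul_of_nonneg_left (min_le_left _ _) (by positivity)) hσpc fun x h =>
      ⟨(hσp x h).1, (hσp x h).2.1⟩,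
    isCorrection_of_branch hd (mul_le_mul_of_nonneg_left (min_le_right _ _) (by positivity)) hσmc fun x h =>
      ⟨(hσm x h).1, (hσm x h).2.1⟩, fun μ hμ => ?_⟩
  obtain ⟨hxp, hxm⟩ := hx μ hμ
  have hm2 : ∀ t, v t = -μ.2 / (3 * d) → (m t).2 = μ.2 := fun t h => by
    simp only [hv] at h
    field_simp at h
    linarith
  have hm1 : ∀ t a, w t = a → (m t).1 = 2 * d * a := fun t a h => by
    rw [← h]; simp only [hw]; field_simp
  constructor
  · rintro ⟨h0, h1 | h1⟩
    · obtain ⟨-, -, h4, h5, h6⟩ := hσp _ ⟨h0, hxp⟩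
      exact ⟨_, by rw [abs_of_nonneg h4.1]; exact h4.2,
        Prod.ext ((hm1 _ _ h6).trans h1.symm) (hm2 _ h5)⟩
    · obtain ⟨-, -, h4, h5, h6⟩ := hσm _ ⟨h0, hxm⟩
      refine ⟨-τm (-μ.2 / (3 * d)), by rw [abs_neg, abs_of_nonneg h4.1]; exact h4.2,
        Prod.ext ?_ (hm2 _ h5)⟩
      rw [hm1 _ _ (neg_eq_iff_eq_neg.1 h6), h1]
      ring
  · rintro ⟨t, ht, rfl⟩
    rcases le_total 0 t with h | h
    · rw [abs_of_nonneg h] at ht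
      obtain ⟨h1, h2⟩ := hτp t ⟨h, ht.le⟩ hxp
      obtain ⟨-, -, -, -, h3⟩ := hσp (v t) ⟨h1, hxp⟩
      rw [h2] at h3
      exact ⟨h1, Or.inl (hm1 _ _ h3)⟩
    · rw [abs_of_nonpos h] at ht
      obtain ⟨h1, h2⟩ := hτm (-t) ⟨neg_nonneg.2 h, ht.le⟩ (by rw [neg_neg]; exact hxm)
      simp only [neg_neg] at h1 h2
      obtain ⟨-, -, -, -, h3⟩ := hσm (v t) ⟨h1, hxm⟩
      rw [h2, neg_neg] at h3
      refine ⟨h1, Or.inr ?_⟩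
      rw [hm1 _ _ (neg_eq_iff_eq_neg.1 h3)]
      simp only [hv]
      ring

/-! ### Generic two-parameter unfolding of a triple zero. -/

section Partial

variable {E : Type*} [NormedAddCommGroup E] [NormedSpace ℝ E]

theorem hasDerivAt_fiber {g : E × ℝ → ℝ} {x : E × ℝ} (hg : DifferentiableAt ℝ g x) :
    HasDerivAt (fun y => g (x.1, y)) (fderiv ℝ g x (0, 1)) x.2 := by
  have h1 : HasDerivAt (fun y : ℝ => (x.1, y)) ((0 : E), (1 : ℝ)) x.2 :=
    (hasDerivAt_const _ _).prodMk (hasDerivAt_id _)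
  exact HasFDerivAt.comp_hasDerivAt (f := fun y : ℝ => (x.1, y)) x.2 hg.hasFDerivAt h1

theorem contDiffOn_fderiv_snd {g : E × ℝ → ℝ} {U : Set (E × ℝ)} (hU : IsOpen U) {n : WithTop ℕ∞}
    (hg : ContDiffOn ℝ (n + 1) g U) : ContDiffOn ℝ n (fun x => fderiv ℝ g x (0, 1)) U :=
  (hg.fderiv_of_isOpen hU le_rfl).clm_apply contDiffOn_const

theorem fderiv_snd_apply {g : E × ℝ → ℝ} {x : E × ℝ} {a : ℝ} (hg : DifferentiableAt ℝ g x)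
    (ha : HasDerivAt (fun y => g (x.1, y)) a x.2) (v : ℝ) : fderiv ℝ g x (0, v) = v * a := by
  rw [ha.unique (hasDerivAt_fiber hg), ← smul_eq_mul, ← map_smul]
  simp

/-- A change of the second variable does not affect the derivative at a critical point. -/
theorem hasFDerivAt_graph {g : E × ℝ → ℝ} {y : E → ℝ} {x : E}
    (hg : DifferentiableAt ℝ g (x, y x)) (hy : DifferentiableAt ℝ y x)
    (h0 : HasDerivAt (fun s => g (x, s)) 0 (y x)) :
    HasFDerivAt (fun ε => g (ε, y ε)) ((fderiv ℝ g (x, y x)).comp (.inl ℝ E ℝ)) x := by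
  have h1 : HasFDerivAt (fun ε => (ε, y ε)) ((ContinuousLinearMap.id ℝ E).prod (fderiv ℝ y x)) x :=
    (hasFDerivAt_id x).prodMk hy.hasFDerivAt
  refine (HasFDerivAt.comp (g := g) (f := fun ε => (ε, y ε)) x hg.hasFDerivAt h1).congr_fderiv
    (ContinuousLinearMap.ext fun v => ?_)
  have h2 : ((v, fderiv ℝ y x v) : E × ℝ) = (v, 0) + (0, fderiv ℝ y x v) := by simp
  change fderiv ℝ g (x, y x) (v, fderiv ℝ y x v) = fderiv ℝ g (x, y x) (v, 0)
  rw [h2, map_add, fderiv_snd_apply hg h0, mul_zero, add_zero]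

end Partial

/-- The parameters of a generic two-parameter unfolding of a triple zero, and the curve of
double zeros, parametrized by the position of the zero. -/
theorem exists_double_zero_curve {n : WithTop ℕ∞} (hn : 2 ≤ n) {g g₁ g₂ g₃ : Params × ℝ → ℝ}
    {U : Set (Params × ℝ)} (hU : IsOpen U) {ym d : ℝ} (h0 : ((0 : Params), ym) ∈ U)
    (hg : ContDiffOn ℝ n g U) (hg₁ : ContDiffOn ℝ n g₁ U) (hg₂ : ContDiffOn ℝ n g₂ U)
    (hg₃ : ContDiffOn ℝ 1 g₃ U) (d₀ : ∀ x ∈ U, HasDerivAt (fun y => g (x.1, y)) (g₁ x) x.2)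
    (d₁ : ∀ x ∈ U, HasDerivAt (fun y => g₁ (x.1, y)) (g₂ x) x.2)
    (d₂ : ∀ x ∈ U, HasDerivAt (fun y => g₂ (x.1, y)) (g₃ x) x.2) (z₀ : g (0, ym) = 0)
    (z₁ : g₁ (0, ym) = 0) (z₂ : g₂ (0, ym) = 0) (z₃ : g₃ (0, ym) = 6 * d) (hd : d ≠ 0)
    (hdet : (fderiv ℝ (fun ε : Params => ((g (ε, ym), g₁ (ε, ym)) : Params)) 0).det ≠ 0) :
    ∃ (par : OpenPartialHomeomorph Params Params) (yM : Params → ℝ) (e : ℝ → Params) (K : ℝ),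
      (0 ∈ par.source ∧ (∀ ε, par ε = (g (ε, yM ε), g₁ (ε, yM ε))) ∧
      (∀ ε ∈ par.source, (ε, yM ε) ∈ U ∧ g₂ (ε, yM ε) = 0) ∧ ContDiffOn ℝ n par par.source ∧
      ContDiffOn ℝ n par.symm par.target ∧ ContDiffOn ℝ n yM par.source ∧ yM 0 = ym) ∧
      e 0 = 0 ∧ 0 ≤ K ∧ ContDiffAt ℝ 2 (fun t => par (e t)) 0 ∧
      (∀ᶠ t in 𝓝 (0 : ℝ), e t ∈ par.source ∧ g (e t, yM (e t) + t) = 0 ∧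
        g₁ (e t, yM (e t) + t) = 0 ∧ |g₂ (e t, yM (e t) + t) - 6 * d * t| ≤ K * |t| ^ 2 ∧
        |(par (e t)).2 + 3 * d * t ^ 2| ≤ K * |t| ^ 3 ∧
        |(par (e t)).1 - 2 * d * t ^ 3| ≤ 2 * K * |t| ^ 4) ∧
      ∀ᶠ p : ℝ × Params in 𝓝 (0, 0), (p.2, yM p.2 + p.1) ∈ U ∧
        (g (p.2, yM p.2 + p.1) = 0 → g₁ (p.2, yM p.2 + p.1) = 0 → p.2 = e p.1) := by
  have hn0 : n ≠ 0 := fun h => by simp [h] at hn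
  have hn1 : 1 ≤ n := le_trans (by norm_num) hn
  have hdiff : ∀ {u : Params × ℝ → ℝ}, ContDiffOn ℝ n u U → DifferentiableAt ℝ u (0, ym) :=
    fun hu => (hu.contDiffAt (hU.mem_nhds h0)).differentiableAt hn0
  have hd6 : 6 * d ≠ 0 := mul_ne_zero (by norm_num) hd
  -- The zero of the second derivative continues because the third derivative is `6 * d ≠ 0`.
  obtain ⟨A, yM, hAo, h0A, hyM, hyM0, hA, -⟩ := exists_smooth_implicit hU hn0 hg₂ h0
    (fderiv ℝ g₂ (0, ym)) (hdiff hg₂).hasFDerivAt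
    (ContinuousLinearEquiv.unitsEquivAut ℝ (Units.mk0 (6 * d) hd6)) fun v => by
      rw [fderiv_snd_apply (hdiff hg₂) (d₂ _ h0), z₃]
      simp
  have hyMd : DifferentiableAt ℝ yM 0 := (hyM.contDiffAt (hAo.mem_nhds h0A)).differentiableAt hn0
  set J : Params →L[ℝ] Params := ((fderiv ℝ g (0, ym)).comp (.inl ℝ Params ℝ)).prod
    ((fderiv ℝ g₁ (0, ym)).comp (.inl ℝ Params ℝ)) with hJ
  -- At the tangency `g₁` and `g₂` vanish, so the derivative of `(g, g₁)` along a graph through `ym`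
  -- does not depend on the graph. The Jacobian assumed at the fixed point `ym` is therefore that of
  -- the new parameters along `yM`.
  have hgr : ∀ y : Params → ℝ, y 0 = ym → DifferentiableAt ℝ y 0 →
      HasFDerivAt (fun ε => ((g (ε, y ε), g₁ (ε, y ε)) : Params)) J 0 := by
    rintro y hy0 hyd
    have e0 := d₀ _ h0
    have e1 := d₁ _ h0
    rw [z₁] at e0
    rw [z₂] at e1
    have k0 := hdiff hg
    have k1 := hdiff hg₁
    rw [hJ]
    rw [← hy0] at e0 e1 k0 k1 ⊢
    exact (hasFDerivAt_graph k0 hyd e0).prodMk (hasFDerivAt_graph k1 hyd e1)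
  rw [(hgr (fun _ => ym) rfl (differentiableAt_const _)).fderiv] at hdet
  set J' := J.toContinuousLinearEquivOfDetNeZero hdet with hJ'
  have hJ'c : (J' : Params →L[ℝ] Params) = J := by ext <;> rfl
  have hPs : ContDiffOn ℝ n (fun ε => ((g (ε, yM ε), g₁ (ε, yM ε)) : Params)) A := by
    have h1 : ContDiffOn ℝ n (fun ε => (ε, yM ε)) A := contDiffOn_id.prodMk hyM
    exact (hg.comp h1 fun x hx => (hA x hx).1).prodMk (hg₁.comp h1 fun x hx => (hA x hx).1)
  have hP := hgr yM hyM0 hyMd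
  obtain ⟨par, h0par, hparA, hpar, hsymm⟩ := exists_smooth_localInverse hAo hn0 hPs h0A J'
    (by rw [hJ'c]; exact hP)
  have hpars : ContDiffOn ℝ n par par.source := (hPs.mono hparA).congr fun x _ => hpar x
  set Φ : ℝ × Params → Params × ℝ := fun p => (p.2, yM p.2 + p.1) with hΦ
  set W : Set (ℝ × Params) := (univ ×ˢ A) ∩ Φ ⁻¹' U with hW
  have hΦs : ContDiffOn ℝ n Φ (univ ×ˢ A) := by
    have h1 : ContDiffOn ℝ n (fun p : ℝ × Params => yM p.2) (univ ×ˢ A) :=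
      hyM.comp contDiffOn_snd fun x hx => hx.2
    exact contDiffOn_snd.prodMk (h1.add contDiffOn_fst)
  have hWo : IsOpen W := hΦs.continuousOn.isOpen_inter_preimage (isOpen_univ.prod hAo) hU
  have hΦ0 : Φ (0, 0) = (0, ym) := by simp [hΦ, hyM0]
  have h0W : ((0 : ℝ), (0 : Params)) ∈ W := ⟨⟨mem_univ _, h0A⟩, by
    change Φ (0, 0) ∈ U
    rwa [hΦ0]⟩
  have hWs : ∀ u : Params × ℝ → ℝ, ContDiffOn ℝ n u U → ContDiffOn ℝ n (fun p => u (Φ p)) W :=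
    fun u hu => hu.comp (hΦs.mono inter_subset_left) fun x hx => hx.2
  set Q : ℝ × Params → Params := fun p => (g (Φ p), g₁ (Φ p)) with hQ
  have hQs : ContDiffOn ℝ n Q W := (hWs g hg).prodMk (hWs g₁ hg₁)
  have hQd : DifferentiableAt ℝ Q (0, 0) :=
    (hQs.contDiffAt (hWo.mem_nhds h0W)).differentiableAt hn0
  have hQ0 : Q (0, 0) = 0 := by
    change (g (Φ (0, 0)), g₁ (Φ (0, 0))) = 0
    rw [hΦ0, z₀, z₁]; rfl
  -- The double zero equations are solved for the parameter as a function of the position `t` of the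
  -- zero. At `t = 0` the derivative in the parameter is `J`, which is invertible.
  obtain ⟨A₂, e, hA₂o, h0A₂, hes, he0, hA₂, huniq⟩ := exists_smooth_implicit hWo hn0 hQs h0W
    (fderiv ℝ Q (0, 0)) hQd.hasFDerivAt J' fun v => by
      rw [← fderiv_fiber hQd v]
      have h1 : (fun z => Q ((0 : ℝ), z)) = fun ε => ((g (ε, yM ε), g₁ (ε, yM ε)) : Params) := by
        funext z; simp [hQ, hΦ]
      change fderiv ℝ (fun z => Q ((0 : ℝ), z)) 0 v = J' v
      rw [h1, hP.fderiv, ← hJ'c]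
      rfl
  have hec : ContDiffAt ℝ n e 0 := hes.contDiffAt (hA₂o.mem_nhds h0A₂)
  have hsrc : ∀ᶠ t in 𝓝 (0 : ℝ), e t ∈ par.source := by
    refine hec.continuousAt.eventually (par.open_source.mem_nhds ?_)
    rwa [he0]
  set Ψ : ℝ × ℝ → Params × ℝ := fun p => (e p.1, yM (e p.1) + p.2) with hΨ
  have hΨ0 : Ψ (0, 0) = (0, ym) := by simp [hΨ, he0, hyM0]
  have hΨs : ContDiffAt ℝ n Ψ (0, 0) := by
    have h1 : ContDiffAt ℝ n (fun p : ℝ × ℝ => e p.1) (0, 0) :=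
      ContDiffAt.comp (g := e) (f := fun p : ℝ × ℝ => p.1) (0, 0) hec contDiffAt_fst
    have h2 : ContDiffAt ℝ n (fun p : ℝ × ℝ => yM (e p.1)) (0, 0) :=
      ContDiffAt.comp (g := yM) (f := fun p : ℝ × ℝ => e p.1) (0, 0)
        (by rw [he0]; exact hyM.contDiffAt (hAo.mem_nhds h0A)) h1
    exact h1.prodMk (h2.add contDiffAt_snd)
  have hΨU : ∀ᶠ p in 𝓝 ((0 : ℝ), (0 : ℝ)), Ψ p ∈ U :=
    hΨs.continuousAt.eventually (hU.mem_nhds (by rwa [hΨ0]))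
  have hg₃Ψ : DifferentiableAt ℝ (fun p => g₃ (Ψ p)) (0, 0) := by
    refine DifferentiableAt.comp (g := g₃) (f := Ψ) (0, 0) ?_ (hΨs.differentiableAt hn0)
    rw [hΨ0]
    exact (hg₃.contDiffAt (hU.mem_nhds h0)).differentiableAt one_ne_zero
  -- The constant `K` bounds the variation of the third derivative: for `|s| ≤ |t|` the deviation
  -- from `6 * d` is at most `K * |t|`. This is the `B` of `cubic_double_zero`.
  obtain ⟨K, hK, hKb⟩ := hg₃Ψ.hasFDerivAt.isBigO_sub.exists_nonneg
  obtain ⟨r, hr, hball⟩ := Metric.eventually_nhds_iff_ball.1 (hΨU.and hKb.bound)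
  refine ⟨par, yM, e, K, ⟨h0par, hpar, fun ε hε => ⟨(hA ε (hparA hε)).1,
    (hA ε (hparA hε)).2.trans z₂⟩, hpars, hsymm, hyM.mono hparA, hyM0⟩, he0, hK, ?_, ?_, ?_⟩
  · refine ContDiffAt.comp (g := par) (f := e) 0 ?_ (hec.of_le hn)
    rw [he0]
    exact (hpars.contDiffAt (par.open_source.mem_nhds h0par)).of_le hn
  · filter_upwards [hsrc, hA₂o.mem_nhds h0A₂, Metric.ball_mem_nhds (0 : ℝ) hr] with t ht htA htr
    have hQt := (hA₂ t htA).2.trans hQ0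
    have e0 : g (e t, yM (e t) + t) = 0 := congrArg Prod.fst hQt
    have e1 : g₁ (e t, yM (e t) + t) = 0 := congrArg Prod.snd hQt
    rw [mem_ball_zero_iff, Real.norm_eq_abs] at htr
    have hb : ∀ s, |s| ≤ |t| → (e t, yM (e t) + s) ∈ U ∧
        |g₃ (e t, yM (e t) + s) - 6 * d| ≤ K * |t| := fun s hs => by
      have hnorm : ‖((t, s) : ℝ × ℝ)‖ = |t| := by
        rw [Prod.norm_def]
        exact max_eq_left hs
      obtain ⟨h1, h2⟩ := hball (t, s) (by
        rw [mem_ball_iff_norm, show ((t, s) : ℝ × ℝ) - (0, 0) = (t, s) by simp, hnorm]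
        exact htr)
      rw [show ((t, s) : ℝ × ℝ) - (0, 0) = (t, s) by simp, hnorm, hΨ0, z₃] at h2
      exact ⟨h1, h2⟩
    obtain ⟨b2, b1, b0⟩ := cubic_double_zero
      (H₀ := fun s => g (e t, yM (e t) + s)) (H₁ := fun s => g₁ (e t, yM (e t) + s))
      (H₂ := fun s => g₂ (e t, yM (e t) + s)) (H₃ := fun s => g₃ (e t, yM (e t) + s))
      (fun s hs => (d₀ _ (hb s hs).1).comp_const_add (yM (e t)) s)
      (fun s hs => (d₁ _ (hb s hs).1).comp_const_add (yM (e t)) s)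
      (fun s hs => (d₂ _ (hb s hs).1).comp_const_add (yM (e t)) s)
      (fun s hs => (hb s hs).2) e0 e1
      (by simpa using (hA (e t) (hparA ht)).2.trans z₂)
    simp only [add_zero] at b1 b0
    refine ⟨ht, e0, e1, b2.trans_eq (by ring), ?_, ?_⟩
    · rw [hpar]
      exact b1.trans_eq (by ring)
    · rw [hpar]
      exact b0.trans_eq (by ring)
  · filter_upwards [huniq, hWo.mem_nhds h0W] with p hp hpW
    exact ⟨hpW.2, fun h1 h2 => (hp ((Prod.ext h1 h2 : Q p = 0).trans hQ0.symm)).2⟩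

/-- The bifurcation curve of double zeros in a generic unfolding of a triple zero. -/
theorem exists_bifurcation_curve {n : WithTop ℕ∞} (hn : 2 ≤ n) {g g₁ g₂ g₃ : Params × ℝ → ℝ}
    {U : Set (Params × ℝ)} (hU : IsOpen U) {ym d : ℝ} (h0 : ((0 : Params), ym) ∈ U)
    (hg : ContDiffOn ℝ n g U) (hg₁ : ContDiffOn ℝ n g₁ U) (hg₂ : ContDiffOn ℝ n g₂ U)
    (hg₃ : ContDiffOn ℝ 1 g₃ U) (d₀ : ∀ x ∈ U, HasDerivAt (fun y => g (x.1, y)) (g₁ x) x.2)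
    (d₁ : ∀ x ∈ U, HasDerivAt (fun y => g₁ (x.1, y)) (g₂ x) x.2)
    (d₂ : ∀ x ∈ U, HasDerivAt (fun y => g₂ (x.1, y)) (g₃ x) x.2) (z₀ : g (0, ym) = 0)
    (z₁ : g₁ (0, ym) = 0) (z₂ : g₂ (0, ym) = 0) (z₃ : g₃ (0, ym) = 6 * d) (hd : d ≠ 0)
    (hdet : (fderiv ℝ (fun ε : Params => ((g (ε, ym), g₁ (ε, ym)) : Params)) 0).det ≠ 0) :
    ∃ (par : OpenPartialHomeomorph Params Params) (yM : Params → ℝ),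
      (0 ∈ par.source ∧ (∀ ε, par ε = (g (ε, yM ε), g₁ (ε, yM ε))) ∧
      (∀ ε ∈ par.source, (ε, yM ε) ∈ U ∧ g₂ (ε, yM ε) = 0) ∧ ContDiffOn ℝ n par par.source ∧
      ContDiffOn ℝ n par.symm par.target ∧ ContDiffOn ℝ n yM par.source ∧ yM 0 = ym ∧
      par 0 = 0) ∧
      ∃ (ρp ρm : ℝ → ℝ) (δ₁ η₁ : ℝ), 0 < δ₁ ∧ 0 < η₁ ∧
        Metric.ball (0 : Params) δ₁ ⊆ par.target ∧ IsCorrection d δ₁ ρp ∧ IsCorrection d δ₁ ρm ∧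
        (∀ μ ∈ Metric.ball (0 : Params) δ₁, ∀ t, |t| < η₁ →
          (par.symm μ, yM (par.symm μ) + t) ∈ U) ∧
        (∀ μ ∈ Metric.ball (0 : Params) δ₁, μ ∈ curveH0 d ρp ρm ↔ ∃ t, |t| < η₁ ∧
          g (par.symm μ, yM (par.symm μ) + t) = 0 ∧ g₁ (par.symm μ, yM (par.symm μ) + t) = 0) ∧
        ∀ μ ∈ Metric.ball (0 : Params) δ₁, ∀ t, |t| < η₁ →
          g (par.symm μ, yM (par.symm μ) + t) = 0 → g₁ (par.symm μ, yM (par.symm μ) + t) = 0 →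
          |d| * t ^ 2 ≤ |μ.2| ∧ (μ ≠ 0 → g₂ (par.symm μ, yM (par.symm μ) + t) ≠ 0) := by
  obtain ⟨par, yM, e, K, ⟨h0par, hpar, hsrc, hps, hpsymm, hyM, hyM0⟩, he0, hK, hm, hcurve, huniq⟩ :=
    exists_double_zero_curve hn hU h0 hg hg₁ hg₂ hg₃ d₀ d₁ d₂ z₀ z₁ z₂ z₃ hd hdet
  have hpar0 : par 0 = 0 := by rw [hpar, hyM0, z₀, z₁]; rfl
  have h0tgt : (0 : Params) ∈ par.target := by
    have := par.map_source h0par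
    rwa [hpar0] at this
  have hsymm0 : par.symm 0 = 0 := by
    have := par.left_inv h0par
    rwa [hpar0] at this
  have hdp : 0 < |d| := abs_pos.2 hd
  -- On this range every error term is at most the fraction `|d|` of its leading term, against
  -- coefficients `3 * |d|` and `6 * |d|`.
  have hKt : ∀ᶠ t in 𝓝 (0 : ℝ), K * |t| ≤ |d| := by
    have : Tendsto (fun t : ℝ => K * |t|) (𝓝 0) (𝓝 0) := by
      have : Continuous fun t : ℝ => K * |t| := by fun_prop
      exact this.tendsto' _ _ (by simp)
    exact (this.eventually (gt_mem_nhds hdp)).mono fun t ht => ht.le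
  obtain ⟨r₁, hr₁, hball₁⟩ := Metric.eventually_nhds_iff_ball.1 (hcurve.and hKt)
  obtain ⟨r₂, hr₂, hball₂⟩ := Metric.eventually_nhds_iff_ball.1 huniq
  obtain ⟨ρp, ρm, η₁, δ', hη, hηr, hδ', hρp, hρm, hiff⟩ := exists_curveH0 (m := fun t => par (e t))
    hd hm hK (hcurve.mono fun t ht => ht.2.2.2.2) (lt_min hr₁ hr₂)
  have hnear : ∀ᶠ μ in 𝓝 (0 : Params), ‖par.symm μ‖ < r₂ ∧ μ ∈ par.target := by
    have h1 : Tendsto par.symm (𝓝 0) (𝓝 0) := by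
      have := (par.continuousAt_symm h0tgt).tendsto
      rwa [hsymm0] at this
    exact (h1.norm.eventually (by simpa using gt_mem_nhds hr₂)).and
      (par.open_target.mem_nhds h0tgt)
  obtain ⟨r₃, hr₃, hball₃⟩ := Metric.eventually_nhds_iff_ball.1 hnear
  have hsub : Metric.ball (0 : Params) (min δ' r₃) ⊆ Metric.ball 0 δ' :=
    Metric.ball_subset_ball (min_le_left _ _)
  have hsub₃ : Metric.ball (0 : Params) (min δ' r₃) ⊆ Metric.ball 0 r₃ :=
    Metric.ball_subset_ball (min_le_right _ _)
  -- By local uniqueness, every double zero at a small offset `t` comes from the parameter `e t`.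
  have hu : ∀ μ ∈ Metric.ball (0 : Params) (min δ' r₃), ∀ t, |t| < η₁ →
      (par.symm μ, yM (par.symm μ) + t) ∈ U ∧ (g (par.symm μ, yM (par.symm μ) + t) = 0 →
        g₁ (par.symm μ, yM (par.symm μ) + t) = 0 → par.symm μ = e t) := fun μ hμ t ht => by
    refine hball₂ (t, par.symm μ) ?_
    rw [mem_ball_iff_norm, show ((t, par.symm μ) : ℝ × Params) - (0, 0) = (t, par.symm μ) by simp,
      Prod.norm_def]
    exact max_lt (ht.trans_le (hηr.trans (min_le_right _ _))) (hball₃ μ (hsub₃ hμ)).1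
  have hc : ∀ t, |t| < η₁ → _ := fun t ht => hball₁ t (by
    rw [mem_ball_zero_iff]
    exact ht.trans_le (hηr.trans (min_le_left _ _)))
  refine ⟨par, yM, ⟨h0par, hpar, hsrc, hps, hpsymm, hyM, hyM0, hpar0⟩, ρp, ρm, min δ' r₃, η₁,
    lt_min hδ' hr₃, hη, fun μ hμ => (hball₃ μ (hsub₃ hμ)).2, hρp.mono (min_le_left _ _),
    hρm.mono (min_le_left _ _), fun μ hμ t ht => (hu μ hμ t ht).1, fun μ hμ => ?_,
    fun μ hμ t ht k0 k1 => ?_⟩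
  · rw [hiff μ (hsub hμ)]
    constructor
    · rintro ⟨t, ht, rfl⟩
      obtain ⟨⟨h1, h2, h3, -⟩, -⟩ := hc t ht
      refine ⟨t, ht, ?_⟩
      rw [par.left_inv h1]
      exact ⟨h2, h3⟩
    · rintro ⟨t, ht, k0, k1⟩
      refine ⟨t, ht, ?_⟩
      rw [← (hu μ hμ t ht).2 k0 k1, par.right_inv (hball₃ μ (hsub₃ hμ)).2]
  · have h1 := (hu μ hμ t ht).2 k0 k1
    have h2 : par (e t) = μ := by rw [← h1, par.right_inv (hball₃ μ (hsub₃ hμ)).2]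
    obtain ⟨⟨-, -, -, b2, b1, -⟩, hKd⟩ := hc t ht
    rw [h2] at b1
    have b3 : K * |t| ^ 3 ≤ |d| * t ^ 2 := by
      rw [← sq_abs t, pow_succ' |t| 2, ← mul_assoc]
      exact mul_le_mul_of_nonneg_right hKd (by positivity)
    refine ⟨?_, fun hμ0 h3 => ?_⟩
    · have h4 : 3 * |d| * t ^ 2 = |(μ.2 + 3 * d * t ^ 2) - μ.2| := by
        rw [add_sub_cancel_left, abs_mul, abs_mul, abs_of_nonneg (sq_nonneg t)]
        norm_num
      have h5 := abs_sub (μ.2 + 3 * d * t ^ 2) μ.2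
      linarith [show 0 ≤ |d| * t ^ 2 by positivity]
    -- The second derivative at the double zero is `6 * d * t` up to `|d| * |t|`, hence nonzero once
    -- `t ≠ 0`.
    · have ht0 : t ≠ 0 := fun h => hμ0 (by rw [← h2, h, he0, hpar0])
      rw [← h1, h3, zero_sub, abs_neg, abs_mul, abs_mul] at b2
      have h4 : K * |t| ^ 2 ≤ |d| * |t| := by
        rw [sq, ← mul_assoc]
        exact mul_le_mul_of_nonneg_right hKd (abs_nonneg t)
      have h5 : |(6 : ℝ)| = 6 := by norm_num
      rw [h5] at b2
      have : 0 < |d| * |t| := mul_pos hdp (abs_pos.2 ht0)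
      linarith

/-! ### Homoclinic orbits close to the given one. -/

namespace AxisChart

variable {k : ℕ∞} {f : Params → Equiv.Perm Plane}
  {Θ : OpenPartialHomeomorph (Params × Plane) (Params × Plane)} {δ R κ : ℝ}

/-- Where the splitting function vanishes, the image of `W^u_loc` meets `W^s_loc`. -/
theorem apply_pow_eq_of_splitting (h : AxisChart k f Θ δ R κ) {q : ℕ} {ε : Params} {y : ℝ}
    (hsrc : (ε, (f ε ^ q) (atPoint Θ ε (0, y))) ∈ Θ.source) (hs : splitting f Θ q ε y = 0) :
    |(Θ (ε, (f ε ^ q) (atPoint Θ ε (0, y)))).2.1| < R ∧ (f ε ^ q) (atPoint Θ ε (0, y)) =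
      atPoint Θ ε ((Θ (ε, (f ε ^ q) (atPoint Θ ε (0, y)))).2.1, 0) := by
  obtain ⟨-, h1, h2⟩ := h.apply_mem hsrc
  refine ⟨(norm_fst_le _).trans_lt h1, ?_⟩
  exact h2.symm.trans (congrArg _ (Prod.ext rfl hs))

/-- A zero of the splitting function puts the image on the stable axis, and it comes from the
unstable one. It is not the saddle because the iterate is injective, fixes the saddle, and starts
from a point with `y ≠ 0`. -/
theorem exists_isHomoclinic (h : AxisChart k f Θ δ R κ) (hk : 1 ≤ k) (q : ℕ) :
    ∃ δ' > 0, ∀ ε : Params, ‖ε‖ < δ' → ∀ y : ℝ, |y| < R → y ≠ 0 →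
      (ε, (f ε ^ q) (atPoint Θ ε (0, y))) ∈ Θ.source → splitting f Θ q ε y = 0 →
      IsHomoclinic (f ε) (atPoint Θ ε 0) ((f ε ^ q) (atPoint Θ ε (0, y))) := by
  obtain ⟨δ₁, hδ₁, hδ₁', hc₁⟩ := h.exists_uniform_contraction hk
  obtain ⟨δ₂, hδ₂, hδ₂', hc₂⟩ := h.swap.exists_uniform_contraction hk
  refine ⟨min δ₁ δ₂, lt_min hδ₁ hδ₂, fun ε hε y hy hy0 hsrc hs => ⟨fun he => hy0 ?_, ?_, ?_⟩⟩
  · have hεδ : ‖ε‖ < δ := (hε.trans_le (min_le_left _ _)).trans_le hδ₁'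
    have h1 : (f ε ^ q) (atPoint Θ ε 0) = atPoint Θ ε 0 :=
      Equiv.Perm.pow_apply_eq_self_of_apply_eq_self (h.fixed hεδ) q
    have h2 := (f ε ^ q).injective (he.trans h1.symm)
    have h3 := h.apply_atPoint hεδ (norm_axis_lt' hy)
    rw [h2, h.apply_atPoint hεδ (by simpa using h.R_pos)] at h3
    exact (congrArg (fun x : Params × Plane => x.2.2) h3).symm
  · refine Metric.tendsto_atTop.2 fun η hη => ?_
    obtain ⟨N, hN⟩ := hc₂ (-q) η hη
    refine ⟨N, fun n hn => ?_⟩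
    have := hN n hn ε (hε.trans_le (min_le_right _ _)) y hy
    rw [inv_zpow_neg, zpow_natCast] at this
    rw [symm_pow_eq]
    exact this
  · obtain ⟨hx, hz⟩ := h.apply_pow_eq_of_splitting hsrc hs
    refine Metric.tendsto_atTop.2 fun η hη => ?_
    obtain ⟨N, hN⟩ := hc₁ 0 η hη
    refine ⟨N, fun n hn => ?_⟩
    have := hN n hn ε (hε.trans_le (min_le_left _ _)) _ hx
    rw [← hz] at this
    exact this

/-- The homoclinic orbits near a given one are uniformly close to it. -/
theorem eventually_dist_homoclinic_lt (h : AxisChart k f Θ δ R κ) (hk : 1 ≤ k) {q : ℕ} {ym xp : ℝ}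
    (hym : |ym| < R) (hxp : |xp| < R)
    (hq : (f 0 ^ q) (atPoint Θ 0 (0, ym)) = atPoint Θ 0 (xp, 0)) {η : ℝ} (hη : 0 < η) :
    ∀ᶠ x : Params × ℝ in 𝓝 (0, ym), splitting f Θ q x.1 x.2 = 0 → ∀ n : ℤ,
      dist ((f x.1 ^ n) ((f x.1 ^ q) (atPoint Θ x.1 (0, x.2))))
        ((f 0 ^ n) ((f 0 ^ q) (atPoint Θ 0 (0, ym)))) < η := by
  have h0 : ‖(0 : Params)‖ < δ := by simpa using h.δ_pos
  have hline : ContinuousAt (fun x : Params × ℝ => (x.1, ((0, x.2) : Plane))) (0, ym) := by fun_prop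
  have hpow : ∀ i : ℕ, ContinuousAt (fun x : Params × ℝ => (f x.1 ^ i) (atPoint Θ x.1 (0, x.2)))
      (0, ym) := fun i => by
    have := ContinuousAt.comp (f := fun x : Params × ℝ => (x.1, ((0, x.2) : Plane)))
      (x := ((0 : Params), ym))
      (h.contDiffAt_zpow_atPoint (i : ℤ) h0 (norm_axis_lt' hym)).continuousAt hline
    simpa [Function.comp_def] using this
  have hsrc0 : ((0 : Params), (f 0 ^ q) (atPoint Θ 0 (0, ym))) ∈ Θ.source := by
    rw [hq]
    exact h.mem_source h0 (norm_axis_lt hxp)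
  have hgraph : ContinuousAt (fun x : Params × ℝ => (x.1, (f x.1 ^ q) (atPoint Θ x.1 (0, x.2))))
      (0, ym) := continuousAt_fst.prodMk (hpow q)
  have hsrc := hgraph.eventually (Θ.open_source.mem_nhds hsrc0)
  have hX : ContinuousAt (fun x : Params × ℝ =>
      (x.1, (Θ (x.1, (f x.1 ^ q) (atPoint Θ x.1 (0, x.2)))).2.1)) (0, ym) := by
    have h1 : ContinuousAt (fun x : Params × ℝ => Θ (x.1, (f x.1 ^ q) (atPoint Θ x.1 (0, x.2))))
        (0, ym) := ContinuousAt.comp (g := Θ)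
      (f := fun x : Params × ℝ => (x.1, (f x.1 ^ q) (atPoint Θ x.1 (0, x.2))))
      (Θ.continuousAt hsrc0) hgraph
    exact continuousAt_fst.prodMk (continuous_fst.comp continuous_snd |>.continuousAt.comp h1)
  have hX0 : Tendsto (fun x : Params × ℝ =>
      (x.1, (Θ (x.1, (f x.1 ^ q) (atPoint Θ x.1 (0, x.2)))).2.1)) (𝓝 (0, ym)) (𝓝 (0, xp)) := by
    have := hX.tendsto
    simp only [hq, h.apply_atPoint h0 (norm_axis_lt hxp)] at this
    exact this
  -- Times `n ≥ 0` belong to the stable tail, times `n < -q` to the unstable tail, and the finitely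
  -- many in between are handled by continuity.
  have hfwd := hX0.eventually (h.eventually_dist_orbit_lt hk hxp hη)
  have hbwd := h.swap.eventually_dist_orbit_lt hk hym hη
  have hmid : ∀ᶠ x : Params × ℝ in 𝓝 (0, ym), ∀ i ∈ Finset.range (q + 1),
      dist ((f x.1 ^ i) (atPoint Θ x.1 (0, x.2))) ((f 0 ^ i) (atPoint Θ 0 (0, ym))) < η :=
    (Finset.eventually_all _).2 fun i _ => (hpow i).eventually (Metric.ball_mem_nhds _ hη)
  filter_upwards [hsrc, hfwd, hbwd, hmid] with x hsx hfx hbx hmx hs n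
  obtain ⟨-, hz⟩ := h.apply_pow_eq_of_splitting hsx hs
  rcases le_or_gt 0 n with hn | hn
  · lift n to ℕ using hn
    rw [zpow_natCast, zpow_natCast, hq, hz]
    exact hfx n
  · have hadd : ∀ (g : Equiv.Perm Plane) (z : Plane), (g ^ n) ((g ^ q) z) = (g ^ (n + q)) z :=
      fun g z => by rw [zpow_add, Equiv.Perm.mul_apply, zpow_natCast]
    rw [hadd, hadd]
    rcases le_or_gt 0 (n + q) with hnq | hnq
    · obtain ⟨i, hi⟩ := Int.eq_ofNat_of_zero_le hnq
      rw [hi, zpow_natCast, zpow_natCast]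
      exact hmx i (Finset.mem_range.2 (by omega))
    · obtain ⟨i, hi⟩ := Int.eq_ofNat_of_zero_le (neg_nonneg.2 hnq.le)
      have hi' : n + (q : ℤ) = -(i : ℤ) := by omega
      have := hbx i
      rw [← zpow_natCast, ← zpow_natCast, inv_zpow', inv_zpow'] at this
      rw [hi']
      exact this

end AxisChart

/-! ### Smoothness of the splitting function and proof of the theorem. -/

/-- Two derivatives in `y` cost two orders of smoothness, which is where `k - 2` comes from. The
condition `4 ≤ k` leaves at least `C²` for the second derivative and `C¹` for the third. -/
theorem exists_partials {E : Type*} [NormedAddCommGroup E] [NormedSpace ℝ E] {k : ℕ∞} (hk : 4 ≤ k)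
    {g : E × ℝ → ℝ} {U : Set (E × ℝ)} (hU : IsOpen U) (hg : ContDiffOn ℝ k g U) :
    ∃ g₁ g₂ g₃ : E × ℝ → ℝ, ContDiffOn ℝ (k - 2 : ℕ∞) g U ∧ ContDiffOn ℝ (k - 2 : ℕ∞) g₁ U ∧
      ContDiffOn ℝ (k - 2 : ℕ∞) g₂ U ∧ ContDiffOn ℝ 1 g₃ U ∧
      ∀ x ∈ U, HasDerivAt (fun y => g (x.1, y)) (g₁ x) x.2 ∧
        HasDerivAt (fun y => g₁ (x.1, y)) (g₂ x) x.2 ∧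
        HasDerivAt (fun y => g₂ (x.1, y)) (g₃ x) x.2 ∧
        deriv (fun y => g (x.1, y)) x.2 = g₁ x ∧ iteratedDeriv 2 (fun y => g (x.1, y)) x.2 = g₂ x ∧
        iteratedDeriv 3 (fun y => g (x.1, y)) x.2 = g₃ x := by
  obtain ⟨n, rfl⟩ := exists_add_of_le hk
  -- Writing `k = 4 + n` avoids truncated subtraction and covers `k = ∞`.
  have hk2 : 4 + n - 2 = 2 + n := by
    rw [show (4 : ℕ∞) + n = (2 + n) + 2 by rw [add_right_comm]; norm_num]
    exact (ENat.addLECancellable_of_ne_top (by simp)).add_tsub_cancel_right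
  rw [hk2]
  have hg' : ContDiffOn ℝ (((2 + n : ℕ∞) : WithTop ℕ∞) + 1 + 1) g U := hg.of_le (by
    refine WithTop.coe_le_coe.2 (?_ : 2 + n + 1 + 1 ≤ 4 + n)
    rw [add_assoc, add_right_comm]; norm_num)
  set g₁ : E × ℝ → ℝ := fun x => fderiv ℝ g x (0, 1) with hg₁
  set g₂ : E × ℝ → ℝ := fun x => fderiv ℝ g₁ x (0, 1) with hg₂
  set g₃ : E × ℝ → ℝ := fun x => fderiv ℝ g₂ x (0, 1) with hg₃
  have s₁ : ContDiffOn ℝ (((2 + n : ℕ∞) : WithTop ℕ∞) + 1) g₁ U := contDiffOn_fderiv_snd hU hg'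
  have s₂ : ContDiffOn ℝ (2 + n : ℕ∞) g₂ U := contDiffOn_fderiv_snd hU s₁
  have s₃ : ContDiffOn ℝ 1 g₃ U := contDiffOn_fderiv_snd hU (s₂.of_le (by
    refine WithTop.coe_le_coe.2 (?_ : (1 + 1 : ℕ∞) ≤ 2 + n)
    rw [one_add_one_eq_two]; exact le_self_add))
  have hdiff : ∀ {u : E × ℝ → ℝ} {m : WithTop ℕ∞}, 1 ≤ m → ContDiffOn ℝ m u U → ∀ x ∈ U,
      HasDerivAt (fun y => u (x.1, y)) (fderiv ℝ u x (0, 1)) x.2 := fun hm hu x hx =>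
    hasDerivAt_fiber ((hu.contDiffAt (hU.mem_nhds hx)).differentiableAt
      (ENat.one_le_iff_ne_zero_withTop.1 hm))
  have d₀ : ∀ x ∈ U, HasDerivAt (fun y => g (x.1, y)) (g₁ x) x.2 := hdiff le_add_self hg'
  have d₁ : ∀ x ∈ U, HasDerivAt (fun y => g₁ (x.1, y)) (g₂ x) x.2 := hdiff le_add_self s₁
  have d₂ : ∀ x ∈ U, HasDerivAt (fun y => g₂ (x.1, y)) (g₃ x) x.2 := hdiff (by
    refine WithTop.coe_le_coe.2 (?_ : (1 : ℕ∞) ≤ 2 + n)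
    exact le_trans (by norm_num) le_self_add) s₂
  have hev : ∀ x ∈ U, ∀ᶠ y in 𝓝 x.2, (x.1, y) ∈ U := fun x hx =>
    (show ContinuousAt (fun y : ℝ => (x.1, y)) x.2 by fun_prop).eventually (hU.mem_nhds hx)
  have e₂ : ∀ x ∈ U, iteratedDeriv 2 (fun y => g (x.1, y)) x.2 = g₂ x := fun x hx => by
    rw [iteratedDeriv_succ, iteratedDeriv_one, ← (d₁ x hx).deriv]
    refine EventuallyEq.deriv_eq ?_
    filter_upwards [hev x hx] with y hy
    exact (d₀ _ hy).deriv
  refine ⟨g₁, g₂, g₃, (hg'.of_le le_self_add).of_le le_self_add, s₁.of_le le_self_add, s₂, s₃,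
    fun x hx => ⟨d₀ x hx, d₁ x hx, d₂ x hx, (d₀ x hx).deriv, e₂ x hx, ?_⟩⟩
  rw [iteratedDeriv_succ, ← (d₂ x hx).deriv]
  refine EventuallyEq.deriv_eq ?_
  filter_upwards [hev x hx] with y hy
  exact e₂ _ hy

theorem proposition1 (r : ℕ∞) (hr : 5 ≤ r) (V : Set Params) (f : Params → Equiv.Perm Plane)
    (hf : IsSymplecticFamily r V f)
    (O : Plane) (lam : ℝ) (hO : IsSaddle (f 0) O lam)
    (M : Plane) (hM : IsHomoclinic (f 0) O M) (hB : CubicTangency (f 0) O M)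
    (hC : UnfoldsGenerally f O M) :
    -- adapted coordinates, with two homoclinic points in their domain, exist
    (∃ (Θ : OpenPartialHomeomorph (Params × Plane) (Params × Plane)) (δ R : ℝ)
        (j : ℤ) (q : ℕ) (ym xp : ℝ),
      IsAdaptedChart r V f O Θ δ R ∧ IsGlobalMapData f M Θ R j q ym xp) ∧
    -- and in any such coordinates the following holds
    ∀ (k : ℕ∞), 4 ≤ k → k ≤ r →
    ∀ (Θ : OpenPartialHomeomorph (Params × Plane) (Params × Plane)) (δ R : ℝ)
        (j : ℤ) (q : ℕ) (ym xp d : ℝ),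
      IsAdaptedChart k V f O Θ δ R → IsGlobalMapData f M Θ R j q ym xp →
      6 * d = iteratedDeriv 3 (splitting f Θ q 0) ym →
      d ≠ 0 ∧
      ∃ (par : OpenPartialHomeomorph Params Params) (yM : Params → ℝ),
        IsSplittingParameter k f Θ δ q ym par yM ∧
        ∃ (ρp ρm : ℝ → ℝ) (δ₁ η₁ : ℝ), 0 < δ₁ ∧ 0 < η₁ ∧
          Metric.ball (0 : Params) δ₁ ⊆ par.target ∧
          IsCorrection d δ₁ ρp ∧ IsCorrection d δ₁ ρm ∧
          -- the curve consists of the parameters for which `T₁(W^u_loc)` touches `W^s_loc`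
          (∀ μ ∈ Metric.ball (0 : Params) δ₁, μ ∈ curveH0 d ρp ρm ↔
            ∃ t : ℝ, |t| < η₁ ∧
              splitting f Θ q (par.symm μ) (yM (par.symm μ) + t) = 0 ∧
              deriv (splitting f Θ q (par.symm μ)) (yM (par.symm μ) + t) = 0) ∧
          -- on the curve there is a homoclinic orbit close to the original one, whose tangency
          -- is quadratic for `μ ≠ 0` and cubic for `μ = 0`
          ∃ z : Params → Plane,
            (∀ μ ∈ Metric.ball (0 : Params) δ₁, μ ∈ curveH0 d ρp ρm →
              IsHomoclinic (f (par.symm μ)) (atPoint Θ (par.symm μ) 0) (z μ) ∧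
              (μ ≠ 0 → ∀ n : ℤ, QuadraticTangency (f (par.symm μ))
                (atPoint Θ (par.symm μ) 0) ((f (par.symm μ) ^ n) (z μ))) ∧
              (μ = 0 → ∀ n : ℤ, CubicTangency (f (par.symm μ))
                (atPoint Θ (par.symm μ) 0) ((f (par.symm μ) ^ n) (z μ)))) ∧
            ∀ η > 0, ∃ δ₂ > 0, ∀ μ ∈ Metric.ball (0 : Params) δ₂, μ ∈ curveH0 d ρp ρm →
              ∀ n : ℤ, dist ((f (par.symm μ) ^ n) (z μ)) ((f 0 ^ (n + (j + q))) M) < η := by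
  have hr1 : 1 ≤ r := le_trans (by norm_num) hr
  refine ⟨exists_adaptedChart_globalMapData hr1 hf hO hM, ?_⟩
  intro k hk hkr Θ δ R j q ym xp d hΘ hD hd6
  have hk1 : 1 ≤ k := le_trans (by norm_num) hk
  have hk2 : 2 ≤ k := le_trans (by norm_num) hk
  have hk3 : 3 ≤ k := le_trans (by norm_num) hk
  obtain ⟨κ, h⟩ := hΘ.exists_axisChart hkr hr1 hf
  have hδ := h.δ_pos
  have h0 : ‖(0 : Params)‖ < δ := by simpa using hδ
  obtain ⟨hz, hz3⟩ := h.splitting_of_cubicTangency hk3 hΘ.origin hD hB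
  have hJ := h.splitting_jacobian_ne_zero hk2 hΘ.origin hD hC
  obtain ⟨hym, hxp, hm, hp⟩ := hD
  have hd : d ≠ 0 := fun hd => hz3 (by rw [← hd6, hd, mul_zero])
  have hq : (f 0 ^ q) (atPoint Θ 0 (0, ym)) = atPoint Θ 0 (xp, 0) := by
    rw [hm, hp, add_comm, zpow_add, Equiv.Perm.mul_apply, zpow_natCast]
  -- If `M⁻` were the saddle, then so would be `M`.
  have hym0 : ym ≠ 0 := fun hy => hM.1 (by
    have h1 : (f 0 ^ j) O = O := Equiv.Perm.zpow_apply_eq_self_of_apply_eq_self hO.fixed j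
    refine (f 0 ^ j).injective ?_
    rw [h1, ← hm, hy]
    exact hΘ.origin)
  refine ⟨hd, ?_⟩
  obtain ⟨δc, hδc, hcontact⟩ := h.exists_hasContact hk3 q
  obtain ⟨δh, hδh, hhom⟩ := h.exists_isHomoclinic hk1 q
  have hev : ∀ᶠ x : Params × ℝ in 𝓝 (0, ym), ‖x.1‖ < δ ∧ ‖x.1‖ < δc ∧ ‖x.1‖ < δh ∧ |x.2| < R ∧
      x.2 ≠ 0 ∧ (x.1, (f x.1 ^ q) (atPoint Θ x.1 (0, x.2))) ∈ Θ.source := by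
    have hnorm : ∀ b > 0, ∀ᶠ x : Params × ℝ in 𝓝 (0, ym), ‖x.1‖ < b := fun b hb =>
      (show ContinuousAt (fun x : Params × ℝ => ‖x.1‖) (0, ym) by fun_prop).eventually
        (gt_mem_nhds (by simpa using hb))
    have habs : ∀ᶠ x : Params × ℝ in 𝓝 (0, ym), |x.2| < R :=
      (show ContinuousAt (fun x : Params × ℝ => |x.2|) (0, ym) by fun_prop).eventually
        (gt_mem_nhds hym)
    have hne : ∀ᶠ x : Params × ℝ in 𝓝 (0, ym), x.2 ≠ 0 :=
      (show ContinuousAt (fun x : Params × ℝ => x.2) (0, ym) by fun_prop).eventually_ne hym0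
    have hgraph : ContinuousAt (fun x : Params × ℝ =>
        (x.1, (f x.1 ^ q) (atPoint Θ x.1 (0, x.2)))) (0, ym) := by
      have := ContinuousAt.comp (f := fun x : Params × ℝ => (x.1, ((0, x.2) : Plane)))
        (x := ((0 : Params), ym))
        (h.contDiffAt_zpow_atPoint (q : ℤ) h0 (AxisChart.norm_axis_lt' hym)).continuousAt (by fun_prop)
      simp only [zpow_natCast, Function.comp_def] at this
      exact continuousAt_fst.prodMk this
    have hsrc := hgraph.eventually (Θ.open_source.mem_nhds (by
      simp only [hq]
      exact h.mem_source h0 (AxisChart.norm_axis_lt hxp)))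
    filter_upwards [hnorm δ hδ, hnorm δc hδc, hnorm δh hδh, habs, hne, hsrc] with x a b c a' b' c'
    exact ⟨a, b, c, a', b', c'⟩
  -- On this open set the splitting function is smooth, and the contact and homoclinicity statements
  -- apply.
  obtain ⟨U, hUsub, hUo, hU0⟩ := mem_nhds_iff.1 hev
  have hS : ContDiffOn ℝ k (fun x : Params × ℝ => splitting f Θ q x.1 x.2) U := fun x hx => by
    obtain ⟨a, -, -, b, -, c⟩ := hUsub hx
    have h1 := h.contDiffAt_transition q a (AxisChart.norm_axis_lt' b) (by rw [zpow_natCast]; exact c)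
    simp only [zpow_natCast] at h1
    have h2 : ContDiffAt ℝ k (fun x : Params × ℝ => (x.1, ((0, x.2) : Plane))) x := by fun_prop
    exact (contDiff_snd.contDiffAt.comp x (ContDiffAt.comp
      (g := fun x : Params × Plane => (Θ (x.1, (f x.1 ^ q) (atPoint Θ x.1 x.2))).2)
      (f := fun x : Params × ℝ => (x.1, ((0, x.2) : Plane))) x h1 h2)).contDiffWithinAt
  obtain ⟨g₁, g₂, g₃, s₀, s₁, s₂, s₃, hg⟩ := exists_partials hk hUo hS
  have e₁ : ∀ x ∈ U, deriv (splitting f Θ q x.1) x.2 = g₁ x := fun x hx => (hg x hx).2.2.2.1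
  have e₂ : ∀ x ∈ U, iteratedDeriv 2 (splitting f Θ q x.1) x.2 = g₂ x := fun x hx =>
    (hg x hx).2.2.2.2.1
  have e₃ : ∀ x ∈ U, iteratedDeriv 3 (splitting f Θ q x.1) x.2 = g₃ x := fun x hx =>
    (hg x hx).2.2.2.2.2
  have hJ' : (fderiv ℝ (fun ε : Params =>
      ((splitting f Θ q ε ym, g₁ (ε, ym)) : Params)) 0).det ≠ 0 := by
    rw [EventuallyEq.fderiv_eq (f := fun ε : Params =>
      ((splitting f Θ q ε ym, g₁ (ε, ym)) : Params))] at hJ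
    · exact hJ
    · filter_upwards [(show ContinuousAt (fun ε : Params => (ε, ym)) 0 by fun_prop).eventually
        (hUo.mem_nhds hU0)] with ε hε
      exact Prod.ext rfl (e₁ _ hε)
  have hn : (2 : WithTop ℕ∞) ≤ ((k - 2 : ℕ∞) : WithTop ℕ∞) :=
    WithTop.coe_le_coe.2 
      ((ENat.addLECancellable_of_ne_top (by simp)).le_tsub_of_add_le_right
        (le_trans (by norm_num) hk) : (2 : ℕ∞) ≤ k - 2)
  obtain ⟨par, yM, ⟨h0par, hpar, hsrc, hps, hpsymm, hyM, hyM0, hpar0⟩, ρp, ρm, δ₁, η₁, hδ₁, hη₁,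
    htgt, hρp, hρm, hmemU, hiff, hquad⟩ := exists_bifurcation_curve hn hUo hU0 s₀ s₁ s₂ s₃
      (fun x hx => (hg x hx).1) (fun x hx => (hg x hx).2.1) (fun x hx => (hg x hx).2.2.1)
      (by simpa using hz 0 (by norm_num))
      (by rw [← e₁ _ hU0]; simpa using hz 1 (by norm_num))
      (by rw [← e₂ _ hU0]; exact hz 2 le_rfl) (by rw [← e₃ _ hU0]; exact hd6.symm) hd hJ'
  have h0tgt : (0 : Params) ∈ par.target := by
    have := par.map_source h0par
    rwa [hpar0] at this
  have hsymm0 : par.symm 0 = 0 := by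
    have := par.left_inv h0par
    rwa [hpar0] at this
  -- A double zero is selected for each `μ` on the curve; the value `0` elsewhere is never used.
  have hτex : ∀ μ : Params, ∃ t, μ ∈ Metric.ball (0 : Params) δ₁ → μ ∈ curveH0 d ρp ρm →
      |t| < η₁ ∧ splitting f Θ q (par.symm μ) (yM (par.symm μ) + t) = 0 ∧
        g₁ (par.symm μ, yM (par.symm μ) + t) = 0 := fun μ => by
    by_cases hμ : μ ∈ Metric.ball (0 : Params) δ₁ ∧ μ ∈ curveH0 d ρp ρm
    · obtain ⟨t, ht⟩ := (hiff μ hμ.1).1 hμ.2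
      exact ⟨t, fun _ _ => ht⟩
    · exact ⟨0, fun h1 h2 => absurd ⟨h1, h2⟩ hμ⟩
  choose τ hτ using hτex
  have hτb : ∀ μ ∈ Metric.ball (0 : Params) δ₁, μ ∈ curveH0 d ρp ρm → |d| * τ μ ^ 2 ≤ |μ.2| :=
    fun μ hμ hc => by
      obtain ⟨a, b, c⟩ := hτ μ hμ hc
      exact (hquad μ hμ _ a b c).1
  have hdp : 0 < |d| := abs_pos.2 hd
  refine ⟨par, yM, ⟨h0par, hpar0, fun ε hε => by
      simpa using (hUsub (hsrc ε hε).1).1, hps, hpsymm, hyM0, hyM,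
      fun ε _ => by rw [hpar], fun ε hε => by rw [hpar]; exact (e₁ _ (hsrc ε hε).1).symm,
      fun ε hε => (e₂ _ (hsrc ε hε).1).trans (hsrc ε hε).2⟩,
    ρp, ρm, δ₁, η₁, hδ₁, hη₁, htgt, hρp, hρm, fun μ hμ => ?_,
    fun μ => (f (par.symm μ) ^ q) (atPoint Θ (par.symm μ) (0, yM (par.symm μ) + τ μ)),
    fun μ hμ hc => ?_, fun η hη => ?_⟩
  · rw [hiff μ hμ]
    refine exists_congr fun t => and_congr_right fun ht => and_congr_right fun _ => ?_
    rw [← e₁ _ (hmemU μ hμ t ht)]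
  · obtain ⟨ht, k0, k1⟩ := hτ μ hμ hc
    have hU := hmemU μ hμ _ ht
    obtain ⟨-, uc, uh, uR, u0, us⟩ := hUsub hU
    refine ⟨hhom _ uh _ uR u0 us k0, fun hμ0 => ?_, fun hμ0 => ?_⟩
    · refine hcontact _ uc _ uR us 1 (by norm_num) (fun i hi => ?_) ?_
      · interval_cases i
        · simpa using k0
        · rw [iteratedDeriv_one]
          exact (e₁ _ hU).trans k1
      · exact fun h2 => (hquad μ hμ _ ht k0 k1).2 hμ0 ((e₂ _ hU).symm.trans h2)
    -- At `μ = 0` the bound `|d| * τ² ≤ |μ₂|` leaves only the original triple zero.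
    · have hτ0 : τ μ = 0 := by
        have := hτb μ hμ hc
        rw [hμ0, Prod.snd_zero, abs_zero] at this
        have h2 : τ 0 ^ 2 = 0 := le_antisymm (by nlinarith) (sq_nonneg _)
        rw [hμ0]
        exact pow_eq_zero_iff (two_ne_zero) |>.1 h2
      refine hcontact _ uc _ uR us 2 le_rfl ?_ ?_
      · rw [hτ0, hμ0, hsymm0, hyM0, add_zero]
        exact hz
      · rw [hτ0, hμ0, hsymm0, hyM0, add_zero]
        exact hz3
  -- The same bound gives `|τ μ| ≤ √(|μ₂| / |d|)`. So the selected zero tends to `ym` along the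
  -- curve, although the selection need not be continuous.
  · have hτ0 : Tendsto τ (𝓝[curveH0 d ρp ρm] 0) (𝓝 0) := by
      have h1 : Tendsto (fun μ : Params => √(|μ.2| / |d|)) (𝓝[curveH0 d ρp ρm] 0) (𝓝 0) := by
        have : Continuous (fun μ : Params => √(|μ.2| / |d|)) := by fun_prop
        exact (this.tendsto' 0 0 (by simp)).mono_left nhdsWithin_le_nhds
      refine squeeze_zero_norm' ?_ h1
      filter_upwards [self_mem_nhdsWithin, mem_nhdsWithin_of_mem_nhds
        (Metric.ball_mem_nhds (0 : Params) hδ₁)] with μ hc hμ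
      refine Real.abs_le_sqrt ?_
      rw [le_div_iff₀ hdp, mul_comm]
      exact hτb μ hμ hc
    have hs0 : Tendsto par.symm (𝓝[curveH0 d ρp ρm] 0) (𝓝 0) := by
      have := (par.continuousAt_symm h0tgt).tendsto
      rw [hsymm0] at this
      exact this.mono_left nhdsWithin_le_nhds
    have hy0 : Tendsto yM (𝓝 0) (𝓝 ym) := by
      have := (hyM.continuousOn.continuousAt (par.open_source.mem_nhds h0par)).tendsto
      rwa [hyM0] at this
    have hlim : Tendsto (fun μ => (par.symm μ, yM (par.symm μ) + τ μ))
        (𝓝[curveH0 d ρp ρm] 0) (𝓝 (0, ym)) := by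
      have := hs0.prodMk_nhds ((hy0.comp hs0).add hτ0)
      rwa [add_zero] at this
    have hclose := eventually_nhdsWithin_iff.1
      (hlim.eventually (h.eventually_dist_homoclinic_lt hk1 hym hxp hq hη))
    obtain ⟨δ₂, hδ₂, hball⟩ := Metric.eventually_nhds_iff_ball.1 hclose
    refine ⟨min δ₁ δ₂, lt_min hδ₁ hδ₂, fun μ hμ hc n => ?_⟩
    have h1 := hball μ (Metric.ball_subset_ball (min_le_right _ _) hμ) hc
      (hτ μ (Metric.ball_subset_ball (min_le_left _ _) hμ) hc).2.1 n
    rw [zpow_add, Equiv.Perm.mul_apply, ← hp, ← hq]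
    exact h1
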